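/- **Setting.** Let $(\varepsilon_t)_{t\in\mathbb Z}$ be i.i.d. real random variables, $\Theta\subset\mathbb R^d$ compact, $\theta_0:[0,1]\to\Theta$, and for each $\theta\in\Theta$ let $(\varepsilon,y)\mapsto\tilde G_\varepsilon(y,\theta)$ be a measurable function $\mathbb R\times\mathbb R^p\to\mathbb R$; put $G_\varepsilon(y,u):=\tilde G_\varepsilon(y,\theta_0(u))$. For $u\in[0,1]$ let $\tilde X_t(u)=H(u,(\varepsilon_t,\varepsilon_{t-1},\dots))$, with $H(u,\cdot)$ measurable, be the causal stationary solution of $$\tilde X_t(u)=G_{\varepsilon_t}(\tilde X_{t-1}(u),\dots,\tilde X_{t-p}(u),u)\ \text{ a.s.},\qquad t\in\mathbb Z,$$ and let $X_{t,n}$, $t\le n$, satisfy $X_{t,n}=G_{\varepsilon_t}(X_{t-1,n},\dots,X_{t-p,n},\max(t/n,0))$ a.s., with $X_{t,n}=\tilde X_t(0)$ a.s. for $t\le 0$. Write $Y_{t-1,n}=(X_{t-1,n},\dots,X_{t-p,n})$, $\tilde Y_{t-1}(u)=(\tilde X_{t-1}(u),\dots,\tilde X_{t-p}(u))$, $|z|_1=\sum_i|z_i|$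 and $\|W\|_q=(\mathbb E|W|^q)^{1/q}$. *Conditions with exponent $q>0$* (where $q'=\min\{q,1\}$): * (L1) There are $\chi\in\mathbb R^p_{\ge0}$ with $\sum_i\chi_i<1$ and $y_0\in\mathbb R^p$ such that $\sup_{u\in[0,1]}\|G_{\varepsilon_0}(y_0,u)\|_q<\infty$ and $\|G_{\varepsilon_0}(y,u)-G_{\varepsilon_0}(y',u)\|_q\le\big(\sum_i\chi_i|y_i-y_i'|^{q'}\big)^{1/q'}$ for all $u\in[0,1]$ and $y,y'\in\mathbb R^p$. * (L4) For some $0<\alpha\le1$, $\sup_{u\in[0,1]}\|C(\tilde Y_0(u))\|_q<\infty$, where $C(y)=\sup_{u\ne u'}\|G_{\varepsilon_0}(y,u)-G_{\varepsilon_0}(y,u')\|_q/|u-u'|^\alpha$. Let $K:\mathbb R\to\mathbb R$ be bounded, of bounded variation, zero outside $[-\frac12,\frac12]$, with $\int K=1$, and $K_b(x)=\frac1bK(\frac xb)$. Let $M,C_z,C_\theta\ge0$ and let $\ell:\mathbb R^{p+1}\times\Theta\to\mathbb R$ belong to $\tilde{\mathcal L}_{p+1}(M,(C_z,C_\theta))$,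 i.e. for all $z,z'\in\mathbb R^{p+1}$ and $\theta,\theta'\in\Theta$, $$|\ell(z,\theta)-\ell(z',\theta)|\le C_z|z-z'|_1(1+|z|_1^M+|z'|_1^M),\qquad |\ell(z,\theta)-\ell(z,\theta')|\le 3C_\theta(1+|z|_1^{M+1})|\theta-\theta'|_1 .$$ Define $$L_{n,b}(u,\theta)=\frac1n\sum_{t=p+1}^nK_b\Big(\frac tn-u\Big)\ell(X_{t,n},Y_{t-1,n},\theta),\qquad L(u,\theta)=\mathbb E\,\ell(\tilde X_0(u),\tilde Y_{-1}(u),\theta),$$ and let $\hat\theta_b(u)$ be any minimiser of $L_{n,b}(u,\cdot)$ over $\Theta$. **Theorem.** Assume (L1) and (L4) with $q=M+1$, and that for every $u\in[0,1]$ the point $\theta_0(u)$ lies in the interior of $\Theta$ and is the unique minimiser of $L(u,\cdot)$ over $\Theta$. Let $b=b_n\in(0,1)$ satisfy $b\to0$ and $nb\to\infty$. Then: 1. For every $u\in(0,1)$, $\hat\theta_b(u)\to\theta_0(u)$ in probability. 2. If in addition (L1) and (L4) hold with some $q>M+1$, $\theta_0$ is continuous, and $b^{-1}=o\big(n^{1-(M+1)/q}\big)$,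 then $$\sup_{u\in[b/2,\,1-b/2]}|\hat\theta_b(u)-\theta_0(u)|_1\to0\quad\text{in probability.}$$ (Convergence in probability is understood with outer probability where measurability is not clear.) -/

import Mathlib

open MeasureTheory ProbabilityTheory Filter Topology Asymptotics Set
open scoped ENNReal

noncomputable section

namespace LocStat

/-- The norm `|y|_1 = ∑ |y_i|`. -/
def l1 {r : ℕ} (y : Fin r → ℝ) : ℝ := ∑ i, |y i|

/-- The weighted norm `|z|_{χ,s} = (∑ |z_i|^s χ_i)^{1/s}`. -/
def wnorm {p : ℕ} (χ : Fin p → ℝ) (s : ℝ) (z : Fin p → ℝ) : ℝ :=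
  (∑ i, |z i| ^ s * χ i) ^ (1 / s)

/-- `‖W‖_q = (𝔼 |W|^q)^{1/q}` for a `[0,∞]`-valued random variable `W`. -/
def lqNorm {Ω : Type*} [MeasurableSpace Ω] (μ : Measure Ω) (q : ℝ) (W : Ω → ℝ≥0∞) : ℝ≥0∞ :=
  (∫⁻ ω, W ω ^ q ∂μ) ^ (1 / q)

/-- Localizing kernel: bounded, of bounded variation, supported in `[-1/2, 1/2]`, integral one. -/
structure IsKernel (K : ℝ → ℝ) : Prop where
  bounded : ∃ B : ℝ, ∀ x, |K x| ≤ B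
  boundedVariation : BoundedVariationOn K univ
  support : ∀ x, x ∉ Icc (-(1 / 2) : ℝ) (1 / 2) → K x = 0
  integral_eq_one : ∫ x, K x = 1

/-- The rescaled kernel `K_b(x) = K(x / b) / b`. -/
def scaled (K : ℝ → ℝ) (b x : ℝ) : ℝ := 1 / b * K (x / b)

/-- The class `𝓛_r(M, C)` of functions on a set `S ⊆ ℝ^r`
(locally Lipschitz with polynomially growing constant). -/
def ClassL {r : ℕ} (S : Set (Fin r → ℝ)) (M C : ℝ) (g : (Fin r → ℝ) → ℝ) : Prop :=
  0 ≤ M ∧ ∀ y ∈ S, ∀ y' ∈ S,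
    |g y - g y'| ≤ C * (l1 (y - y') * (1 + l1 y ^ M + l1 y' ^ M))

/-- The class of functions `g : ℝ^{p+1} × Θ → ℝ` with `g(·, θ) ∈ 𝓛_{p+1}(M, C_z)` and
`g(z, ·) ∈ 𝓛_d(0, C_θ (1 + |z|_1^{M+1}))`. -/
def ClassLTilde {p d : ℕ} (Θ : Set (Fin d → ℝ)) (M Cz Cθ : ℝ)
    (g : (Fin (p + 1) → ℝ) → (Fin d → ℝ) → ℝ) : Prop :=
  0 ≤ M ∧ 0 ≤ Cz ∧ 0 ≤ Cθ ∧
  (∀ θ ∈ Θ, ClassL univ M Cz (fun z => g z θ)) ∧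
  (∀ z, ClassL Θ 0 (Cθ * (1 + l1 z ^ (M + 1))) (g z))

/-- The vector `(x_t, x_{t-1}, …, x_{t-r+1})`. -/
def lags (r : ℕ) (x : ℤ → ℝ) (t : ℤ) : Fin r → ℝ := fun i => x (t - (i : ℤ))

/-- Real i.i.d. innovations indexed by `ℤ`. -/
structure IsIIDInnovations {Ω : Type*} [MeasurableSpace Ω] (μ : Measure Ω) (ε : ℤ → Ω → ℝ) :
    Prop where
  measurable : ∀ t, Measurable (ε t)
  indep : iIndepFun ε μ
  identDistrib : ∀ t, IdentDistrib (ε t) (ε 0) μ μ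

/-- `Xt t u` is, for each `u ∈ [0,1]`, the causal stationary solution
`Xt t u = H(u, (ε_t, ε_{t-1}, …))` of the recursion
`Xt t u = G_{ε_t}(Xt (t-1) u, …, Xt (t-p) u, u)`, `t ∈ ℤ`. -/
structure IsStationaryApprox {Ω : Type*} [MeasurableSpace Ω] {p : ℕ} (μ : Measure Ω)
    (ε : ℤ → Ω → ℝ) (G : ℝ → (Fin p → ℝ) → ℝ → ℝ) (Xt : ℤ → ℝ → Ω → ℝ) : Prop where
  causal : ∀ u ∈ Icc (0 : ℝ) 1, ∃ H : (ℕ → ℝ) → ℝ, Measurable H ∧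
    ∀ t : ℤ, ∀ᵐ ω ∂μ, Xt t u ω = H (fun k : ℕ => ε (t - (k : ℤ)) ω)
  recursion : ∀ u ∈ Icc (0 : ℝ) 1, ∀ t : ℤ, ∀ᵐ ω ∂μ,
    Xt t u ω = G (ε t ω) (lags p (fun s => Xt s u ω) (t - 1)) u

/-- `X n t` (for `t ≤ n`) is the locally stationary process given by
`X n t = G_{ε_t}(X n (t-1), …, X n (t-p), (t/n) ∨ 0)`, `t ≤ n`. For `t ≤ 0` this is the
stationary recursion at `u = 0`, and the process is its stationary solution there. -/
structure IsLocallyStationary {Ω : Type*} [MeasurableSpace Ω] {p : ℕ} (μ : Measure Ω)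
    (ε : ℤ → Ω → ℝ) (G : ℝ → (Fin p → ℝ) → ℝ → ℝ) (Xt : ℤ → ℝ → Ω → ℝ)
    (X : ℕ → ℤ → Ω → ℝ) : Prop where
  past : ∀ n : ℕ, ∀ t : ℤ, t ≤ 0 → ∀ᵐ ω ∂μ, X n t ω = Xt t 0 ω
  recursion : ∀ n : ℕ, ∀ t : ℤ, t ≤ (n : ℤ) → ∀ᵐ ω ∂μ,
    X n t ω = G (ε t ω) (lags p (fun s => X n s ω) (t - 1)) (max ((t : ℝ) / (n : ℝ)) 0)

/-- Condition (L1): moment and contraction condition in `y`, with exponent `q`. -/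
def CondL1 {Ω : Type*} [MeasurableSpace Ω] {p : ℕ} (μ : Measure Ω)
    (ε : ℤ → Ω → ℝ) (G : ℝ → (Fin p → ℝ) → ℝ → ℝ) (q : ℝ) : Prop :=
  ∃ (χ : Fin p → ℝ) (y₀ : Fin p → ℝ), (∀ i, 0 ≤ χ i) ∧ ∑ i, χ i < 1 ∧
    (⨆ u ∈ Icc (0 : ℝ) 1, lqNorm μ q (fun ω => ‖G (ε 0 ω) y₀ u‖ₑ)) < ∞ ∧
    ∀ u ∈ Icc (0 : ℝ) 1, ∀ y y' : Fin p → ℝ,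
      lqNorm μ q (fun ω => ‖G (ε 0 ω) y u - G (ε 0 ω) y' u‖ₑ)
        ≤ ENNReal.ofReal (wnorm χ (min q 1) (y - y'))

/-- `C(y) = sup_{u ≠ u'} ‖G_{ε_0}(y,u) - G_{ε_0}(y,u')‖_q / |u - u'|^α`. -/
def holderConst {Ω : Type*} [MeasurableSpace Ω] {p : ℕ} (μ : Measure Ω)
    (ε : ℤ → Ω → ℝ) (G : ℝ → (Fin p → ℝ) → ℝ → ℝ) (q α : ℝ) (y : Fin p → ℝ) : ℝ≥0∞ :=
  ⨆ u ∈ Icc (0 : ℝ) 1, ⨆ u' ∈ Icc (0 : ℝ) 1, ⨆ _ : u ≠ u',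
    lqNorm μ q (fun ω => ‖G (ε 0 ω) y u - G (ε 0 ω) y u'‖ₑ) / ENNReal.ofReal (|u - u'| ^ α)

/-- Condition (L4): Hölder condition in `u`, i.e. `sup_u ‖C(Ỹ_0(u))‖_q < ∞` for some
`0 < α ≤ 1`, with exponent `q`. -/
def CondL4 {Ω : Type*} [MeasurableSpace Ω] {p : ℕ} (μ : Measure Ω)
    (ε : ℤ → Ω → ℝ) (G : ℝ → (Fin p → ℝ) → ℝ → ℝ) (Xt : ℤ → ℝ → Ω → ℝ) (q : ℝ) : Prop :=
  ∃ α : ℝ, 0 < α ∧ α ≤ 1 ∧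
    (⨆ u ∈ Icc (0 : ℝ) 1,
      lqNorm μ q (fun ω => holderConst μ ε G q α (lags p (fun s => Xt s u ω) 0))) < ∞

/-- `L(u, θ) = 𝔼 ℓ(X̃_0(u), X̃_{-1}(u), …, X̃_{-p}(u), θ)`. -/
def limitLik {Ω : Type*} [MeasurableSpace Ω] {p d : ℕ} (μ : Measure Ω)
    (Xt : ℤ → ℝ → Ω → ℝ) (ℓ : (Fin (p + 1) → ℝ) → (Fin d → ℝ) → ℝ)
    (u : ℝ) (θ : Fin d → ℝ) : ℝ :=
  ∫ ω, ℓ (lags (p + 1) (fun s => Xt s u ω) 0) θ ∂μ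

/-- The local negative log conditional likelihood for observations `x_1, …, x_n`:
`(1/n) ∑_{t=p+1}^n K_b(t/n - u) ℓ(x_t, x_{t-1}, …, x_{t-p}, θ)`. -/
def localLik {p d : ℕ} (K : ℝ → ℝ) (ℓ : (Fin (p + 1) → ℝ) → (Fin d → ℝ) → ℝ)
    (n : ℕ) (b : ℝ) (x : ℤ → ℝ) (u : ℝ) (θ : Fin d → ℝ) : ℝ :=
  1 / (n : ℝ) * ∑ t ∈ Finset.Icc (p + 1) n,
    scaled K b ((t : ℝ) / (n : ℝ) - u) * ℓ (lags (p + 1) x (t : ℤ)) θ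

/-- `θhat n u ω` is a minimiser over `Θ` of the local likelihood with bandwidth `b n`,
for every `n`, every `u ∈ [0,1]` and every outcome `ω`. -/
def IsLocalMLE {Ω : Type*} {p d : ℕ} (K : ℝ → ℝ) (ℓ : (Fin (p + 1) → ℝ) → (Fin d → ℝ) → ℝ)
    (Θ : Set (Fin d → ℝ)) (X : ℕ → ℤ → Ω → ℝ) (b : ℕ → ℝ)
    (θhat : ℕ → ℝ → Ω → (Fin d → ℝ)) : Prop :=
  ∀ (n : ℕ), ∀ u ∈ Icc (0 : ℝ) 1, ∀ ω,
    θhat n u ω ∈ Θ ∧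
      ∀ θ ∈ Θ, localLik K ℓ n (b n) (fun t => X n t ω) u (θhat n u ω)
        ≤ localLik K ℓ n (b n) (fun t => X n t ω) u θ

/-- Bandwidths `b_n ∈ (0,1)` with `b_n → 0` and `n b_n → ∞`. -/
structure IsBandwidth (b : ℕ → ℝ) : Prop where
  mem : ∀ n, b n ∈ Ioo (0 : ℝ) 1
  tendsto_zero : Tendsto b atTop (𝓝 0)
  tendsto_mul : Tendsto (fun n : ℕ => (n : ℝ) * b n) atTop atTop

end LocStat

end

/-! Consistency follows the standard pattern for minimisers. The limit `L` is continuous on `[0,1] ×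
Θ` and its minimiser is unique, so over a compact set of locations it exceeds its minimum by a fixed
gap at every parameter at distance `δ` from `θ₀ u` (`exists_separation`). If the local likelihood is
within half that gap of `L`, no minimiser can be `δ` away. Closeness uniformly in `θ` follows from a
finite net of `Θ`, because the Lipschitz constant of `ℓ` in `θ` is governed by the envelope `1 +
|z|_1^(M+1)`, whose local averages converge too (`tendsto_localLik`). What remains is `LocalLLN`: a
law of large numbers for local averages of one locally Lipschitz function `g` of growth `M`, at a
single location for the first claim and over all of `[b/2, 1 - b/2]` for the second.

The probabilistic input is the contraction (L1). An innovation can be integrated out given the past,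
so one step of the recursion shrinks `L^q` distances by the factor `s = ∑ χ i < 1`
(`Model.contraction`). Iterating it yields the moments of the stationary solution, which are not
assumed (`stationary_bound`); geometric approximation by Picard iterates, which depend on finitely
many innovations (`sub_picard`); and, with (L4), a distance of order `(|t/n - u| + 1/n)^α` between
`X n t` and `Xt t u` (`exists_approx`). Hölder's inequality carries all this over to `g`, with
exponent `Q = q/(M+1)` (`ClassL.nq_sub_le`). The bias vanishes since the kernel only sees `|t/n - u|
≤ b/2` and its Riemann sums have error of order `1/(nb)`.

The centred part is handled in two ways. For `q = M + 1` only first moments of `g` are available: at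
fixed `u` the process is replaced by the stationary one, then by a truncated Picard approximation,
and the variance of a weighted sum of bounded `D`-dependent variables tends to zero. For `q > M +
1`, sums over blocks of length `h ≈ η n b` exceed `δ h` with probability at most `C h^(1-Q)`, by a
Fuk–Nagaev inequality applied to each Picard increment. There are about `n/h` blocks, and `n
(nb)^(-Q) → 0` is the condition on `b`. When all blocks are good, bounded variation of the kernel
controls every `u` at once (`IsBVKernel.abs_sum_mul_le`), so no net in `u` is needed. -/

set_option linter.unusedSectionVars false

/-! ### Innovations, independent blocks and causal random variables -/

noncomputable section

namespace LocStat

variable {Ω : Type*}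

/-- The σ-algebra generated by the innovations with index in `S`. -/
abbrev sigmaOn (ε : ℤ → Ω → ℝ) (S : Set ℤ) : MeasurableSpace Ω :=
  ⨆ s ∈ S, MeasurableSpace.comap (ε s) inferInstance

lemma sigmaOn_mono (ε : ℤ → Ω → ℝ) {S T : Set ℤ} (h : S ⊆ T) : sigmaOn ε S ≤ sigmaOn ε T :=
  biSup_mono h

lemma measurable_innovation_sigmaOn (ε : ℤ → Ω → ℝ) {S : Set ℤ} {s : ℤ} (hs : s ∈ S) :
    Measurable[sigmaOn ε S] (ε s) :=
  Measurable.mono (comap_measurable (ε s))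
    (le_biSup (fun s => MeasurableSpace.comap (ε s) inferInstance) hs) le_rfl

variable [mΩ : MeasurableSpace Ω] {μ : Measure Ω}

lemma IsIIDInnovations.sigmaOn_le {ε : ℤ → Ω → ℝ} (hε : IsIIDInnovations μ ε) (S : Set ℤ) :
    sigmaOn ε S ≤ mΩ :=
  iSup₂_le fun s _ => (hε.measurable s).comap_le

lemma IsIIDInnovations.indep_sigmaOn {ε : ℤ → Ω → ℝ} (hε : IsIIDInnovations μ ε)
    {S T : Set ℤ} (hST : Disjoint S T) : Indep (sigmaOn ε S) (sigmaOn ε T) μ :=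
  indep_iSup_of_disjoint (fun s => (hε.measurable s).comap_le)
    ((iIndepFun_iff_iIndep _ _ _).1 hε.indep) hST

/-- Functions of consecutive disjoint blocks of innovations are independent. -/
lemma IsIIDInnovations.iIndep_blocks [IsProbabilityMeasure μ] {ε : ℤ → Ω → ℝ}
    (hε : IsIIDInnovations μ ε) (D : ℕ) (r : ℤ) :
    iIndep (fun j : ℤ => sigmaOn ε (Ioc (r + D * j - D) (r + D * j))) μ := by
  rw [iIndep_iff]
  intro S
  induction S using Finset.induction_on_max with
  | empty => intro f _; simp
  | insert a S ha ih =>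
    intro f hf
    have haS : a ∉ S := fun h => lt_irrefl _ (ha a h)
    rw [Finset.prod_insert haS, ← ih (fun i hi => hf i (Finset.mem_insert_of_mem hi)),
      Finset.set_biInter_insert]
    -- The block of largest index is independent of everything up to its left endpoint, and all
    -- other blocks lie there.
    have hind := hε.indep_sigmaOn (S := Ioc (r + D * a - D) (r + D * a)) (T := Iic (r + D * a - D))
      (by rw [Set.disjoint_left]; intro x hx hx'; simp at hx hx'; omega)
    refine (Indep_iff _ _ μ).1 hind _ _ (hf a (Finset.mem_insert_self _ _)) ?_
    refine @Finset.measurableSet_biInter _ _ (sigmaOn ε (Iic (r + D * a - D))) _ _ ?_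
    intro i hi
    refine sigmaOn_mono ε ?_ _ (hf i (Finset.mem_insert_of_mem hi))
    intro x hx
    have h1 : i + 1 ≤ a := ha i hi
    have h2 : (D : ℤ) * (i + 1) ≤ D * a := mul_le_mul_of_nonneg_left h1 (by positivity)
    simp at hx ⊢
    linarith [hx.2]

/-- Windows of length `D` taken along an arithmetic progression of step `D` are disjoint. This
reduces `D`-dependent sums to independent ones. -/
lemma IsIIDInnovations.iIndepFun_blocks [IsProbabilityMeasure μ] {ε : ℤ → Ω → ℝ}
    (hε : IsIIDInnovations μ ε) (D : ℕ) (r : ℤ) {ζ : ℤ → Ω → ℝ}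
    (hζ : ∀ t, Measurable[sigmaOn ε (Ioc (t - D) t)] (ζ t)) :
    iIndepFun (fun j : ℤ => ζ (r + D * j)) μ := by
  rw [iIndepFun_iff_iIndep]
  refine iIndep_of_iIndep_of_le (hε.iIndep_blocks D r) fun j => ?_
  exact (hζ (r + D * j)).comap_le

lemma IsIIDInnovations.indepFun_of_le {ε : ℤ → Ω → ℝ}
    (hε : IsIIDInnovations μ ε) {D : ℕ} {ζ : ℤ → Ω → ℝ}
    (hζ : ∀ t, Measurable[sigmaOn ε (Ioc (t - D) t)] (ζ t)) {s t : ℤ} (hst : s + D ≤ t) :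
    IndepFun (ζ s) (ζ t) μ := by
  rw [IndepFun_iff_Indep]
  refine indep_of_indep_of_le_left (indep_of_indep_of_le_right
    (hε.indep_sigmaOn (S := Ioc (s - D) s) (T := Ioc (t - D) t) ?_)
    (hζ t).comap_le) (hζ s).comap_le
  rw [Set.disjoint_left]; intro x hx hx'; simp at hx hx'; omega

/-- `U` is almost surely equal to a measurable function of `ε_s`, `s ≤ t`. -/
def Causal {α : Type*} [MeasurableSpace α] (μ : Measure Ω) (ε : ℤ → Ω → ℝ) (t : ℤ)
    (U : Ω → α) : Prop :=
  ∃ U' : Ω → α, Measurable[sigmaOn ε (Iic t)] U' ∧ U =ᵐ[μ] U'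

namespace Causal

variable {α β : Type*} [MeasurableSpace α] [MeasurableSpace β] {ε : ℤ → Ω → ℝ} {s t : ℤ}

lemma mono {U : Ω → α} (h : Causal μ ε s U) (hst : s ≤ t) : Causal μ ε t U := by
  obtain ⟨U', hm, he⟩ := h
  exact ⟨U', hm.mono (sigmaOn_mono ε (Iic_subset_Iic.2 hst)) le_rfl, he⟩

lemma comp {U : Ω → α} (h : Causal μ ε t U) {f : α → β} (hf : Measurable f) :
    Causal μ ε t (fun ω => f (U ω)) := by
  obtain ⟨U', hm, he⟩ := h
  exact ⟨fun ω => f (U' ω), hf.comp hm, he.fun_comp f⟩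

lemma prodMk {U : Ω → α} {V : Ω → β} (hU : Causal μ ε t U) (hV : Causal μ ε t V) :
    Causal μ ε t (fun ω => (U ω, V ω)) := by
  obtain ⟨U', hm, he⟩ := hU
  obtain ⟨V', hm', he'⟩ := hV
  exact ⟨fun ω => (U' ω, V' ω), hm.prodMk hm', he.prodMk he'⟩

lemma pi {ι : Type*} [Countable ι] {U : ι → Ω → α} (hU : ∀ i, Causal μ ε t (U i)) :
    Causal μ ε t (fun ω i => U i ω) := by
  choose U' hm he using hU
  refine ⟨fun ω i => U' i ω, @measurable_pi_lambda _ _ _ (_) _ _ hm, ?_⟩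
  filter_upwards [ae_all_iff.2 he] with ω hω
  funext i; exact hω i

lemma const (a : α) : Causal μ ε t (fun _ => a) := ⟨fun _ => a, measurable_const, ae_eq_rfl⟩

lemma congr {U V : Ω → α} (h : Causal μ ε t U) (he : V =ᵐ[μ] U) : Causal μ ε t V := by
  obtain ⟨U', hm, he'⟩ := h
  exact ⟨U', hm, he.trans he'⟩

lemma of_measurable {S : Set ℤ} {U : Ω → α} (h : Measurable[sigmaOn ε S] U) (hS : S ⊆ Iic t) :
    Causal μ ε t U := ⟨U, h.mono (sigmaOn_mono ε hS) le_rfl, ae_eq_rfl⟩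

lemma innovation : Causal μ ε t (ε t) :=
  ⟨ε t, measurable_innovation_sigmaOn ε (mem_Iic.2 le_rfl), ae_eq_rfl⟩

lemma aemeasurable {U : Ω → α} (h : Causal μ ε t U) (hε : IsIIDInnovations μ ε) :
    AEMeasurable U μ := by
  obtain ⟨U', hm, he⟩ := h
  exact ⟨U', hm.mono (hε.sigmaOn_le _) le_rfl, he⟩

lemma aestronglyMeasurable {U : Ω → ℝ} (h : Causal μ ε t U) (hε : IsIIDInnovations μ ε) :
    AEStronglyMeasurable U μ := (h.aemeasurable hε).aestronglyMeasurable

lemma lags {r : ℕ} {Z : ℤ → Ω → ℝ} (hZ : ∀ s ≤ t, Causal μ ε s (Z s)) :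
    Causal μ ε t (fun ω => LocStat.lags r (fun s => Z s ω) t) :=
  pi fun i => (hZ _ (by omega)).mono (by omega)

end Causal

/-- Integrating out an innovation which is independent of the past. -/
lemma IsIIDInnovations.lintegral_innovation [IsProbabilityMeasure μ] {ε : ℤ → Ω → ℝ}
    (hε : IsIIDInnovations μ ε) {α : Type*} [MeasurableSpace α] {t : ℤ} {U : Ω → α}
    (hU : Causal μ ε (t - 1) U) {Φ : ℝ × α → ℝ≥0∞} (hΦ : Measurable Φ) :
    ∫⁻ ω, Φ (ε t ω, U ω) ∂μ = ∫⁻ ω, ∫⁻ ω', Φ (ε 0 ω', U ω) ∂μ ∂μ := by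
  obtain ⟨U', hm, he⟩ := hU
  have hm' : Measurable U' := hm.mono (hε.sigmaOn_le _) le_rfl
  have h1 : ∫⁻ ω, Φ (ε t ω, U ω) ∂μ = ∫⁻ ω, Φ (ε t ω, U' ω) ∂μ :=
    lintegral_congr_ae (by filter_upwards [he] with ω hω; rw [hω])
  have h2 : ∫⁻ ω, ∫⁻ ω', Φ (ε 0 ω', U ω) ∂μ ∂μ = ∫⁻ ω, ∫⁻ ω', Φ (ε 0 ω', U' ω) ∂μ ∂μ :=
    lintegral_congr_ae (by filter_upwards [he] with ω hω; rw [hω])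
  rw [h1, h2]
  have hind : IndepFun (ε t) U' μ := by
    rw [IndepFun_iff_Indep]
    refine indep_of_indep_of_le_left (indep_of_indep_of_le_right
      (hε.indep_sigmaOn (S := {t}) (T := Iic (t - 1)) ?_) hm.comap_le) ?_
    · rw [Set.disjoint_left]; intro x hx hx'; simp at hx hx'; omega
    · exact (measurable_innovation_sigmaOn ε (mem_singleton t)).comap_le
  have hmt := hε.measurable t
  have hlaw : μ.map (ε t) = μ.map (ε 0) := (hε.identDistrib t).map_eq
  calc ∫⁻ ω, Φ (ε t ω, U' ω) ∂μ = ∫⁻ x, Φ x ∂(μ.map (fun ω => (ε t ω, U' ω))) := by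
        rw [lintegral_map hΦ (hmt.prodMk hm')]
    _ = ∫⁻ x, Φ x ∂((μ.map (ε 0)).prod (μ.map U')) := by
        rw [(indepFun_iff_map_prod_eq_prod_map_map hmt.aemeasurable hm'.aemeasurable).1 hind, hlaw]
    _ = ∫⁻ a, ∫⁻ e, Φ (e, a) ∂(μ.map (ε 0)) ∂(μ.map U') := by
        have : IsProbabilityMeasure (μ.map (ε 0)) :=
          Measure.isProbabilityMeasure_map (hε.measurable 0).aemeasurable
        have : IsProbabilityMeasure (μ.map U') :=
          Measure.isProbabilityMeasure_map hm'.aemeasurable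
        rw [lintegral_prod_symm' _ hΦ]
    _ = ∫⁻ ω, ∫⁻ e, Φ (e, U' ω) ∂(μ.map (ε 0)) ∂μ := by
        have : IsProbabilityMeasure (μ.map (ε 0)) :=
          Measure.isProbabilityMeasure_map (hε.measurable 0).aemeasurable
        rw [lintegral_map hΦ.lintegral_prod_left' hm']
    _ = _ := by
        refine lintegral_congr fun ω => ?_
        exact lintegral_map (f := fun e => Φ (e, U' ω)) (hΦ.comp measurable_prodMk_right)
          (hε.measurable 0)

/-- The vector `(ε_t, ε_{t-1}, …)` has the same law for all `t`. -/
lemma IsIIDInnovations.map_past_eq [IsProbabilityMeasure μ] {ε : ℤ → Ω → ℝ}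
    (hε : IsIIDInnovations μ ε) (s t : ℤ) :
    μ.map (fun ω => fun k : ℕ => ε (s - (k : ℤ)) ω) =
      μ.map (fun ω => fun k : ℕ => ε (t - (k : ℤ)) ω) := by
  -- Distinct indices give an independent family with common marginals, so the law is an infinite
  -- product not involving `t`.
  have key : ∀ t : ℤ, μ.map (fun ω => fun k : ℕ => ε (t - (k : ℤ)) ω) =
      Measure.infinitePi fun _ : ℕ => μ.map (ε 0) := by
    intro t
    have hi : iIndepFun (fun k : ℕ => ε (t - (k : ℤ))) μ :=
      hε.indep.precomp (g := fun k : ℕ => t - (k : ℤ)) (fun a b hab => by simpa using hab)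
    rw [(iIndepFun_iff_map_fun_eq_infinitePi_map (fun k => hε.measurable _)).1 hi]
    congr 1
    funext k
    exact (hε.identDistrib _).map_eq
  rw [key, key]

end LocStat

end

/-! ### `L^q` norms and the contraction property -/

noncomputable section


namespace LocStat

variable {Ω : Type*} [mΩ : MeasurableSpace Ω] {μ : Measure Ω}

/-- The norm `‖f‖_q` of a real random variable. -/
abbrev nq (μ : Measure Ω) (q : ℝ) (f : Ω → ℝ) : ℝ≥0∞ := eLpNorm f (ENNReal.ofReal q) μ

lemma nq_eq {q : ℝ} (hq : 0 < q) (f : Ω → ℝ) :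
    nq μ q f = (∫⁻ ω, ‖f ω‖ₑ ^ q ∂μ) ^ (1 / q) := by
  rw [nq, eLpNorm_eq_lintegral_rpow_enorm_toReal (by simpa using hq) (by simp),
    ENNReal.toReal_ofReal hq.le]

lemma lqNorm_enorm {q : ℝ} (hq : 0 < q) (f : Ω → ℝ) :
    lqNorm μ q (fun ω => ‖f ω‖ₑ) = nq μ q f := by
  rw [nq_eq hq, lqNorm]

lemma nq_le_iff {q : ℝ} (hq : 0 < q) {f : Ω → ℝ} {a : ℝ≥0∞} :
    nq μ q f ≤ a ↔ ∫⁻ ω, ‖f ω‖ₑ ^ q ∂μ ≤ a ^ q := by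
  rw [nq_eq hq, one_div, ENNReal.rpow_inv_le_iff hq]

lemma one_le_ofReal {q : ℝ} (hq : 1 ≤ q) : (1 : ℝ≥0∞) ≤ ENNReal.ofReal q := by
  simpa using hq

lemma nq_add_le {q : ℝ} (hq : 1 ≤ q) {f g : Ω → ℝ} (hf : AEStronglyMeasurable f μ)
    (hg : AEStronglyMeasurable g μ) {a b : ℝ} (ha : 0 ≤ a) (hb : 0 ≤ b)
    (hfa : nq μ q f ≤ ENNReal.ofReal a) (hgb : nq μ q g ≤ ENNReal.ofReal b) :
    nq μ q (fun ω => f ω + g ω) ≤ ENNReal.ofReal (a + b) := by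
  rw [ENNReal.ofReal_add ha hb]
  exact (eLpNorm_add_le hf hg (one_le_ofReal hq)).trans (add_le_add hfa hgb)

lemma nq_neg {q : ℝ} (f : Ω → ℝ) : nq μ q (fun ω => - f ω) = nq μ q f :=
  eLpNorm_neg f _ μ

lemma nq_const [IsProbabilityMeasure μ] {q : ℝ} (hq : 1 ≤ q) (a : ℝ) :
    nq μ q (fun _ => a) = ENNReal.ofReal |a| := by
  rw [nq, eLpNorm_const _ (by simp; linarith) (NeZero.ne μ)]
  simp [Real.enorm_eq_ofReal_abs]

lemma nq_const_mul {q : ℝ} (c : ℝ) (f : Ω → ℝ) :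
    nq μ q (fun ω => c * f ω) = ENNReal.ofReal |c| * nq μ q f := by
  have := eLpNorm_const_smul c f (ENNReal.ofReal q) μ
  rw [Real.enorm_eq_ofReal_abs] at this
  exact this

lemma nq_sum_le {q : ℝ} (hq : 1 ≤ q) {ι : Type*} (s : Finset ι) {f : ι → Ω → ℝ}
    (hf : ∀ i ∈ s, AEStronglyMeasurable (f i) μ) {a : ι → ℝ} (ha : ∀ i ∈ s, 0 ≤ a i)
    (h : ∀ i ∈ s, nq μ q (f i) ≤ ENNReal.ofReal (a i)) :
    nq μ q (fun ω => ∑ i ∈ s, f i ω) ≤ ENNReal.ofReal (∑ i ∈ s, a i) := by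
  rw [ENNReal.ofReal_sum_of_nonneg ha]
  have := eLpNorm_sum_le hf (one_le_ofReal hq)
  have e : (fun ω => ∑ i ∈ s, f i ω) = ∑ i ∈ s, f i := by ext; simp
  rw [nq, e]
  exact this.trans (Finset.sum_le_sum h)

lemma nq_mono {q : ℝ} {f g : Ω → ℝ} (h : ∀ ω, |f ω| ≤ |g ω|) : nq μ q f ≤ nq μ q g :=
  eLpNorm_mono h

/-- The contraction and moment properties of the recursion function used throughout. -/
structure Model {p : ℕ} (μ : Measure Ω) (ε : ℤ → Ω → ℝ) (F : ℝ → (Fin p → ℝ) → ℝ → ℝ)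
    (q : ℝ) (χ : Fin p → ℝ) (C₁ : ℝ) : Prop where
  iid : IsIIDInnovations μ ε
  one_le : 1 ≤ q
  meas : ∀ u ∈ Icc (0 : ℝ) 1, Measurable (fun x : ℝ × (Fin p → ℝ) => F x.1 x.2 u)
  weight_nonneg : ∀ i, 0 ≤ χ i
  weight_lt : ∑ i, χ i < 1
  const_nonneg : 0 ≤ C₁
  zero_le : ∀ u ∈ Icc (0 : ℝ) 1, nq μ q (fun ω => F (ε 0 ω) 0 u) ≤ ENNReal.ofReal C₁
  lip : ∀ u ∈ Icc (0 : ℝ) 1, ∀ y y' : Fin p → ℝ,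
    nq μ q (fun ω => F (ε 0 ω) y u - F (ε 0 ω) y' u) ≤ ENNReal.ofReal (∑ i, χ i * |y i - y' i|)

/-- For `q ≥ 1` the exponent `min q 1` is one, and the weighted norm is a plain weighted sum. The
Lipschitz bound moves the base point `y₀` to zero at the price of a larger moment constant. -/
lemma CondL1.exists_model [IsProbabilityMeasure μ] {p : ℕ} {ε : ℤ → Ω → ℝ}
    {F : ℝ → (Fin p → ℝ) → ℝ → ℝ}
    {q : ℝ} (h : CondL1 μ ε F q) (hq : 1 ≤ q) (hε : IsIIDInnovations μ ε)
    (hF : ∀ u ∈ Icc (0 : ℝ) 1, Measurable (fun x : ℝ × (Fin p → ℝ) => F x.1 x.2 u)) :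
    ∃ χ C₁, Model μ ε F q χ C₁ := by
  obtain ⟨χ, y₀, hχ, hχ1, hS, hlip⟩ := h
  have hq0 : 0 < q := by linarith
  have hlip' : ∀ u ∈ Icc (0 : ℝ) 1, ∀ y y' : Fin p → ℝ,
      nq μ q (fun ω => F (ε 0 ω) y u - F (ε 0 ω) y' u)
        ≤ ENNReal.ofReal (∑ i, χ i * |y i - y' i|) := by
    intro u hu y y'
    have := hlip u hu y y'
    rw [lqNorm_enorm hq0 (fun ω => F (ε 0 ω) y u - F (ε 0 ω) y' u)] at this
    refine this.trans (le_of_eq ?_)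
    simp only [wnorm, min_eq_right hq, Real.rpow_one, div_one, Pi.sub_apply]
    simp_rw [mul_comm]
  set S := ⨆ u ∈ Icc (0 : ℝ) 1, lqNorm μ q (fun ω => ‖F (ε 0 ω) y₀ u‖ₑ) with hSdef
  have hs0 : 0 ≤ ∑ i, χ i * |(0 : Fin p → ℝ) i - y₀ i| :=
    Finset.sum_nonneg fun i _ => mul_nonneg (hχ i) (abs_nonneg _)
  refine ⟨χ, ∑ i, χ i * |(0 : Fin p → ℝ) i - y₀ i| + S.toReal, hε, hq, hF, hχ, hχ1,
    by positivity, ?_, hlip'⟩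
  intro u hu
  have hmeas : ∀ y : Fin p → ℝ, Measurable (fun ω => F (ε 0 ω) y u) := fun y =>
    (hF u hu).comp ((hε.measurable 0).prodMk measurable_const)
  have h1 : nq μ q (fun ω => F (ε 0 ω) y₀ u) ≤ ENNReal.ofReal S.toReal := by
    rw [ENNReal.ofReal_toReal hS.ne, ← lqNorm_enorm hq0 (fun ω => F (ε 0 ω) y₀ u)]
    exact le_iSup₂ (f := fun u (_ : u ∈ Icc (0 : ℝ) 1) =>
      lqNorm μ q (fun ω => ‖F (ε 0 ω) y₀ u‖ₑ)) u hu
  have := nq_add_le hq ((hmeas 0).sub (hmeas y₀)).aestronglyMeasurable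
    (hmeas y₀).aestronglyMeasurable hs0 ENNReal.toReal_nonneg (hlip' u hu 0 y₀) h1
  simpa using this

namespace Model

variable [IsProbabilityMeasure μ] {p : ℕ} {ε : ℤ → Ω → ℝ} {F : ℝ → (Fin p → ℝ) → ℝ → ℝ}
  {q : ℝ} {χ : Fin p → ℝ} {C₁ : ℝ}

lemma pos (hm : Model μ ε F q χ C₁) : 0 < q := by linarith [hm.one_le]

lemma sum_nonneg (hm : Model μ ε F q χ C₁) : 0 ≤ ∑ i, χ i :=
  Finset.sum_nonneg fun i _ => hm.weight_nonneg i

lemma causal_step (hm : Model μ ε F q χ C₁) {t : ℤ} {v : ℝ} (hv : v ∈ Icc (0 : ℝ) 1)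
    {Y : Ω → (Fin p → ℝ)} (hY : Causal μ ε (t - 1) Y) :
    Causal μ ε t (fun ω => F (ε t ω) (Y ω) v) :=
  ((Causal.innovation (t := t)).prodMk (hY.mono (by omega))).comp (hm.meas v hv)

/-- The contraction property along the process, with a factor `b` depending on the past. -/
lemma contraction (hm : Model μ ε F q χ C₁) {t : ℤ} {v : ℝ} (hv : v ∈ Icc (0 : ℝ) 1)
    {b : Ω → ℝ} {Y Y' : Ω → (Fin p → ℝ)} (hb : Causal μ ε (t - 1) b)
    (hY : Causal μ ε (t - 1) Y) (hY' : Causal μ ε (t - 1) Y') {r : Fin p → ℝ} (hr : ∀ i, 0 ≤ r i)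
    (h : ∀ i, nq μ q (fun ω => b ω * (Y ω i - Y' ω i)) ≤ ENNReal.ofReal (r i)) :
    nq μ q (fun ω => b ω * (F (ε t ω) (Y ω) v - F (ε t ω) (Y' ω) v))
      ≤ ENNReal.ofReal (∑ i, χ i * r i) := by
  have hq := hm.pos
  have hsum : nq μ q (fun ω => ∑ i, χ i * |b ω * (Y ω i - Y' ω i)|)
      ≤ ENNReal.ofReal (∑ i, χ i * r i) := by
    refine nq_sum_le hm.one_le Finset.univ (f := fun i ω => χ i * |b ω * (Y ω i - Y' ω i)|) ?_
      (fun i _ => mul_nonneg (hm.weight_nonneg i) (hr i)) ?_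
    · intro i _
      have hbm := hb.aemeasurable hm.iid
      have hYm := (aemeasurable_pi_iff.1 (hY.aemeasurable hm.iid)) i
      have hYm' := (aemeasurable_pi_iff.1 (hY'.aemeasurable hm.iid)) i
      have : AEMeasurable (fun ω => b ω * (Y ω i - Y' ω i)) μ := hbm.mul (hYm.sub hYm')
      exact ((continuous_abs.measurable.comp_aemeasurable this).const_mul _).aestronglyMeasurable
    · intro i _
      rw [nq_const_mul, ENNReal.ofReal_mul (hm.weight_nonneg i), abs_of_nonneg (hm.weight_nonneg i)]
      gcongr
      refine le_trans (nq_mono fun ω => ?_) (h i)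
      rw [abs_abs]
  refine le_trans ?_ hsum
  rw [nq_eq hq, nq_eq hq]
  refine ENNReal.rpow_le_rpow ?_ (by positivity)
  have hΦ : Measurable (fun x : ℝ × ((Fin p → ℝ) × (Fin p → ℝ) × ℝ) =>
      ‖x.2.2.2 * (F x.1 x.2.1 v - F x.1 x.2.2.1 v)‖ₑ ^ q) := by
    have h1 := (hm.meas v hv).comp (measurable_fst.prodMk (measurable_fst.comp measurable_snd) :
      Measurable (fun x : ℝ × ((Fin p → ℝ) × (Fin p → ℝ) × ℝ) => (x.1, x.2.1)))
    have h2 := (hm.meas v hv).comp (measurable_fst.prodMk (measurable_fst.comp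
      (measurable_snd.comp measurable_snd)) :
      Measurable (fun x : ℝ × ((Fin p → ℝ) × (Fin p → ℝ) × ℝ) => (x.1, x.2.2.1)))
    have h3 : Measurable (fun x : ℝ × ((Fin p → ℝ) × (Fin p → ℝ) × ℝ) => x.2.2.2) := by fun_prop
    exact (h3.mul (h1.sub h2)).enorm.pow_const q
  -- Given the past, `Y`, `Y'` and `b` are constants: integrating out `ε t` first leaves the
  -- Lipschitz bound at frozen points, times `|b|`. The factor `b` lets an indicator of a past event
  -- pass through the recursion.
  have := hm.iid.lintegral_innovation (hY.prodMk (hY'.prodMk hb)) hΦ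
  simp only at this
  rw [this]
  refine lintegral_mono fun ω => ?_
  simp only [enorm_mul]
  have h4 := (nq_le_iff hq).1 (hm.lip v hv (Y ω) (Y' ω))
  simp_rw [ENNReal.mul_rpow_of_nonneg _ _ hq.le]
  rw [lintegral_const_mul' _ _ (ENNReal.rpow_ne_top_of_nonneg hq.le enorm_ne_top)]
  refine (mul_le_mul_right h4 _).trans (le_of_eq ?_)
  have h5 : ∑ i, χ i * |b ω * (Y ω i - Y' ω i)| = |b ω| * ∑ i, χ i * |Y ω i - Y' ω i| := by
    rw [Finset.mul_sum]; refine Finset.sum_congr rfl fun i _ => ?_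
    rw [abs_mul]; ring
  rw [h5, enorm_mul, ENNReal.mul_rpow_of_nonneg _ _ hq.le, Real.enorm_abs]
  congr 2
  rw [Real.enorm_eq_ofReal]
  exact Finset.sum_nonneg fun i _ => mul_nonneg (hm.weight_nonneg i) (abs_nonneg _)

lemma contraction_one (hm : Model μ ε F q χ C₁) {t : ℤ} {v : ℝ} (hv : v ∈ Icc (0 : ℝ) 1)
    {Y Y' : Ω → (Fin p → ℝ)}
    (hY : Causal μ ε (t - 1) Y) (hY' : Causal μ ε (t - 1) Y') {r : Fin p → ℝ} (hr : ∀ i, 0 ≤ r i)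
    (h : ∀ i, nq μ q (fun ω => Y ω i - Y' ω i) ≤ ENNReal.ofReal (r i)) :
    nq μ q (fun ω => F (ε t ω) (Y ω) v - F (ε t ω) (Y' ω) v)
      ≤ ENNReal.ofReal (∑ i, χ i * r i) := by
  simpa using hm.contraction hv (Causal.const (1 : ℝ)) hY hY' hr (by simpa using h)

lemma zero_le_at (hm : Model μ ε F q χ C₁) (t : ℤ) {v : ℝ} (hv : v ∈ Icc (0 : ℝ) 1) :
    nq μ q (fun ω => F (ε t ω) 0 v) ≤ ENNReal.ofReal C₁ := by
  refine le_trans (le_of_eq ?_) (hm.zero_le v hv)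
  have h : Measurable (fun e : ℝ => F e 0 v) :=
    (hm.meas v hv).comp (measurable_id.prodMk measurable_const)
  exact ((hm.iid.identDistrib t).comp h).eLpNorm_eq (p := ENNReal.ofReal q)

/-- The bound for all moments of order `q`. -/
def bound (χ : Fin p → ℝ) (C₁ : ℝ) : ℝ := C₁ / (1 - ∑ i, χ i)

lemma bound_nonneg (hm : Model μ ε F q χ C₁) : 0 ≤ bound χ C₁ :=
  div_nonneg hm.const_nonneg (by linarith [hm.weight_lt])

lemma bound_eq (hm : Model μ ε F q χ C₁) : (∑ i, χ i) * bound χ C₁ + C₁ = bound χ C₁ := by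
  have := hm.weight_lt
  unfold bound
  field_simp [show (1 - ∑ i, χ i) ≠ 0 by linarith]
  ring

/-- `bound` is the fixed point of `R ↦ (∑ χ i) * R + C₁`, so comparison with the value at zero
reproduces the same bound and can be iterated. -/
lemma step_bound (hm : Model μ ε F q χ C₁) {t : ℤ} {v : ℝ} (hv : v ∈ Icc (0 : ℝ) 1)
    {Y : Ω → (Fin p → ℝ)} (hY : Causal μ ε (t - 1) Y)
    (h : ∀ i, nq μ q (fun ω => Y ω i) ≤ ENNReal.ofReal (bound χ C₁)) :
    nq μ q (fun ω => F (ε t ω) (Y ω) v) ≤ ENNReal.ofReal (bound χ C₁) := by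
  have h1 := hm.contraction_one hv hY (Causal.const 0) (r := fun _ => bound χ C₁)
    (fun _ => hm.bound_nonneg) (by simpa using h)
  have h0 := (hm.causal_step hv (t := t) (Causal.const 0)).aestronglyMeasurable hm.iid
  have hY' := (hm.causal_step hv hY).aestronglyMeasurable hm.iid
  have := nq_add_le hm.one_le (hY'.sub h0) h0 (Finset.sum_nonneg fun i _ =>
    mul_nonneg (hm.weight_nonneg i) hm.bound_nonneg) hm.const_nonneg h1 (hm.zero_le_at t hv)
  simpa [← Finset.sum_mul, hm.bound_eq] using this

end Model

end LocStat

end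

/-! ### Picard iterates and moments of the stationary solution -/

noncomputable section


namespace LocStat

variable {Ω : Type*} [mΩ : MeasurableSpace Ω] {μ : Measure Ω}

/-- Picard iterates of the recursion with parameter path `v`, started from zero. -/
def picard {p : ℕ} (ε : ℤ → Ω → ℝ) (F : ℝ → (Fin p → ℝ) → ℝ → ℝ) (v : ℤ → ℝ) :
    ℕ → ℤ → Ω → ℝ
  | 0, _, _ => 0
  | k + 1, t, ω => F (ε t ω) (lags p (fun s => picard ε F v k s ω) (t - 1)) (v t)

/-- `Z` is a causal solution of the recursion with parameter path `v` up to time `T`. -/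
structure IsSol {p : ℕ} (μ : Measure Ω) (ε : ℤ → Ω → ℝ) (F : ℝ → (Fin p → ℝ) → ℝ → ℝ)
    (v : ℤ → ℝ) (T : ℤ) (Z : ℤ → Ω → ℝ) : Prop where
  causal : ∀ t ≤ T, Causal μ ε t (Z t)
  recursion : ∀ t ≤ T, ∀ᵐ ω ∂μ, Z t ω = F (ε t ω) (lags p (fun s => Z s ω) (t - 1)) (v t)

namespace Model

variable [IsProbabilityMeasure μ] {p : ℕ} {ε : ℤ → Ω → ℝ} {F : ℝ → (Fin p → ℝ) → ℝ → ℝ}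
  {q : ℝ} {χ : Fin p → ℝ} {C₁ : ℝ} {v : ℤ → ℝ}

/-- Each iteration reaches at most `p` steps further back. The window grows by `p + 1` so that,
after the first iteration, it contains `t` itself even if `p = 0`. -/
lemma measurable_picard (hm : Model μ ε F q χ C₁) (hv : ∀ t, v t ∈ Icc (0 : ℝ) 1) (k : ℕ) (t : ℤ) :
    Measurable[sigmaOn ε (Ioc (t - k * (p + 1)) t)] (picard ε F v k t) := by
  induction k generalizing t with
  | zero => exact measurable_const
  | succ k ih =>
    refine (hm.meas (v t) (hv t)).comp (Measurable.prodMk ?_ ?_)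
    · refine measurable_innovation_sigmaOn ε ?_
      simp only [mem_Ioc, le_refl, and_true]
      push_cast
      nlinarith
    · refine @measurable_pi_lambda _ _ _ (_) _ _ fun i => ?_
      refine (ih (t - 1 - i)).mono (sigmaOn_mono ε ?_) le_rfl
      intro x hx
      have := i.2
      simp only [mem_Ioc] at hx ⊢
      push_cast
      constructor <;> nlinarith [hx.1, hx.2]

lemma causal_picard (hm : Model μ ε F q χ C₁) (hv : ∀ t, v t ∈ Icc (0 : ℝ) 1) (k : ℕ) (t : ℤ) :
    Causal μ ε t (picard ε F v k t) :=
  Causal.of_measurable (hm.measurable_picard hv k t) fun _ hx => hx.2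

lemma picard_bound (hm : Model μ ε F q χ C₁) (hv : ∀ t, v t ∈ Icc (0 : ℝ) 1) (k : ℕ) (t : ℤ) :
    nq μ q (picard ε F v k t) ≤ ENNReal.ofReal (bound χ C₁) := by
  induction k generalizing t with
  | zero =>
    have : picard ε F v 0 t = fun _ : Ω => (0 : ℝ) := by ext; simp [picard]
    rw [this, nq_const hm.one_le]; simp
  | succ k ih =>
    exact hm.step_bound (hv t) (Causal.lags fun s _ => hm.causal_picard hv k s) fun i => ih _

lemma picard_succ_sub (hm : Model μ ε F q χ C₁) (hv : ∀ t, v t ∈ Icc (0 : ℝ) 1) (k : ℕ) (t : ℤ) :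
    nq μ q (fun ω => picard ε F v (k + 1) t ω - picard ε F v k t ω)
      ≤ ENNReal.ofReal (bound χ C₁ * (∑ i, χ i) ^ k) := by
  induction k generalizing t with
  | zero => simpa [picard] using hm.picard_bound hv 1 t
  | succ k ih =>
    have := hm.contraction_one (hv t) (t := t)
      (Causal.lags (r := p) fun s _ => hm.causal_picard hv (k + 1) s)
      (Causal.lags (r := p) fun s _ => hm.causal_picard hv k s)
      (r := fun _ => bound χ C₁ * (∑ i, χ i) ^ k)
      (fun _ => mul_nonneg hm.bound_nonneg (pow_nonneg hm.sum_nonneg _)) (fun i => ih _)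
    refine this.trans (le_of_eq ?_)
    rw [← Finset.sum_mul]; congr 1; ring

/-- A solution with bounded moments is approximated by the Picard iterates. -/
lemma sub_picard (hm : Model μ ε F q χ C₁) (hv : ∀ t, v t ∈ Icc (0 : ℝ) 1) {T : ℤ}
    {Z : ℤ → Ω → ℝ} (hZ : IsSol μ ε F v T Z)
    (hb : ∀ t ≤ T, nq μ q (Z t) ≤ ENNReal.ofReal (bound χ C₁)) (k : ℕ) {t : ℤ} (ht : t ≤ T) :
    nq μ q (fun ω => Z t ω - picard ε F v k t ω)
      ≤ ENNReal.ofReal (bound χ C₁ * (∑ i, χ i) ^ k) := by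
  induction k generalizing t with
  | zero => simpa [picard] using hb t ht
  | succ k ih =>
    have := hm.contraction_one (hv t) (t := t)
      (Causal.lags (r := p) fun s hs => hZ.causal s (by omega))
      (Causal.lags (r := p) fun s _ => hm.causal_picard hv k s)
      (r := fun _ => bound χ C₁ * (∑ i, χ i) ^ k)
      (fun _ => mul_nonneg hm.bound_nonneg (pow_nonneg hm.sum_nonneg _))
      (fun i => ih (by omega))
    refine le_trans (le_of_eq (eLpNorm_congr_ae ?_)) (this.trans (le_of_eq ?_))
    · filter_upwards [hZ.recursion t ht] with ω hω
      simp only [picard]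
      rw [← hω]
    · rw [← Finset.sum_mul]; congr 1; ring

/-- No moments of `Z` are known here. The factor `b`, in use the indicator that `Z` is at most `A`
on `(-p, 0]`, makes the starting error finite. It belongs to the past of every later step, so it
passes through `contraction`, and each further `p` steps bring a factor `∑ χ i`. The condition `t ≤
k` keeps the iteration depth from running out before time 0 is reached. -/
lemma localized_sub_picard_le (hm : Model μ ε F q χ C₁) (hv : ∀ t, v t ∈ Icc (0 : ℝ) 1)
    {Z : ℤ → Ω → ℝ} (hZ : ∀ T, IsSol μ ε F v T Z) {b : Ω → ℝ} (hb : Causal μ ε 0 b)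
    (hb1 : ∀ ω, |b ω| ≤ 1) {A : ℝ} (hA : 0 ≤ A)
    (hbZ : ∀ t : ℤ, -(p : ℤ) < t → t ≤ 0 → ∀ ω, |b ω * Z t ω| ≤ A) (j k : ℕ) {t : ℤ}
    (hjt : ((j : ℤ) - 1) * p < t) (htk : t ≤ k) :
    nq μ q (fun ω => b ω * (Z t ω - picard ε F v k t ω))
      ≤ ENNReal.ofReal ((∑ i, χ i) ^ j * (A + bound χ C₁)) := by
  have hR := hm.bound_nonneg
  have step : ∀ (k : ℕ) (t : ℤ) (B : ℝ), 0 ≤ B → 0 < t →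
      (∀ i : Fin p, nq μ q (fun ω => b ω * (Z (t - 1 - i) ω - picard ε F v k (t - 1 - i) ω))
        ≤ ENNReal.ofReal B) →
      nq μ q (fun ω => b ω * (Z t ω - picard ε F v (k + 1) t ω))
        ≤ ENNReal.ofReal ((∑ i, χ i) * B) := by
    intro k t B hB ht h
    have := hm.contraction (hv t) (t := t) (hb.mono (by omega))
      (Causal.lags (r := p) fun s _ => (hZ s).causal s le_rfl)
      (Causal.lags (r := p) fun s _ => hm.causal_picard hv k s)
      (r := fun _ => B) (fun _ => hB) h
    refine le_trans (le_of_eq (eLpNorm_congr_ae ?_)) (this.trans (le_of_eq ?_))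
    · filter_upwards [(hZ t).recursion t le_rfl] with ω hω
      simp only [picard]
      rw [← hω]
    · rw [← Finset.sum_mul]
  have base : ∀ (k : ℕ) (t : ℤ), -(p : ℤ) < t → t ≤ 0 →
      nq μ q (fun ω => b ω * (Z t ω - picard ε F v k t ω)) ≤ ENNReal.ofReal (A + bound χ C₁) := by
    intro k t ht ht0
    have hbm := hb.aemeasurable hm.iid
    have hZm := ((hZ t).causal t le_rfl).aemeasurable hm.iid
    have hWm := (hm.causal_picard hv k t).aemeasurable hm.iid
    have h1 : nq μ q (fun ω => b ω * Z t ω) ≤ ENNReal.ofReal A := by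
      refine (nq_mono (g := fun _ => A) fun ω => ?_).trans (le_of_eq ?_)
      · rw [abs_of_nonneg hA]; exact hbZ t ht ht0 ω
      · rw [nq_const hm.one_le, abs_of_nonneg hA]
    have h2 : nq μ q (fun ω => - (b ω * picard ε F v k t ω)) ≤ ENNReal.ofReal (bound χ C₁) := by
      refine (nq_mono (g := picard ε F v k t) fun ω => ?_).trans (hm.picard_bound hv k t)
      rw [abs_neg, abs_mul]
      exact mul_le_of_le_one_left (abs_nonneg _) (hb1 ω)
    have := nq_add_le hm.one_le (hbm.mul hZm).aestronglyMeasurable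
      (hbm.mul hWm).neg.aestronglyMeasurable hA hR h1 h2
    refine le_trans (le_of_eq ?_) this
    congr 1; funext ω; simp only [Pi.mul_apply, Pi.neg_apply]; ring
  -- A bound without decay, which starts the induction on `j`.
  have all : ∀ (k : ℕ) (t : ℤ), -(p : ℤ) < t → t ≤ k →
      nq μ q (fun ω => b ω * (Z t ω - picard ε F v k t ω)) ≤ ENNReal.ofReal (A + bound χ C₁) := by
    intro k
    induction k with
    | zero => intro t ht ht0; exact base 0 t ht (by simpa using ht0)
    | succ k ih =>
      intro t ht htk
      rcases le_or_gt t 0 with h0 | h0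
      · exact base _ t ht h0
      · refine (step k t _ (by positivity) h0 fun i => ih _ ?_ ?_).trans
          (ENNReal.ofReal_le_ofReal ?_)
        · have := i.2; omega
        · push_cast at htk; omega
        · exact mul_le_of_le_one_left (by positivity) hm.weight_lt.le
  induction j generalizing k t with
  | zero => simpa using all k t (by push_cast at hjt; linarith) htk
  | succ j ih =>
    have ht0 : 0 < t := by
      refine lt_of_le_of_lt ?_ hjt
      push_cast; rw [add_sub_cancel_right]; positivity
    obtain ⟨k, rfl⟩ : ∃ k', k = k' + 1 := ⟨k - 1, by omega⟩
    refine (step k t _ (mul_nonneg (pow_nonneg hm.sum_nonneg _) (by positivity)) ht0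
      fun i => ih k ?_ ?_).trans (le_of_eq ?_)
    · have := i.2
      push_cast at hjt
      nlinarith
    · push_cast at htk; omega
    · congr 1; ring

/-- A stationary causal solution automatically has moments of order `q`. -/
lemma stationary_bound (hm : Model μ ε F q χ C₁) (hv : ∀ t, v t ∈ Icc (0 : ℝ) 1)
    {Z : ℤ → Ω → ℝ} (hZ : ∀ T, IsSol μ ε F v T Z) (hid : ∀ t, IdentDistrib (Z t) (Z 0) μ μ) (t : ℤ) :
    nq μ q (Z t) ≤ ENNReal.ofReal (bound χ C₁) := by
  have hq := hm.pos
  rw [nq, (hid t).eLpNorm_eq]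
  have hZm : ∀ t, AEMeasurable (Z t) μ := fun t => ((hZ t).causal t le_rfl).aemeasurable hm.iid
  -- The indicator that the last `p` values are at most `A`; it tends to one as `A → ∞` without any
  -- moment assumption.
  set b : ℕ → Ω → ℝ := fun A ω =>
    ({y : Fin p → ℝ | ∀ i, |y i| ≤ A}).indicator (fun _ => (1 : ℝ))
      (lags p (fun s => Z s ω) 0) with hbdef
  have hset : ∀ A : ℕ, MeasurableSet {y : Fin p → ℝ | ∀ i, |y i| ≤ A} := fun A => by
    rw [ofPred_forall]
    refine MeasurableSet.iInter fun i => ?_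
    exact measurableSet_le (continuous_abs.measurable.comp (measurable_pi_apply i)) measurable_const
  have hbc : ∀ A, Causal μ ε 0 (b A) := fun A =>
    (Causal.lags fun s _ => (hZ s).causal s le_rfl).comp (measurable_const.indicator (hset A))
  have hb01 : ∀ A ω, b A ω = 0 ∨ b A ω = 1 := fun A ω => by
    simp only [hbdef, indicator]; split_ifs <;> simp
  have hbZ : ∀ (A : ℕ) (t : ℤ), -(p : ℤ) < t → t ≤ 0 → ∀ ω, |b A ω * Z t ω| ≤ A := by
    intro A t ht ht0 ω
    simp only [hbdef, indicator]
    split_ifs with h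
    · have h1 := h ⟨(-t).toNat, by omega⟩
      have h2 : (0 : ℤ) - (((-t).toNat : ℕ) : ℤ) = t := by omega
      simp only [lags, h2] at h1
      simpa using h1
    · simp
  -- By stationarity `Z 0` may be exchanged for a late `Z k`. Where `b A = 1` this is close to a
  -- Picard iterate of norm at most `bound`; elsewhere the truncated value is at most `T`.
  have trunc : ∀ (T : ℕ) (A : ℕ), nq μ q (fun ω => min |Z 0 ω| T) ≤
      ENNReal.ofReal (bound χ C₁) + ENNReal.ofReal T * nq μ q (fun ω => 1 - b A ω) := by
    intro T A
    have hbound : ∀ j : ℕ, nq μ q (fun ω => min |Z 0 ω| T) ≤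
        ENNReal.ofReal (bound χ C₁ + (∑ i, χ i) ^ j * (A + bound χ C₁))
          + ENNReal.ofReal T * nq μ q (fun ω => 1 - b A ω) := by
      intro j
      set k : ℕ := j * p + 1
      have h1 := hm.localized_sub_picard_le hv hZ (hbc A)
        (fun ω => by rcases hb01 A ω with h | h <;> simp [h]) (Nat.cast_nonneg A) (hbZ A) j k
        (t := k) (by simp only [k]; push_cast; nlinarith) le_rfl
      have hφ : Measurable (fun x : ℝ => min |x| (T : ℝ)) := by fun_prop
      have h2 : nq μ q (fun ω => min |Z 0 ω| T) = nq μ q (fun ω => min |Z k ω| T) :=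
        (((hid k).comp hφ).eLpNorm_eq (p := ENNReal.ofReal q)).symm
      have hWm := (hm.causal_picard hv k k).aemeasurable hm.iid
      have hbm := (hbc A).aemeasurable hm.iid
      have h3 := nq_add_le hm.one_le
        (continuous_abs.measurable.comp_aemeasurable hWm).aestronglyMeasurable
        (continuous_abs.measurable.comp_aemeasurable
          (hbm.mul ((hZm k).sub hWm))).aestronglyMeasurable
        hm.bound_nonneg (mul_nonneg (pow_nonneg hm.sum_nonneg j)
          (add_nonneg (Nat.cast_nonneg A) hm.bound_nonneg))
        ((nq_mono (g := picard ε F v k k) fun ω => by simp).trans (hm.picard_bound hv k k))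
        ((nq_mono (g := fun ω => b A ω * (Z k ω - picard ε F v k k ω)) fun ω => by simp).trans h1)
      have h4 : nq μ q (fun ω => (T : ℝ) * (1 - b A ω)) =
          ENNReal.ofReal T * nq μ q (fun ω => 1 - b A ω) := by
        rw [nq_const_mul, Nat.abs_cast]
      rw [h2, ← h4]
      refine le_trans ?_ ((eLpNorm_add_le ?_ ?_ (one_le_ofReal hm.one_le)).trans
        (add_le_add h3 le_rfl))
      · refine nq_mono fun ω => ?_
        simp only [Pi.add_apply, Function.comp_apply, Pi.mul_apply, Pi.sub_apply]
        have hT : (0 : ℝ) ≤ T := Nat.cast_nonneg T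
        rw [abs_of_nonneg (le_min (abs_nonneg _) hT)]
        refine le_trans ?_ (le_abs_self _)
        rcases hb01 A ω with h | h
        · rw [h]; simp only [zero_mul, abs_zero, sub_zero, mul_one, add_zero]
          have := min_le_right |Z k ω| (T : ℝ)
          have := abs_nonneg (picard ε F v k k ω)
          linarith
        · rw [h]; simp only [one_mul, sub_self, mul_zero, add_zero]
          refine (min_le_left _ _).trans ?_
          have := abs_add_le (picard ε F v k k ω) (Z k ω - picard ε F v k k ω)
          simpa using this
      · exact ((continuous_abs.measurable.comp_aemeasurable hWm).add
          (continuous_abs.measurable.comp_aemeasurable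
            (hbm.mul ((hZm k).sub hWm)))).aestronglyMeasurable
      · exact ((aemeasurable_const.sub hbm).const_mul _).aestronglyMeasurable
    -- First `j → ∞` at fixed `A` and `T`; afterwards `A → ∞`, and finally `T → ∞` by Fatou.
    refine ge_of_tendsto' (x := atTop) ?_ hbound
    refine Tendsto.add_const _ ?_
    refine ENNReal.tendsto_ofReal ?_
    have := (tendsto_pow_atTop_nhds_zero_of_lt_one hm.sum_nonneg hm.weight_lt).mul_const
      ((A : ℝ) + bound χ C₁)
    simpa using this.const_add (bound χ C₁)
  have hb0 : Tendsto (fun A : ℕ => nq μ q (fun ω => 1 - b A ω)) atTop (𝓝 0) := by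
    have hlim : Tendsto (fun A : ℕ => ∫⁻ ω, ‖1 - b A ω‖ₑ ^ q ∂μ) atTop
        (𝓝 (∫⁻ _, 0 ∂μ)) := by
      refine tendsto_lintegral_of_dominated_convergence' (fun _ => 1) ?_ ?_ (by simp) ?_
      · intro A
        exact (aemeasurable_const.sub ((hbc A).aemeasurable hm.iid)).enorm.pow_const q
      · intro A
        refine Eventually.of_forall fun ω => ?_
        rcases hb01 A ω with h | h <;> simp [h, hq]
      · refine Eventually.of_forall fun ω => ?_
        obtain ⟨N, hN⟩ := exists_nat_ge (∑ i, |lags p (fun s => Z s ω) 0 i|)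
        refine tendsto_const_nhds.congr' ?_
        filter_upwards [eventually_ge_atTop N] with A hA
        have : b A ω = 1 := by
          simp only [hbdef]
          rw [indicator_of_mem]
          intro i
          refine (Finset.single_le_sum (f := fun i => |lags p (fun s => Z s ω) 0 i|)
            (fun i _ => abs_nonneg _) (Finset.mem_univ i)).trans (hN.trans ?_)
          exact_mod_cast hA
        simp [this, hq]
    have := hlim.ennrpow_const (1 / q)
    simp only [lintegral_zero] at this
    rw [ENNReal.zero_rpow_of_pos (by positivity)] at this
    refine this.congr fun A => ?_
    rw [nq_eq hq]
  have trunc' : ∀ T : ℕ, nq μ q (fun ω => min |Z 0 ω| T) ≤ ENNReal.ofReal (bound χ C₁) := by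
    intro T
    refine ge_of_tendsto' (x := atTop) ?_ (trunc T)
    have := (ENNReal.Tendsto.const_mul hb0 (a := ENNReal.ofReal T) (Or.inr (by simp))).const_add
      (ENNReal.ofReal (bound χ C₁))
    simpa using this
  have hfin := Lp.eLpNorm_lim_le_liminf_eLpNorm (μ := μ) (p := ENNReal.ofReal q)
    (f := fun (T : ℕ) ω => min |Z 0 ω| (T : ℝ)) (fun T => by
      have hφ : Measurable (fun x : ℝ => min |x| (T : ℝ)) := by fun_prop
      exact (hφ.comp_aemeasurable (hZm 0)).aestronglyMeasurable) (fun ω => |Z 0 ω|)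
    (Eventually.of_forall fun ω => by
      obtain ⟨N, hN⟩ := exists_nat_ge |Z 0 ω|
      refine tendsto_const_nhds.congr' ?_
      filter_upwards [eventually_ge_atTop N] with T hT
      rw [min_eq_left]
      exact hN.trans (by exact_mod_cast hT))
  refine (nq_mono (g := fun ω => |Z 0 ω|) fun ω => by simp).trans (hfin.trans ?_)
  refine liminf_le_of_le (by isBoundedDefault) fun B hB => ?_
  obtain ⟨T, hT⟩ := hB.exists
  exact hT.trans (trunc' T)

end Model

end LocStat

end

/-! ### The locally stationary process and its stationary approximation -/

noncomputable section


namespace LocStat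

variable {Ω : Type*} [mΩ : MeasurableSpace Ω] {μ : Measure Ω}

/-- The parameter path `t ↦ (t/n ∨ 0) ∧ 1` of the locally stationary process. -/
def path (n : ℕ) (t : ℤ) : ℝ := min (max ((t : ℝ) / n) 0) 1

lemma path_mem (n : ℕ) (t : ℤ) : path n t ∈ Icc (0 : ℝ) 1 :=
  ⟨le_min (le_max_right _ _) zero_le_one, min_le_right _ _⟩

lemma path_eq {n : ℕ} {t : ℤ} (ht : t ≤ n) : path n t = max ((t : ℝ) / n) 0 := by
  refine min_eq_left (max_le ?_ zero_le_one)
  refine div_le_one_of_le₀ ?_ (Nat.cast_nonneg n)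
  exact_mod_cast ht

lemma path_eq_div {n : ℕ} {t : ℕ} (ht : t ≤ n) : path n t = (t : ℝ) / n := by
  rw [path_eq (by exact_mod_cast ht)]
  exact max_eq_left (by push_cast; positivity)

lemma abs_path_sub_le (n : ℕ) (s t : ℤ) : |path n s - path n t| ≤ |(s : ℝ) - t| / n := by
  unfold path
  refine (abs_min_sub_min_le_max _ _ _ _).trans ?_
  rw [sub_self, abs_zero, max_eq_left (abs_nonneg _)]
  refine (abs_max_sub_max_le_max _ _ _ _).trans ?_
  rw [sub_self, abs_zero, max_eq_left (abs_nonneg _), ← sub_div, abs_div, Nat.abs_cast]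

variable [IsProbabilityMeasure μ] {p : ℕ} {ε : ℤ → Ω → ℝ} {F : ℝ → (Fin p → ℝ) → ℝ → ℝ}
  {q : ℝ} {χ : Fin p → ℝ} {C₁ : ℝ} {Xt : ℤ → ℝ → Ω → ℝ} {X : ℕ → ℤ → Ω → ℝ}

namespace IsStationaryApprox

lemma isSol (h : IsStationaryApprox μ ε F Xt) {u : ℝ} (hu : u ∈ Icc (0 : ℝ) 1) (T : ℤ) :
    IsSol μ ε F (fun _ => u) T (fun t => Xt t u) := by
  obtain ⟨H, hH, he⟩ := h.causal u hu
  refine ⟨fun t _ => ⟨fun ω => H (fun k : ℕ => ε (t - (k : ℤ)) ω), hH.comp ?_, he t⟩,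
    fun t _ => h.recursion u hu t⟩
  refine @measurable_pi_lambda _ _ _ (_) _ _ fun k => ?_
  exact measurable_innovation_sigmaOn ε (by simp)

/-- The lag vector is one fixed measurable function of the innovation past, whose law does not
depend on time. -/
lemma identDistrib_lags (h : IsStationaryApprox μ ε F Xt) (hε : IsIIDInnovations μ ε)
    {u : ℝ} (hu : u ∈ Icc (0 : ℝ) 1) (r : ℕ) (s t : ℤ) :
    IdentDistrib (fun ω => lags r (fun s => Xt s u ω) s) (fun ω => lags r (fun s => Xt s u ω) t)
      μ μ := by
  obtain ⟨H, hH, he⟩ := h.causal u hu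
  set Φ : (ℕ → ℝ) → (Fin r → ℝ) := fun x i => H (fun k => x (i + k)) with hΦdef
  have hΦ : Measurable Φ := by
    refine measurable_pi_lambda _ fun i => hH.comp ?_
    exact measurable_pi_lambda _ fun k => measurable_pi_apply _
  have hpast : ∀ t : ℤ, Measurable (fun ω => fun k : ℕ => ε (t - (k : ℤ)) ω) := fun t =>
    measurable_pi_lambda _ fun k => hε.measurable _
  have heq : ∀ t : ℤ, (fun ω => lags r (fun s => Xt s u ω) t)
      =ᵐ[μ] fun ω => Φ (fun k : ℕ => ε (t - (k : ℤ)) ω) := by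
    intro t
    have := ae_all_iff.2 (fun i : Fin r => he (t - i))
    filter_upwards [this] with ω hω
    funext i
    simp only [lags, hΦdef, hω i]
    congr 1; funext k; congr 1; push_cast; ring
  have hmain : IdentDistrib (fun ω => Φ (fun k : ℕ => ε (s - (k : ℤ)) ω))
      (fun ω => Φ (fun k : ℕ => ε (t - (k : ℤ)) ω)) μ μ :=
    IdentDistrib.comp ⟨(hpast s).aemeasurable, (hpast t).aemeasurable, hε.map_past_eq s t⟩ hΦ
  have hs : IdentDistrib (fun ω => lags r (fun s => Xt s u ω) s)
      (fun ω => Φ (fun k : ℕ => ε (s - (k : ℤ)) ω)) μ μ :=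
    IdentDistrib.of_ae_eq ((hΦ.comp (hpast s)).aemeasurable.congr (heq s).symm) (heq s)
  have ht : IdentDistrib (fun ω => lags r (fun s => Xt s u ω) t)
      (fun ω => Φ (fun k : ℕ => ε (t - (k : ℤ)) ω)) μ μ :=
    IdentDistrib.of_ae_eq ((hΦ.comp (hpast t)).aemeasurable.congr (heq t).symm) (heq t)
  exact (hs.trans hmain).trans ht.symm

lemma nq_le (h : IsStationaryApprox μ ε F Xt) (hm : Model μ ε F q χ C₁)
    {u : ℝ} (hu : u ∈ Icc (0 : ℝ) 1) (t : ℤ) :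
    nq μ q (Xt t u) ≤ ENNReal.ofReal (Model.bound χ C₁) := by
  refine hm.stationary_bound (v := fun _ => u) (fun _ => hu) (Z := fun t => Xt t u)
    (fun T => h.isSol hu T) (fun t => ?_) t
  have := (h.identDistrib_lags hm.iid hu 1 t 0).comp (measurable_pi_apply (0 : Fin 1))
  simpa [Function.comp_def, lags] using this

end IsStationaryApprox

namespace IsLocallyStationary

/-- Up to time 0 the process is the stationary solution at `u = 0`, and the recursion carries
causality forward. The cap at one in `path` keeps the parameter admissible at all times and is
invisible for `t ≤ n`. -/
lemma isSol (hX : IsLocallyStationary μ ε F Xt X) (hm : Model μ ε F q χ C₁)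
    (h : IsStationaryApprox μ ε F Xt) (n : ℕ) : IsSol μ ε F (path n) n (X n) := by
  have hrec : ∀ t : ℤ, t ≤ n → ∀ᵐ ω ∂μ,
      X n t ω = F (ε t ω) (lags p (fun s => X n s ω) (t - 1)) (path n t) := by
    intro t ht
    rw [path_eq ht]
    exact hX.recursion n t ht
  refine ⟨?_, hrec⟩
  have key : ∀ (m : ℕ) (t : ℤ), t ≤ m → t ≤ n → Causal μ ε t (X n t) := by
    intro m
    induction m with
    | zero =>
      intro t ht _
      have ht : t ≤ 0 := by simpa using ht
      exact ((h.isSol (u := 0) (by simp) t).causal t le_rfl).congr (hX.past n t ht)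
    | succ m ih =>
      intro t ht htn
      refine (hm.causal_step (path_mem n t) (Causal.lags fun s hs => ih s ?_ ?_)).congr (hrec t htn)
      · push_cast at ht; omega
      · omega
  exact fun t ht => key n t ht ht

lemma nq_le (hX : IsLocallyStationary μ ε F Xt X) (hm : Model μ ε F q χ C₁)
    (h : IsStationaryApprox μ ε F Xt) {n : ℕ} {t : ℤ} (ht : t ≤ n) :
    nq μ q (X n t) ≤ ENNReal.ofReal (Model.bound χ C₁) := by
  have hsol := hX.isSol hm h n
  have key : ∀ (m : ℕ) (t : ℤ), t ≤ m → t ≤ n →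
      nq μ q (X n t) ≤ ENNReal.ofReal (Model.bound χ C₁) := by
    intro m
    induction m with
    | zero =>
      intro t ht _
      have ht : t ≤ 0 := by simpa using ht
      rw [nq, eLpNorm_congr_ae (hX.past n t ht)]
      exact h.nq_le hm (by simp) t
    | succ m ih =>
      intro t ht htn
      rw [nq, eLpNorm_congr_ae (hsol.recursion t htn)]
      refine hm.step_bound (path_mem n t) (Causal.lags fun s hs => hsol.causal s (by omega))
        fun i => ih _ ?_ ?_
      · push_cast at ht; omega
      · omega
  exact key n t ht ht

end IsLocallyStationary

/-- Condition (L4) along the stationary solutions. -/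
lemma CondL4.exists_bound (h4 : CondL4 μ ε F Xt q) (hm : Model μ ε F q χ C₁)
    (h : IsStationaryApprox μ ε F Xt) :
    ∃ α H : ℝ, 0 < α ∧ α ≤ 1 ∧ 0 ≤ H ∧ ∀ u ∈ Icc (0 : ℝ) 1, ∀ v ∈ Icc (0 : ℝ) 1, ∀ t : ℤ,
      nq μ q (fun ω => F (ε t ω) (lags p (fun s => Xt s u ω) (t - 1)) v
        - F (ε t ω) (lags p (fun s => Xt s u ω) (t - 1)) u) ≤ ENNReal.ofReal (H * |v - u| ^ α) := by
  obtain ⟨α, hα, hα1, hS⟩ := h4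
  set S := ⨆ u ∈ Icc (0 : ℝ) 1,
      lqNorm μ q (fun ω => holderConst μ ε F q α (lags p (fun s => Xt s u ω) 0)) with hSdef
  have hq := hm.pos
  refine ⟨α, S.toReal, hα, hα1, ENNReal.toReal_nonneg, fun u hu v hv t => ?_⟩
  rcases eq_or_ne v u with rfl | hne
  · simp
  have hpos : 0 < |v - u| ^ α := Real.rpow_pos_of_pos (abs_pos.2 (sub_ne_zero.2 hne)) α
  have hΦ : Measurable (fun x : ℝ × (Fin p → ℝ) => ‖F x.1 x.2 v - F x.1 x.2 u‖ₑ ^ q) :=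
    ((hm.meas v hv).sub (hm.meas u hu)).enorm.pow_const q
  have hcaus : ∀ t, Causal μ ε t (fun ω => lags p (fun s => Xt s u ω) t) := fun t =>
    Causal.lags fun s _ => (h.isSol hu s).causal s le_rfl
  -- Integrating out `ε t` leaves a function of the lag vector alone, which stationarity moves to
  -- time 0, where (L4) is stated.
  set φ : (Fin p → ℝ) → ℝ≥0∞ := fun y => ∫⁻ ω', ‖F (ε 0 ω') y v - F (ε 0 ω') y u‖ₑ ^ q ∂μ
  have hφ : Measurable φ := by
    have : Measurable (fun x : Ω × (Fin p → ℝ) =>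
        ‖F (ε 0 x.1) x.2 v - F (ε 0 x.1) x.2 u‖ₑ ^ q) :=
      hΦ.comp (((hm.iid.measurable 0).comp measurable_fst).prodMk measurable_snd)
    exact this.lintegral_prod_left'
  rw [ENNReal.ofReal_mul ENNReal.toReal_nonneg, ENNReal.ofReal_toReal hS.ne, nq_le_iff hq]
  have h1 : ∫⁻ ω, ‖F (ε t ω) (lags p (fun s => Xt s u ω) (t - 1)) v
      - F (ε t ω) (lags p (fun s => Xt s u ω) (t - 1)) u‖ₑ ^ q ∂μ =
      ∫⁻ ω, φ (lags p (fun s => Xt s u ω) (t - 1)) ∂μ :=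
    hm.iid.lintegral_innovation (hcaus (t - 1)) hΦ
  have h2 : ∫⁻ ω, φ (lags p (fun s => Xt s u ω) (t - 1)) ∂μ =
      ∫⁻ ω, φ (lags p (fun s => Xt s u ω) 0) ∂μ :=
    ((h.identDistrib_lags hm.iid hu p (t - 1) 0).comp hφ).lintegral_eq
  rw [h1, h2]
  have h3 : lqNorm μ q (fun ω => holderConst μ ε F q α (lags p (fun s => Xt s u ω) 0)) ≤ S :=
    le_iSup₂ (f := fun u (_ : u ∈ Icc (0 : ℝ) 1) =>
      lqNorm μ q (fun ω => holderConst μ ε F q α (lags p (fun s => Xt s u ω) 0))) u hu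
  rw [lqNorm, one_div, ENNReal.rpow_inv_le_iff hq] at h3
  rw [ENNReal.mul_rpow_of_nonneg _ _ hq.le]
  refine le_trans ?_ (mul_le_mul_left h3 _)
  -- The constant is finite, so it enters the integral without measurability of `holderConst`.
  rw [← lintegral_mul_const' _ _ (ENNReal.rpow_ne_top_of_nonneg hq.le ENNReal.ofReal_ne_top)]
  refine lintegral_mono fun ω => ?_
  set y := lags p (fun s => Xt s u ω) 0
  rw [← ENNReal.mul_rpow_of_nonneg _ _ hq.le]
  have h5 : lqNorm μ q (fun ω => ‖F (ε 0 ω) y v - F (ε 0 ω) y u‖ₑ) / ENNReal.ofReal (|v - u| ^ α)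
      ≤ holderConst μ ε F q α y := by
    unfold holderConst
    refine le_trans ?_ (le_iSup₂ (f := fun u (_ : u ∈ Icc (0 : ℝ) 1) =>
      ⨆ u' ∈ Icc (0 : ℝ) 1, ⨆ _ : u ≠ u', lqNorm μ q (fun ω => ‖F (ε 0 ω) y u - F (ε 0 ω) y u'‖ₑ)
        / ENNReal.ofReal (|u - u'| ^ α)) v hv)
    refine le_trans ?_ (le_iSup₂ (f := fun u' (_ : u' ∈ Icc (0 : ℝ) 1) =>
      ⨆ _ : v ≠ u', lqNorm μ q (fun ω => ‖F (ε 0 ω) y v - F (ε 0 ω) y u'‖ₑ)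
        / ENNReal.ofReal (|v - u'| ^ α)) u hu)
    exact le_iSup (f := fun _ : v ≠ u => lqNorm μ q (fun ω => ‖F (ε 0 ω) y v - F (ε 0 ω) y u‖ₑ)
        / ENNReal.ofReal (|v - u| ^ α)) hne
  rw [ENNReal.div_le_iff (by simpa using hpos) ENNReal.ofReal_ne_top, lqNorm, one_div,
    ENNReal.rpow_inv_le_iff hq] at h5
  exact h5

/-- Distance between a solution with varying parameter and a stationary solution. -/
lemma Model.sub_stationary_le (hm : Model μ ε F q χ C₁) (h : IsStationaryApprox μ ε F Xt)
    {α H : ℝ} (hα : 0 < α) (hα1 : α ≤ 1) (hH : 0 ≤ H)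
    (hbd : ∀ u ∈ Icc (0 : ℝ) 1, ∀ v ∈ Icc (0 : ℝ) 1, ∀ t : ℤ,
      nq μ q (fun ω => F (ε t ω) (lags p (fun s => Xt s u ω) (t - 1)) v
        - F (ε t ω) (lags p (fun s => Xt s u ω) (t - 1)) u) ≤ ENNReal.ofReal (H * |v - u| ^ α))
    {v : ℤ → ℝ} (hv : ∀ t, v t ∈ Icc (0 : ℝ) 1) {κ : ℝ} (hκ : 0 ≤ κ)
    (hvκ : ∀ (t : ℤ) (i : Fin p), |v (t - 1 - i) - v t| ≤ κ) {T : ℤ} {Z : ℤ → Ω → ℝ}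
    (hZ : IsSol μ ε F v T Z) (hb : ∀ t ≤ T, nq μ q (Z t) ≤ ENNReal.ofReal (bound χ C₁))
    {u : ℝ} (hu : u ∈ Icc (0 : ℝ) 1) {t : ℤ} (ht : t ≤ T) :
    nq μ q (fun ω => Z t ω - Xt t u ω) ≤
      ENNReal.ofReal (2 * H / (1 - ∑ i, χ i) *
        (|v t - u| + 2 / (1 - ∑ i, χ i) * κ) ^ α) := by
  set s := ∑ i, χ i with hs
  have hs1 : 0 < 1 - s := by have := hm.weight_lt; linarith
  have hs0 : 0 ≤ s := hm.sum_nonneg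
  set c := 2 / (1 - s) with hc
  have hc0 : 0 < c := by positivity
  have hcs : c * (1 - s) = 2 := by rw [hc]; field_simp
  set A := 2 * H / (1 - s) with hA
  have hA0 : 0 ≤ A := by positivity
  have hAs : A * (1 - s) = 2 * H := by rw [hA]; field_simp
  set R := bound χ C₁ with hR
  have hR0 : 0 ≤ R := hm.bound_nonneg
  -- A supersolution of the error recursion, in which a lag moves the parameter by at most `κ`. By
  -- the choice of `c`, `x + κ + c κ ≤ (3-s)/2 · (x + c κ)`; as `α ≤ 1`, the power grows by at most
  -- the same factor, and `s(3-s)/2 + (1-s)/2 = 1 - (1-s)²/2`.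
  have real_step : ∀ x : ℝ, 0 ≤ x →
      s * (A * (x + κ + c * κ) ^ α) + H * x ^ α ≤ A * (x + c * κ) ^ α := by
    intro x hx
    have hy : 0 ≤ x + c * κ := by positivity
    have h1 : (x + κ + c * κ) ^ α ≤ ((3 - s) / 2) * (x + c * κ) ^ α := by
      have h2 : x + κ + c * κ ≤ ((3 - s) / 2) * (x + c * κ) := by nlinarith
      have h3 : 1 ≤ (3 - s) / 2 := by linarith
      calc (x + κ + c * κ) ^ α ≤ (((3 - s) / 2) * (x + c * κ)) ^ α :=
            Real.rpow_le_rpow (by positivity) h2 hα.le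
        _ = ((3 - s) / 2) ^ α * (x + c * κ) ^ α := Real.mul_rpow (by linarith) hy
        _ ≤ ((3 - s) / 2) * (x + c * κ) ^ α := by
            refine mul_le_mul_of_nonneg_right ?_ (Real.rpow_nonneg hy _)
            simpa using Real.rpow_le_rpow_of_exponent_le h3 hα1
    have h4 : x ^ α ≤ (x + c * κ) ^ α :=
      Real.rpow_le_rpow hx (by nlinarith [mul_nonneg hc0.le hκ]) hα.le
    set Y := (x + c * κ) ^ α
    have hY : 0 ≤ Y := Real.rpow_nonneg hy _
    have h5 : s * (A * (x + κ + c * κ) ^ α) ≤ s * (A * ((3 - s) / 2 * Y)) := by gcongr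
    have h6 : H * x ^ α ≤ H * Y := by gcongr
    have h7 : s * (A * ((3 - s) / 2 * Y)) + H * Y ≤ A * Y := by
      have : A * Y - s * (A * ((3 - s) / 2 * Y)) - H * Y = A * Y * (1 - s) ^ 2 / 2 := by
        have hHe : H = A * (1 - s) / 2 := by linarith
        rw [hHe]; ring
      have : 0 ≤ A * Y * (1 - s) ^ 2 / 2 := by positivity
      linarith
    linarith
  have hcX : ∀ t, Causal μ ε t (Xt t u) := fun t => (h.isSol hu t).causal t le_rfl
  -- Iterate from the crude bound `2R`; its contribution decays like `s^k` and only the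
  -- supersolution survives.
  have key : ∀ (k : ℕ) (t : ℤ), t ≤ T → nq μ q (fun ω => Z t ω - Xt t u ω) ≤
      ENNReal.ofReal (2 * R * s ^ k + A * (|v t - u| + c * κ) ^ α) := by
    intro k
    induction k with
    | zero =>
      intro t ht
      have h1 := nq_add_le hm.one_le ((hZ.causal t ht).aestronglyMeasurable hm.iid)
        ((hcX t).aestronglyMeasurable hm.iid).neg hR0 hR0 (hb t ht)
        ((nq_neg (Xt t u)).le.trans (h.nq_le hm hu t))
      refine le_trans (le_of_eq ?_) (h1.trans (ENNReal.ofReal_le_ofReal ?_))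
      · simp [sub_eq_add_neg]
      · have : 0 ≤ A * (|v t - u| + c * κ) ^ α := by positivity
        simp only [pow_zero]; linarith
    | succ k ih =>
      intro t ht
      have hY1 : Causal μ ε (t - 1) (fun ω => lags p (fun s => Z s ω) (t - 1)) :=
        Causal.lags fun s hs => hZ.causal s (by omega)
      have hY2 : Causal μ ε (t - 1) (fun ω => lags p (fun s => Xt s u ω) (t - 1)) :=
        Causal.lags fun s hs => hcX s
      set x := |v t - u| with hx
      have h1 := hm.contraction_one (hv t) hY1 hY2
        (r := fun _ => 2 * R * s ^ k + A * (x + κ + c * κ) ^ α) (fun _ => by positivity) (by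
          intro i
          refine (ih (t - 1 - i) (by omega)).trans (ENNReal.ofReal_le_ofReal ?_)
          gcongr
          have := abs_sub_le (v (t - 1 - i)) (v t) u
          linarith [hvκ t i])
      have m1 := (hm.causal_step (hv t) hY1).aestronglyMeasurable hm.iid
      have m2 := (hm.causal_step (hv t) hY2).aestronglyMeasurable hm.iid
      have m3 := (hm.causal_step hu hY2).aestronglyMeasurable hm.iid
      have h2 := nq_add_le hm.one_le (m1.sub m2) (m2.sub m3) (Finset.sum_nonneg fun i _ =>
        mul_nonneg (hm.weight_nonneg i) (by positivity)) (by positivity) h1 (hbd u hu (v t) (hv t) t)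
      refine le_trans (le_of_eq (eLpNorm_congr_ae ?_)) (h2.trans (ENNReal.ofReal_le_ofReal ?_))
      · filter_upwards [hZ.recursion t ht, h.recursion u hu t] with ω h3 h4
        rw [h3, h4]; simp
      · rw [← Finset.sum_mul, ← hs]
        have := real_step x (abs_nonneg _)
        calc s * (2 * R * s ^ k + A * (x + κ + c * κ) ^ α) + H * x ^ α
            = 2 * R * s ^ (k + 1) + (s * (A * (x + κ + c * κ) ^ α) + H * x ^ α) := by ring
          _ ≤ _ := by linarith
  refine ge_of_tendsto' (x := atTop) ?_ (fun k => key k t ht)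
  refine ENNReal.tendsto_ofReal ?_
  have := (tendsto_pow_atTop_nhds_zero_of_lt_one hs0 (by linarith : s < 1)).const_mul (2 * R)
  simpa using this.add_const (A * (|v t - u| + c * κ) ^ α)

/-- The stationary approximation, in `L^q`. -/
lemma exists_approx (hm : Model μ ε F q χ C₁) (h : IsStationaryApprox μ ε F Xt)
    (hX : IsLocallyStationary μ ε F Xt X) (h4 : CondL4 μ ε F Xt q) :
    ∃ A c α : ℝ, 0 ≤ A ∧ 0 ≤ c ∧ 0 < α ∧
      (∀ (n : ℕ) (t : ℤ), t ≤ n → ∀ u ∈ Icc (0 : ℝ) 1,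
        nq μ q (fun ω => X n t ω - Xt t u ω) ≤ ENNReal.ofReal (A * (|path n t - u| + c / n) ^ α)) ∧
      (∀ u ∈ Icc (0 : ℝ) 1, ∀ u' ∈ Icc (0 : ℝ) 1, ∀ t : ℤ,
        nq μ q (fun ω => Xt t u ω - Xt t u' ω) ≤ ENNReal.ofReal (A * |u - u'| ^ α)) := by
  obtain ⟨α, H, hα, hα1, hH, hbd⟩ := h4.exists_bound hm h
  have hs : 0 < 1 - ∑ i, χ i := by have := hm.weight_lt; linarith
  refine ⟨2 * H / (1 - ∑ i, χ i), 2 / (1 - ∑ i, χ i) * p, α, by positivity, by positivity, hα,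
    ?_, ?_⟩
  -- Lags move `path n` by at most `p / n`; a constant path has `κ = 0`, which gives the Hölder
  -- dependence on `u`.
  · intro n t ht u hu
    have := hm.sub_stationary_le h hα hα1 hH hbd (path_mem n) (κ := p / n) (by positivity) ?_
      (hX.isSol hm h n) (fun t ht => hX.nq_le hm h ht) hu ht
    · rwa [← mul_div_assoc] at this
    · intro t i
      refine (abs_path_sub_le n _ _).trans ?_
      gcongr
      have h1 : (i : ℝ) + 1 ≤ p := by exact_mod_cast i.2
      push_cast
      rw [abs_le]; constructor <;> linarith [(Nat.cast_nonneg (i : ℕ) : (0 : ℝ) ≤ (i : ℕ))]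
  · intro u hu u' hu' t
    have := hm.sub_stationary_le h hα hα1 hH hbd (v := fun _ => u) (fun _ => hu) (κ := 0) le_rfl
      (by simp) (h.isSol hu t) (fun t _ => h.nq_le hm hu t) hu' le_rfl
    simpa using this

end LocStat

end

/-! ### Locally Lipschitz functions of polynomial growth -/

noncomputable section


namespace LocStat

lemma l1_nonneg {r : ℕ} (y : Fin r → ℝ) : 0 ≤ l1 y := Finset.sum_nonneg fun _ _ => abs_nonneg _

lemma continuous_l1 {r : ℕ} : Continuous (l1 : (Fin r → ℝ) → ℝ) := by
  unfold l1; fun_prop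

lemma abs_le_l1 {r : ℕ} (y : Fin r → ℝ) (i : Fin r) : |y i| ≤ l1 y :=
  Finset.single_le_sum (f := fun i => |y i|) (fun _ _ => abs_nonneg _) (Finset.mem_univ i)

lemma l1_sub_comm {r : ℕ} (y z : Fin r → ℝ) : l1 (y - z) = l1 (z - y) := by
  simp only [l1, Pi.sub_apply, abs_sub_comm]

lemma l1_sub_le {r : ℕ} (x y z : Fin r → ℝ) : l1 (x - z) ≤ l1 (x - y) + l1 (y - z) := by
  simp only [l1, Pi.sub_apply, ← Finset.sum_add_distrib]
  exact Finset.sum_le_sum fun i _ => abs_sub_le _ _ _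

lemma abs_l1_sub_l1_le {r : ℕ} (y z : Fin r → ℝ) : |l1 y - l1 z| ≤ l1 (y - z) := by
  have h1 := l1_sub_le y z 0
  have h2 := l1_sub_le z y 0
  simp only [sub_zero] at h1 h2
  rw [l1_sub_comm z y] at h2
  rw [abs_le]; constructor <;> linarith

namespace ClassL

variable {r : ℕ} {M C : ℝ} {g : (Fin r → ℝ) → ℝ}

lemma continuous (hg : ClassL univ M C g) : Continuous g := by
  rw [continuous_iff_continuousAt]
  intro y
  rw [ContinuousAt, tendsto_iff_dist_tendsto_zero]
  have hM := hg.1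
  have h1 : Continuous (fun z : Fin r → ℝ => C * (l1 (z - y) * (1 + l1 z ^ M + l1 y ^ M))) := by
    have h2 : Continuous (fun z : Fin r → ℝ => l1 (z - y)) :=
      continuous_l1.comp (continuous_id.sub continuous_const)
    have h3 : Continuous (fun z : Fin r → ℝ => l1 z ^ M) :=
      continuous_l1.rpow_const fun _ => Or.inr hM
    fun_prop
  have h2 := h1.tendsto y
  have h0 : l1 (y - y) = 0 := by simp [l1]
  simp only [h0, zero_mul, mul_zero] at h2
  refine squeeze_zero (fun _ => dist_nonneg) (fun z => ?_) h2
  rw [Real.dist_eq]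
  exact hg.2 z (mem_univ _) y (mem_univ _)

lemma abs (hg : ClassL univ M C g) : ClassL univ M C (fun z => |g z|) :=
  ⟨hg.1, fun y hy y' hy' => (abs_abs_sub_abs_le_abs_sub _ _).trans (hg.2 y hy y' hy')⟩

end ClassL

/-- For `b ≤ a`, Bernoulli's inequality for `(b/a)^(M+1)` gives `a^(M+1) - b^(M+1) ≤ (M+1)(a-b)a^M`.
-/
lemma abs_rpow_sub_rpow_le {M a b : ℝ} (hM : 0 ≤ M) (ha : 0 ≤ a) (hb : 0 ≤ b) :
    |a ^ (M + 1) - b ^ (M + 1)| ≤ (M + 1) * (|a - b| * (1 + a ^ M + b ^ M)) := by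
  wlog hab : b ≤ a generalizing a b
  · have := this hb ha (le_of_not_ge hab)
    rw [abs_sub_comm, abs_sub_comm a b]
    refine this.trans (le_of_eq ?_); ring
  rw [abs_of_nonneg (sub_nonneg.2 (Real.rpow_le_rpow hb hab (by linarith))),
    abs_of_nonneg (sub_nonneg.2 hab)]
  have hbM : 0 ≤ b ^ M := Real.rpow_nonneg hb M
  rcases eq_or_lt_of_le ha with rfl | hapos
  · have : b = 0 := le_antisymm hab hb
    subst this; simp
  have h1 := one_add_mul_self_le_rpow_one_add (s := b / a - 1) (p := M + 1)
    (by have : 0 ≤ b / a := by positivity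
        linarith) (by linarith)
  have h2 : (1 + (b / a - 1)) ^ (M + 1) = b ^ (M + 1) / a ^ (M + 1) := by
    rw [add_sub_cancel, Real.div_rpow hb ha]
  rw [h2] at h1
  have h3 : a ^ (M + 1) = a ^ M * a := by rw [Real.rpow_add_one hapos.ne']
  have haM : 0 < a ^ M := Real.rpow_pos_of_pos hapos M
  rw [le_div_iff₀ (by positivity), h3] at h1
  have h4 : (1 + (M + 1) * (b / a - 1)) * (a ^ M * a) = a ^ M * a - (M + 1) * (a - b) * a ^ M := by
    field_simp
    ring
  rw [h4] at h1
  rw [h3]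
  have h5 : 0 ≤ (M + 1) * ((a - b) * (1 + b ^ M)) :=
    mul_nonneg (by linarith) (mul_nonneg (by linarith) (by linarith))
  nlinarith

lemma classL_rpow {r : ℕ} {M : ℝ} (hM : 0 ≤ M) :
    ClassL univ M (M + 1) (fun z : Fin r → ℝ => l1 z ^ (M + 1)) := by
  refine ⟨hM, fun y _ y' _ => (abs_rpow_sub_rpow_le hM (l1_nonneg y) (l1_nonneg y')).trans ?_⟩
  have := Real.rpow_nonneg (l1_nonneg y) M
  have := Real.rpow_nonneg (l1_nonneg y') M
  gcongr
  exact abs_l1_sub_l1_le y y'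

variable {Ω : Type*} [mΩ : MeasurableSpace Ω] {μ : Measure Ω}

/-- Hölder's inequality with weights `1/(M+1)` and `M/(M+1)`; this is the source of the exponent
`q/(M+1)`. -/
lemma nq_mul_rpow_le {q M : ℝ} (hM : 0 ≤ M) (hq : 0 < q) {a B : Ω → ℝ} (ha : AEMeasurable a μ)
    (hB : AEMeasurable B μ) (hB0 : ∀ ω, 0 ≤ B ω) :
    nq μ (q / (M + 1)) (fun ω => a ω * B ω ^ M) ≤ nq μ q a * nq μ q B ^ M := by
  have hM1 : 0 < M + 1 := by linarith
  have hQ : 0 < q / (M + 1) := by positivity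
  rw [nq_le_iff hQ, nq_eq hq, nq_eq hq]
  have h1 : ∀ ω, ‖a ω * B ω ^ M‖ₑ ^ (q / (M + 1))
      = (‖a ω‖ₑ ^ q) ^ (1 / (M + 1)) * (‖B ω‖ₑ ^ q) ^ (M / (M + 1)) := by
    intro ω
    have : ‖B ω ^ M‖ₑ = ‖B ω‖ₑ ^ M := by
      rw [Real.enorm_eq_ofReal (Real.rpow_nonneg (hB0 ω) M), Real.enorm_eq_ofReal (hB0 ω),
        ENNReal.ofReal_rpow_of_nonneg (hB0 ω) hM]
    rw [enorm_mul, this, ENNReal.mul_rpow_of_nonneg _ _ hQ.le, ← ENNReal.rpow_mul,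
      ← ENNReal.rpow_mul, ← ENNReal.rpow_mul]
    congr 2 <;> field_simp
  simp_rw [h1]
  refine (ENNReal.lintegral_mul_norm_pow_le (ha.enorm.pow_const q) (hB.enorm.pow_const q)
    (by positivity) (by positivity) (by field_simp; ring)).trans (le_of_eq ?_)
  rw [ENNReal.mul_rpow_of_nonneg _ _ hQ.le, ← ENNReal.rpow_mul, ← ENNReal.rpow_mul,
    ← ENNReal.rpow_mul]
  congr 2 <;> field_simp

/-- With the growth collected in a single power, Hölder is applied once and Minkowski handles the
base. -/
lemma one_add_rpow_add_rpow_le {M x y : ℝ} (hM : 0 ≤ M) (hx : 0 ≤ x) (hy : 0 ≤ y) :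
    1 + x ^ M + y ^ M ≤ 3 * (1 + x + y) ^ M := by
  have h1 : (1 : ℝ) ≤ (1 + x + y) ^ M := Real.one_le_rpow (by linarith) hM
  have h2 : x ^ M ≤ (1 + x + y) ^ M := Real.rpow_le_rpow hx (by linarith) hM
  have h3 : y ^ M ≤ (1 + x + y) ^ M := Real.rpow_le_rpow hy (by linarith) hM
  linarith

lemma nq_l1_le {r : ℕ} {q : ℝ} (hq : 1 ≤ q) {z : Ω → (Fin r → ℝ)} (hz : AEMeasurable z μ)
    {R : ℝ} (hR : 0 ≤ R) (h : ∀ i, nq μ q (fun ω => z ω i) ≤ ENNReal.ofReal R) :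
    nq μ q (fun ω => l1 (z ω)) ≤ ENNReal.ofReal (r * R) := by
  have := nq_sum_le hq Finset.univ (f := fun (i : Fin r) ω => |z ω i|) (μ := μ)
    (a := fun _ => R) (fun i _ => (continuous_abs.measurable.comp_aemeasurable
      (aemeasurable_pi_iff.1 hz i)).aestronglyMeasurable) (fun _ _ => hR)
    (fun i _ => (nq_mono (g := fun ω => z ω i) fun ω => by simp).trans (h i))
  simpa [l1] using this

/-- The Lipschitz constant of `g ∈ 𝓛_r(M, C)` on random vectors with moments bounded by `R`. -/
def lipConst (r : ℕ) (M C R : ℝ) : ℝ := C * 3 * (r * (1 + 2 * (r * R)) ^ M)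

lemma lipConst_nonneg {r : ℕ} {M C R : ℝ} (hC : 0 ≤ C) (hR : 0 ≤ R) : 0 ≤ lipConst r M C R := by
  unfold lipConst; positivity

/-- Transfers every approximation of the process to `g`: the local Lipschitz constant is dominated
by the `M`-th power of a variable with bounded `L^q` norm, so Hölder keeps the error linear in `δ`
and lowers the exponent. -/
lemma ClassL.nq_sub_le [IsProbabilityMeasure μ] {r : ℕ} {M C : ℝ} {g : (Fin r → ℝ) → ℝ}
    (hg : ClassL univ M C g) (hC : 0 ≤ C) {q : ℝ} (hq : 1 ≤ q)
    {z z' : Ω → (Fin r → ℝ)} (hz : AEMeasurable z μ) (hz' : AEMeasurable z' μ)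
    {R δ : ℝ} (hR : 0 ≤ R) (hδ : 0 ≤ δ)
    (h : ∀ i, nq μ q (fun ω => z ω i) ≤ ENNReal.ofReal R)
    (h' : ∀ i, nq μ q (fun ω => z' ω i) ≤ ENNReal.ofReal R)
    (hd : ∀ i, nq μ q (fun ω => z ω i - z' ω i) ≤ ENNReal.ofReal δ) :
    nq μ (q / (M + 1)) (fun ω => g (z ω) - g (z' ω)) ≤ ENNReal.ofReal (lipConst r M C R * δ) := by
  have hM := hg.1
  have hq0 : 0 < q := by linarith
  have h1 : nq μ (q / (M + 1)) (fun ω => g (z ω) - g (z' ω)) ≤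
      nq μ (q / (M + 1)) (fun ω => (C * 3) * (l1 (z ω - z' ω) * (1 + l1 (z ω) + l1 (z' ω)) ^ M)) := by
    refine nq_mono fun ω => ?_
    refine le_trans (hg.2 (z ω) (mem_univ _) (z' ω) (mem_univ _)) (le_trans ?_ (le_abs_self _))
    have := one_add_rpow_add_rpow_le hM (l1_nonneg (z ω)) (l1_nonneg (z' ω))
    calc C * (l1 (z ω - z' ω) * (1 + l1 (z ω) ^ M + l1 (z' ω) ^ M))
        ≤ C * (l1 (z ω - z' ω) * (3 * (1 + l1 (z ω) + l1 (z' ω)) ^ M)) := by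
          gcongr
          exact l1_nonneg _
      _ = _ := by ring
  have ml : ∀ {w : Ω → (Fin r → ℝ)}, AEMeasurable w μ → AEMeasurable (fun ω => l1 (w ω)) μ :=
    fun hw => continuous_l1.measurable.comp_aemeasurable hw
  have h2 : nq μ q (fun ω => l1 (z ω - z' ω)) ≤ ENNReal.ofReal (r * δ) :=
    nq_l1_le hq (hz.sub hz') hδ hd
  have h3 : nq μ q (fun ω => 1 + l1 (z ω) + l1 (z' ω)) ≤ ENNReal.ofReal (1 + r * R + r * R) :=
    nq_add_le hq (aemeasurable_const.add (ml hz)).aestronglyMeasurable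
      (ml hz').aestronglyMeasurable (by positivity) (by positivity)
      (nq_add_le hq aestronglyMeasurable_const (ml hz).aestronglyMeasurable zero_le_one
        (by positivity) (by rw [nq_const hq]; simp) (nq_l1_le hq hz hR h)) (nq_l1_le hq hz' hR h')
  refine h1.trans ?_
  rw [nq_const_mul]
  refine (mul_le_mul_right (nq_mul_rpow_le hM hq0 (ml (hz.sub hz'))
    ((aemeasurable_const.add (ml hz)).add (ml hz')) fun ω => ?_) _).trans ?_
  · have := l1_nonneg (z ω)
    have := l1_nonneg (z' ω)
    simp only [Pi.add_apply]
    positivity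
  · have hb : 0 ≤ 1 + r * R + r * R := by positivity
    calc ENNReal.ofReal |C * 3| * (nq μ q (fun ω => l1 (z ω - z' ω)) *
          nq μ q (fun ω => 1 + l1 (z ω) + l1 (z' ω)) ^ M)
        ≤ ENNReal.ofReal (C * 3) * (ENNReal.ofReal (r * δ) *
          ENNReal.ofReal (1 + r * R + r * R) ^ M) := by
          rw [abs_of_nonneg (by positivity)]
          gcongr
      _ = _ := by
          rw [ENNReal.ofReal_rpow_of_nonneg hb hM, ← ENNReal.ofReal_mul (by positivity),
            ← ENNReal.ofReal_mul (by positivity), lipConst]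
          congr 1
          rw [show 1 + r * R + r * R = 1 + 2 * (r * R) by ring]; ring

lemma integrable_of_nq [IsProbabilityMeasure μ] {Q : ℝ} (hQ : 1 ≤ Q) {f : Ω → ℝ}
    (hf : AEStronglyMeasurable f μ) {a : ℝ} (ha : 0 ≤ a) (h : nq μ Q f ≤ ENNReal.ofReal a) :
    Integrable f μ ∧ ∫ ω, |f ω| ∂μ ≤ a := by
  have h1 : eLpNorm f 1 μ ≤ ENNReal.ofReal a :=
    (eLpNorm_le_eLpNorm_of_exponent_le (one_le_ofReal hQ) hf).trans h
  have hi : Integrable f μ := memLp_one_iff_integrable.1 ⟨hf, h1.trans_lt ENNReal.ofReal_lt_top⟩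
  refine ⟨hi, ?_⟩
  rw [eLpNorm_one_eq_lintegral_enorm, ← ofReal_integral_norm_eq_lintegral_enorm hi] at h1
  exact (ENNReal.ofReal_le_ofReal_iff ha).1 h1

end LocStat

end

/-! ### Kernels of bounded variation and weighted sums -/

noncomputable section


namespace LocStat

/-- A kernel with a bounded monotone function `V` controlling its increments. -/
structure IsBVKernel (K V : ℝ → ℝ) (B : ℝ) : Prop where
  abs_le : ∀ x, |K x| ≤ B
  support : ∀ x, x ∉ Icc (-(1 / 2) : ℝ) (1 / 2) → K x = 0
  mono : Monotone V
  nonneg : ∀ x, 0 ≤ V x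
  le : ∀ x, V x ≤ B
  var : ∀ x y, x ≤ y → |K y - K x| ≤ V y - V x
  integrable : Integrable K
  integral_eq_one : ∫ x, K x = 1

lemma IsKernel.exists_bv {K : ℝ → ℝ} (hK : IsKernel K) : ∃ V B, IsBVKernel K V B := by
  obtain ⟨B, hB⟩ := hK.bounded
  have hbv := hK.boundedVariation
  have hfin : ∀ x, eVariationOn K (Iic x) ≠ ∞ := fun x =>
    ne_top_of_le_ne_top hbv (eVariationOn.mono K (subset_univ _))
  refine ⟨fun x => (eVariationOn K (Iic x)).toReal, max B (eVariationOn K univ).toReal,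
    fun x => (hB x).trans (le_max_left _ _), hK.support, ?_, fun x => ENNReal.toReal_nonneg,
    fun x => (ENNReal.toReal_mono hbv (eVariationOn.mono K (subset_univ _))).trans
      (le_max_right _ _), ?_, ?_, hK.integral_eq_one⟩
  · intro x y hxy
    exact ENNReal.toReal_mono (hfin y) (eVariationOn.mono K (Iic_subset_Iic.2 hxy))
  · intro x y hxy
    have h1 := eVariationOn.union K (s := Iic x) (t := Icc x y) (x := x) isGreatest_Iic
      (isLeast_Icc hxy)
    rw [Iic_union_Icc_eq_Iic hxy] at h1
    have h2 : edist (K y) (K x) ≤ eVariationOn K (Icc x y) :=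
      eVariationOn.edist_le K (right_mem_Icc.2 hxy) (left_mem_Icc.2 hxy)
    have h3 : eVariationOn K (Icc x y) ≠ ∞ :=
      ne_top_of_le_ne_top hbv (eVariationOn.mono K (subset_univ _))
    rw [h1, ENNReal.toReal_add (hfin x) h3, add_sub_cancel_left, ← Real.dist_eq, dist_edist]
    exact ENNReal.toReal_mono h3 h2
  -- A non-integrable function has Bochner integral zero by convention, so integral one forces
  -- integrability.
  · by_contra hni
    have := hK.integral_eq_one
    rw [integral_undef hni] at this
    exact zero_ne_one this

/-- The rectangular kernel. -/
def boxKernel : ℝ → ℝ := (Icc (-(1 / 2) : ℝ) (1 / 2)).indicator fun _ => 1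

lemma boxKernel_bv : ∃ V B, IsBVKernel boxKernel V B := by
  -- `V` jumps once on entering the box and once just after leaving it; the second inequality is
  -- strict because the box is closed.
  refine ⟨fun x => (if -(1 / 2) ≤ x then 1 else 0) + (if 1 / 2 < x then 1 else 0), 2,
    ?_, ?_, ?_, ?_, ?_, ?_, ?_, ?_⟩
  · intro x; simp only [boxKernel, indicator]; split_ifs <;> simp
  · intro x hx; exact indicator_of_notMem hx _
  · intro x y hxy; simp only; split_ifs <;> linarith
  · intro x; split_ifs <;> norm_num
  · intro x; split_ifs <;> norm_num
  · intro x y hxy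
    simp only [boxKernel, indicator, mem_Icc]
    split_ifs <;> simp <;> grind
  · exact (integrable_indicator_iff measurableSet_Icc).2 (by simp)
  · rw [boxKernel, integral_indicator measurableSet_Icc]; simp; norm_num

lemma card_abs_sub_le {h m x : ℝ} (hh : 0 < h) (hm : 0 ≤ m) (S : Finset ℕ) :
    ((S.filter fun j : ℕ => |(j : ℝ) * h - x| ≤ m / 2).card : ℝ) ≤ m / h + 1 := by
  set a := (x - m / 2) / h
  set b := (x + m / 2) / h
  have hsub : (S.filter fun j : ℕ => |(j : ℝ) * h - x| ≤ m / 2).card ≤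
      (Finset.Icc ⌈a⌉ ⌊b⌋).card := by
    refine Finset.card_le_card_of_injOn (fun j : ℕ => (j : ℤ)) ?_ (fun _ _ _ _ h => by simpa using h)
    intro j hj
    have := (Finset.mem_filter.1 hj).2
    rw [abs_le] at this
    simp only [Finset.coe_Icc, mem_Icc]
    constructor
    · rw [Int.ceil_le, div_le_iff₀ hh]; push_cast; linarith
    · rw [Int.le_floor, le_div_iff₀ hh]; push_cast; linarith
  have hba : b - a = m / h := by simp only [a, b]; field_simp; ring
  rw [Int.card_Icc] at hsub
  have h1 : (((⌊b⌋ + 1 - ⌈a⌉).toNat : ℕ) : ℝ) ≤ m / h + 1 := by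
    rcases le_total 0 (⌊b⌋ + 1 - ⌈a⌉) with h0 | h0
    · have : (((⌊b⌋ + 1 - ⌈a⌉).toNat : ℤ) : ℝ) = ((⌊b⌋ + 1 - ⌈a⌉ : ℤ) : ℝ) := by
        rw [Int.toNat_of_nonneg h0]
      rw [Int.cast_natCast] at this
      rw [this]; push_cast
      linarith [Int.floor_le b, Int.le_ceil a]
    · rw [Int.toNat_of_nonpos h0]; push_cast; positivity
  exact le_trans (by exact_mod_cast hsub) h1

namespace IsBVKernel

variable {K V : ℝ → ℝ} {B : ℝ}

lemma bound_nonneg (hK : IsBVKernel K V B) : 0 ≤ B := (abs_nonneg _).trans (hK.abs_le 0)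

lemma abs_sub_le_of_ne (hK : IsBVKernel K V B) {m y : ℝ} (hm : 0 < m) (h : K (y / m) ≠ 0) :
    |y| ≤ m / 2 := by
  by_contra hy
  refine h (hK.support _ fun hmem => hy ?_)
  rw [mem_Icc, le_div_iff₀ hm, div_le_iff₀ hm] at hmem
  rw [_root_.abs_le]; constructor <;> linarith [hmem.1, hmem.2]

lemma sum_abs_le (hK : IsBVKernel K V B) {h m x : ℝ} (hh : 0 < h) (hm : 0 < m) (S : Finset ℕ) :
    ∑ j ∈ S, |K (((j : ℝ) * h - x) / m)| ≤ B * (m / h + 1) := by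
  have h1 : ∑ j ∈ S, |K (((j : ℝ) * h - x) / m)| ≤
      ∑ j ∈ S.filter (fun j : ℕ => |(j : ℝ) * h - x| ≤ m / 2), B := by
    rw [Finset.sum_filter]
    refine Finset.sum_le_sum fun j _ => ?_
    split_ifs with hj
    · exact hK.abs_le _
    · have : K (((j : ℝ) * h - x) / m) = 0 := by
        by_contra hne; exact hj (hK.abs_sub_le_of_ne hm hne)
      simp [this]
  refine h1.trans ?_
  rw [Finset.sum_const, nsmul_eq_mul, mul_comm]
  exact mul_le_mul_of_nonneg_left (card_abs_sub_le hh hm.le S) hK.bound_nonneg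

lemma sum_abs_le' (hK : IsBVKernel K V B) {m x : ℝ} (hm : 0 < m) (S : Finset ℕ) :
    ∑ j ∈ S, |K (((j : ℝ) - x) / m)| ≤ B * (m + 1) := by
  simpa using hK.sum_abs_le one_pos hm S (x := x)

/-- Riemann sums of the kernel. -/
lemma abs_sum_sub_le (hK : IsBVKernel K V B) {m x : ℝ} (hm : 0 < m) {n : ℕ} (p : ℕ)
    (h1 : m / 2 ≤ x) (h2 : x ≤ n - m / 2) :
    |∑ t ∈ Finset.Icc (p + 1) n, K (((t : ℝ) - x) / m) - m| ≤ B * (p + 1) := by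
  set a : ℕ → ℝ := fun i => ((i : ℝ) - x) / m with ha
  have hmono : Monotone a := fun i j hij => by
    simp only [ha]
    gcongr
  have hint : ∀ i, IntervalIntegrable K volume (a i) (a (i + 1)) := fun i =>
    hK.integrable.intervalIntegrable
  -- By `h1` and `h2` the points `a 0` and `a n` enclose the support of `K`, so no mass is lost.
  -- This is why locations must stay `b/2` away from 0 and 1.
  have hsum : ∑ i ∈ Finset.range n, ∫ y in (a i)..(a (i + 1)), K y = 1 := by
    rw [intervalIntegral.sum_integral_adjacent_intervals fun i _ => hint i,
      intervalIntegral.integral_of_le (hmono (Nat.zero_le n)), ← integral_Icc_eq_integral_Ioc,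
      setIntegral_eq_integral_of_forall_compl_eq_zero, hK.integral_eq_one]
    intro y hy
    refine hK.support y fun hy' => hy ⟨?_, ?_⟩
    · refine le_trans ?_ hy'.1
      simp only [ha]
      rw [div_le_iff₀ hm]; push_cast; linarith
    · refine hy'.2.trans ?_
      simp only [ha]
      rw [le_div_iff₀ hm]; linarith
  -- Within a cell `K` differs from its value at the right end by at most the increment of `V`, and
  -- these increments telescope.
  have hdiff : ∀ i, |m * (∫ y in (a i)..(a (i + 1)), K y) - K (a (i + 1))| ≤
      V (a (i + 1)) - V (a i) := by
    intro i
    have hlen : a (i + 1) - a i = 1 / m := by simp only [ha]; push_cast; field_simp; ring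
    have e : ∫ y in (a i)..(a (i + 1)), (K y - K (a (i + 1))) =
        (∫ y in (a i)..(a (i + 1)), K y) - K (a (i + 1)) / m := by
      rw [intervalIntegral.integral_sub (hint i) intervalIntegrable_const,
        intervalIntegral.integral_const, hlen, smul_eq_mul]
      ring
    have hle := intervalIntegral.norm_integral_le_of_norm_le_const
      (a := a i) (b := a (i + 1)) (f := fun y => K y - K (a (i + 1)))
      (C := V (a (i + 1)) - V (a i)) (by
        intro y hy
        rw [uIoc_of_le (hmono (Nat.le_succ i))] at hy
        rw [Real.norm_eq_abs, abs_sub_comm]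
        refine (hK.var y _ hy.2).trans ?_
        linarith [hK.mono hy.1.le])
    rw [e, hlen, abs_of_pos (by positivity), Real.norm_eq_abs] at hle
    have : m * (∫ y in (a i)..(a (i + 1)), K y) - K (a (i + 1)) =
        m * ((∫ y in (a i)..(a (i + 1)), K y) - K (a (i + 1)) / m) := by field_simp
    rw [this, abs_mul, abs_of_pos hm]
    calc m * _ ≤ m * ((V (a (i + 1)) - V (a i)) * (1 / m)) := by gcongr
      _ = _ := by field_simp
  have hfull : |∑ t ∈ Finset.range n, K (a (t + 1)) - m| ≤ B := by
    have e : ∑ t ∈ Finset.range n, K (a (t + 1)) - m =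
        - ∑ t ∈ Finset.range n, (m * (∫ y in (a t)..(a (t + 1)), K y) - K (a (t + 1))) := by
      rw [Finset.sum_sub_distrib, ← Finset.mul_sum, hsum]; ring
    rw [e, abs_neg]
    refine (Finset.abs_sum_le_sum_abs _ _).trans ((Finset.sum_le_sum fun i _ => hdiff i).trans ?_)
    rw [Finset.sum_range_sub (fun i => V (a i))]
    linarith [hK.nonneg (a 0), hK.le (a n)]
  have hsplit : |∑ t ∈ Finset.range n, K (a (t + 1)) - ∑ t ∈ Finset.Icc (p + 1) n, K (a t)|
      ≤ B * p := by
    have e1 : ∑ t ∈ Finset.range n, K (a (t + 1)) = ∑ t ∈ Finset.Icc 1 n, K (a t) := by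
      rw [Finset.range_eq_Ico, Finset.sum_Ico_add' (fun t => K (a t)) 0 n 1]
      rfl
    have hsub : Finset.Icc (p + 1) n ⊆ Finset.Icc 1 n := Finset.Icc_subset_Icc (by omega) le_rfl
    rw [e1, ← Finset.sum_sdiff hsub, add_sub_cancel_right]
    refine (Finset.abs_sum_le_sum_abs _ _).trans ((Finset.sum_le_sum fun i _ => hK.abs_le _).trans ?_)
    rw [Finset.sum_const, nsmul_eq_mul, mul_comm]
    refine mul_le_mul_of_nonneg_left ?_ hK.bound_nonneg
    have : (Finset.Icc 1 n \ Finset.Icc (p + 1) n).card ≤ (Finset.Icc 1 p).card := by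
      refine Finset.card_le_card fun t ht => ?_
      simp only [Finset.mem_sdiff, Finset.mem_Icc] at ht ⊢
      omega
    rw [Nat.card_Icc] at this
    exact_mod_cast this
  have := abs_sub_le (∑ t ∈ Finset.Icc (p + 1) n, K (a t)) (∑ t ∈ Finset.range n, K (a (t + 1))) m
  rw [abs_sub_comm (∑ t ∈ Finset.Icc (p + 1) n, K (a t)) (∑ t ∈ Finset.range n, _)] at this
  simp only [ha] at this hfull hsplit ⊢
  linarith

/-- Kernel sums are controlled by plain sums over cells of length `h`. -/
lemma abs_sum_mul_le (hK : IsBVKernel K V B) {m : ℝ} (x : ℝ) (hm : 0 < m) {h : ℕ} (hh : 0 < h)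
    (S : Finset ℕ) {J : ℕ} (hJ : ∀ t ∈ S, t / h < J) (η : ℕ → ℝ) {δ D : ℝ} (hδ : 0 ≤ δ)
    (hD : 0 ≤ D)
    (h1 : ∀ j < J, |∑ t ∈ S with t / h = j, η t| ≤ δ * h)
    (h2 : ∀ j < J, ∑ t ∈ S with t / h = j, |η t| ≤ D * h) :
    |∑ t ∈ S, K (((t : ℝ) - x) / m) * η t| ≤ B * δ * (m + h) + B * D * h := by
  have hhr : (0 : ℝ) < h := by exact_mod_cast hh
  set a : ℕ → ℝ := fun j => ((j : ℝ) * h - x) / m with ha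
  have hmono : Monotone a := fun i j hij => by
    simp only [ha]
    gcongr
  have e : ∑ t ∈ S, K (((t : ℝ) - x) / m) * η t =
      ∑ j ∈ Finset.range J, ∑ t ∈ S with t / h = j, K (((t : ℝ) - x) / m) * η t :=
    (Finset.sum_fiberwise_of_maps_to (fun t ht => Finset.mem_range.2 (hJ t ht)) _).symm
  -- Freeze the kernel at the left end of each cell. The frozen part uses the cancellation `h1`, and
  -- at most `m/h + 1` of the frozen weights are nonzero. The rest uses the absolute sizes `h2`,
  -- weighted by increments of `V`, which telescope. The bound does not involve `x`, hence its
  -- uniformity in the location.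
  have e2 : ∀ j, ∑ t ∈ S with t / h = j, K (((t : ℝ) - x) / m) * η t =
      K (a j) * (∑ t ∈ S with t / h = j, η t) +
        ∑ t ∈ S with t / h = j, (K (((t : ℝ) - x) / m) - K (a j)) * η t := by
    intro j
    rw [Finset.mul_sum, ← Finset.sum_add_distrib]
    exact Finset.sum_congr rfl fun t _ => by ring
  rw [e]
  simp_rw [e2]
  rw [Finset.sum_add_distrib]
  refine (abs_add_le _ _).trans (add_le_add ?_ ?_)
  · refine (Finset.abs_sum_le_sum_abs _ _).trans ?_
    calc ∑ j ∈ Finset.range J, |K (a j) * ∑ t ∈ S with t / h = j, η t|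
        ≤ ∑ j ∈ Finset.range J, |K (a j)| * (δ * h) := by
          refine Finset.sum_le_sum fun j hj => ?_
          rw [abs_mul]
          exact mul_le_mul_of_nonneg_left (h1 j (Finset.mem_range.1 hj)) (abs_nonneg _)
      _ = (∑ j ∈ Finset.range J, |K (a j)|) * (δ * h) := by rw [Finset.sum_mul]
      _ ≤ (B * (m / h + 1)) * (δ * h) :=
          mul_le_mul_of_nonneg_right (hK.sum_abs_le hhr hm _) (by positivity)
      _ = B * δ * (m + h) := by field_simp
  · refine (Finset.abs_sum_le_sum_abs _ _).trans ?_
    calc ∑ j ∈ Finset.range J, |∑ t ∈ S with t / h = j, (K (((t : ℝ) - x) / m) - K (a j)) * η t|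
        ≤ ∑ j ∈ Finset.range J, (V (a (j + 1)) - V (a j)) * (D * h) := by
          refine Finset.sum_le_sum fun j hj => ?_
          have hV : 0 ≤ V (a (j + 1)) - V (a j) := sub_nonneg.2 (hK.mono (hmono (Nat.le_succ j)))
          refine (Finset.abs_sum_le_sum_abs _ _).trans ?_
          refine le_trans ?_ (mul_le_mul_of_nonneg_left (h2 j (Finset.mem_range.1 hj)) hV)
          rw [Finset.mul_sum]
          refine Finset.sum_le_sum fun t ht => ?_
          have htj := (Finset.mem_filter.1 ht).2
          have hle : j * h ≤ t := by rw [← htj]; exact Nat.div_mul_le_self t h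
          have hlt : t ≤ (j + 1) * h := by
            rw [← htj, add_mul, one_mul]
            have := Nat.lt_div_mul_add (a := t) hh
            omega
          have hle' : (j : ℝ) * h ≤ t := by exact_mod_cast hle
          have hlt' : (t : ℝ) ≤ ((j + 1 : ℕ) : ℝ) * h := by exact_mod_cast hlt
          rw [abs_mul]
          refine mul_le_mul_of_nonneg_right ?_ (abs_nonneg _)
          refine (hK.var (a j) _ (by simp only [ha]; gcongr)).trans ?_
          have : V (((t : ℝ) - x) / m) ≤ V (a (j + 1)) := hK.mono (by simp only [ha]; gcongr)
          linarith
      _ = (V (a J) - V (a 0)) * (D * h) := by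
          rw [← Finset.sum_mul, Finset.sum_range_sub (fun i => V (a i))]
      _ ≤ B * (D * h) := by
          refine mul_le_mul_of_nonneg_right ?_ (by positivity)
          linarith [hK.nonneg (a 0), hK.le (a J)]
      _ = B * D * h := by ring

end IsBVKernel

end LocStat

end

/-! ### Exponential and Fuk–Nagaev inequalities -/

noncomputable section


namespace LocStat

variable {Ω : Type*} [mΩ : MeasurableSpace Ω] {μ : Measure Ω}

/-- For `|u| ≤ 1` the quadratic Taylor error is at most `|u|^s`, and for `|u| ≥ 1` already `|u| ≤
|u|^s`. It makes the exponential method available for moments of order below two. -/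
lemma exp_le_one_add_add {s : ℝ} (hs1 : 1 ≤ s) (hs2 : s ≤ 2) (u : ℝ) :
    Real.exp u ≤ 1 + u + |u| ^ s * Real.exp |u| := by
  have hexp : 1 ≤ Real.exp |u| := Real.one_le_exp (abs_nonneg u)
  have hp : 0 ≤ |u| ^ s := Real.rpow_nonneg (abs_nonneg u) s
  rcases le_total |u| 1 with h | h
  · have h1 := (le_abs_self _).trans (Real.abs_exp_sub_one_sub_id_le h)
    have h2 : u ^ 2 ≤ |u| ^ s := by
      have := Real.rpow_le_rpow_of_exponent_ge' (abs_nonneg u) h (by linarith) hs2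
      rwa [Real.rpow_two, sq_abs] at this
    nlinarith
  · have h1 : |u| ≤ |u| ^ s := by simpa using Real.rpow_le_rpow_of_exponent_le h hs1
    rcases le_total 0 u with h0 | h0
    · rw [abs_of_nonneg h0] at *
      nlinarith [Real.exp_pos u]
    · have h2 : Real.exp u ≤ 1 := Real.exp_le_one_iff.2 h0
      rw [abs_of_nonpos h0] at *
      nlinarith

lemma integral_rpow_le_of_nq {s a : ℝ} (hs : 0 < s) (ha : 0 ≤ a) {f : Ω → ℝ}
    (hf : AEStronglyMeasurable f μ) (h : nq μ s f ≤ ENNReal.ofReal a) :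
    Integrable (fun ω => |f ω| ^ s) μ ∧ ∫ ω, |f ω| ^ s ∂μ ≤ a ^ s := by
  rw [nq_le_iff hs, ENNReal.ofReal_rpow_of_nonneg ha hs.le] at h
  have he : ∀ ω, ‖f ω‖ₑ ^ s = ENNReal.ofReal (|f ω| ^ s) := fun ω => by
    rw [Real.enorm_eq_ofReal_abs, ENNReal.ofReal_rpow_of_nonneg (abs_nonneg _) hs.le]
  simp_rw [he] at h
  have hm : AEStronglyMeasurable (fun ω => |f ω| ^ s) μ :=
    ((continuous_abs.measurable.comp_aemeasurable hf.aemeasurable).pow_const s).aestronglyMeasurable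
  have hnn : 0 ≤ᵐ[μ] fun ω => |f ω| ^ s :=
    Eventually.of_forall fun ω => Real.rpow_nonneg (abs_nonneg _) _
  refine ⟨⟨hm, ?_⟩, ?_⟩
  · rw [hasFiniteIntegral_iff_ofReal hnn]
    exact h.trans_lt ENNReal.ofReal_lt_top
  · rw [integral_eq_lintegral_of_nonneg_ae hnn hm]
    exact ENNReal.toReal_le_of_le_ofReal (by positivity) h

lemma measureReal_lt_abs_le [IsProbabilityMeasure μ] {Q a y : ℝ} (hQ : 0 < Q) (ha : 0 ≤ a)
    (hy : 0 < y) {f : Ω → ℝ}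
    (hf : AEStronglyMeasurable f μ) (h : nq μ Q f ≤ ENNReal.ofReal a) :
    μ.real {ω | y < |f ω|} ≤ (a / y) ^ Q := by
  obtain ⟨hi, hle⟩ := integral_rpow_le_of_nq hQ ha hf h
  have h1 := mul_meas_ge_le_integral_of_nonneg
    (Eventually.of_forall fun ω => Real.rpow_nonneg (abs_nonneg (f ω)) Q) hi (y ^ Q)
  have h2 : μ.real {ω | y < |f ω|} ≤ μ.real {ω | y ^ Q ≤ |f ω| ^ Q} :=
    measureReal_mono fun ω (hω : y < |f ω|) => Real.rpow_le_rpow hy.le hω.le hQ.le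
  rw [Real.div_rpow ha hy.le, le_div_iff₀ (Real.rpow_pos_of_pos hy Q)]
  calc _ ≤ μ.real {ω | y ^ Q ≤ |f ω| ^ Q} * y ^ Q := by gcongr
    _ ≤ a ^ Q := by rw [mul_comm]; exact h1.trans hle

/-- Chernoff bound for sums of bounded independent variables with moments of order `s ∈ [1, 2]`. -/
lemma chernoff_bound [IsProbabilityMeasure μ] {ι : Type*} {ξ : ι → Ω → ℝ} (hind : iIndepFun ξ μ)
    (hmeas : ∀ i, Measurable (ξ i)) (S : Finset ι) {s a y N : ℝ} (hs1 : 1 ≤ s) (hs2 : s ≤ 2)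
    (ha : 0 < a) (hy : 0 < y) (hbd : ∀ i ω, |ξ i ω| ≤ y)
    (hmom : ∀ i ∈ S, ∫ ω, |ξ i ω| ^ s ∂μ ≤ a ^ s) (hN0 : 0 < N) (hN : (S.card : ℝ) ≤ N) (r : ℕ)
    (hv1 : N * (a / y) ^ s < 1) :
    μ.real {ω | 3 * r * y ≤ ∑ i ∈ S, (ξ i ω - ∫ ω', ξ i ω' ∂μ)} ≤
      Real.exp 1 * (N * (a / y) ^ s) ^ r := by
  set v := N * (a / y) ^ s with hv
  have hv0 : 0 < v := mul_pos hN0 (Real.rpow_pos_of_pos (by positivity) s)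
  -- The rate is chosen so that `exp (-3θ) = v`: the deviation `3 r y` then contributes `v^r`, while
  -- the remainder terms sum to at most `v θ^s exp θ ≤ v exp (3θ) = 1`.
  set θ := -Real.log v / 3 with hθ
  have hlog : Real.log v = -(3 * θ) := by rw [hθ]; ring
  have hθ0 : 0 < θ := by have := Real.log_neg hv0 hv1; rw [hθ]; linarith
  set l := θ / y with hl
  have hl0 : 0 < l := by positivity
  have hint : ∀ i, Integrable (ξ i) μ := fun i =>
    Integrable.of_bound (hmeas i).aestronglyMeasurable y (Eventually.of_forall (hbd i))
  have hints : ∀ i, Integrable (fun ω => |ξ i ω| ^ s) μ := fun i =>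
    Integrable.of_bound (((continuous_abs.measurable.comp (hmeas i)).pow_const s)).aestronglyMeasurable
      (y ^ s) (Eventually.of_forall fun ω => by
        rw [Real.norm_eq_abs, abs_of_nonneg (Real.rpow_nonneg (abs_nonneg _) _)]
        exact Real.rpow_le_rpow (abs_nonneg _) (hbd i ω) (by linarith))
  set c := l ^ s * Real.exp θ * a ^ s with hc
  have hmgf : ∀ i ∈ S, mgf (ξ i) μ l ≤ Real.exp (l * ∫ ω, ξ i ω ∂μ + c) := by
    intro i hi
    have h1 : mgf (ξ i) μ l ≤ ∫ ω, (1 + l * ξ i ω + l ^ s * Real.exp θ * |ξ i ω| ^ s) ∂μ := by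
      refine integral_mono ?_ ?_ fun ω => ?_
      · refine Integrable.of_bound
          (Real.measurable_exp.comp ((hmeas i).const_mul l)).aestronglyMeasurable (Real.exp θ)
          (Eventually.of_forall fun ω => ?_)
        rw [Real.norm_eq_abs, Real.abs_exp, Real.exp_le_exp]
        calc l * ξ i ω ≤ l * y := by gcongr; exact (le_abs_self _).trans (hbd i ω)
          _ = θ := by rw [hl]; field_simp
      · exact ((integrable_const _).add ((hint i).const_mul l)).add ((hints i).const_mul _)
      · refine (exp_le_one_add_add hs1 hs2 (l * ξ i ω)).trans ?_
        rw [abs_mul, abs_of_pos hl0, Real.mul_rpow hl0.le (abs_nonneg _)]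
        have : l * |ξ i ω| ≤ θ := by
          calc l * |ξ i ω| ≤ l * y := by gcongr; exact hbd i ω
            _ = θ := by rw [hl]; field_simp
        have h2 : Real.exp (l * |ξ i ω|) ≤ Real.exp θ := Real.exp_le_exp.2 this
        have h3 : 0 ≤ l ^ s * |ξ i ω| ^ s := by positivity
        nlinarith
    have hi1 : Integrable (fun ω => 1 + l * ξ i ω) μ :=
      (integrable_const _).add ((hint i).const_mul l)
    rw [integral_add hi1 ((hints i).const_mul _),
      integral_add (integrable_const _) ((hint i).const_mul l), integral_const_mul,
      integral_const_mul, integral_const] at h1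
    simp only [probReal_univ, smul_eq_mul, mul_one] at h1
    refine h1.trans (le_trans ?_ (Real.add_one_le_exp _))
    have := mul_le_mul_of_nonneg_left (hmom i hi) (by positivity : 0 ≤ l ^ s * Real.exp θ)
    rw [hc]; linarith
  have hNc : S.card * c ≤ 1 := by
    have h1 : N * c = v * (θ ^ s * Real.exp θ) := by
      rw [hc, hv, hl, Real.div_rpow hθ0.le hy.le, Real.div_rpow ha.le hy.le]; ring
    have h2 : θ ^ s ≤ Real.exp (2 * θ) := by
      calc θ ^ s ≤ (Real.exp θ) ^ s :=
            Real.rpow_le_rpow hθ0.le (by linarith [Real.add_one_le_exp θ]) (by linarith)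
        _ = Real.exp (θ * s) := by rw [Real.exp_mul]
        _ ≤ Real.exp (2 * θ) := by rw [Real.exp_le_exp]; nlinarith
    calc S.card * c ≤ N * c := by gcongr
      _ ≤ v * (Real.exp (2 * θ) * Real.exp θ) := by rw [h1]; gcongr
      _ = 1 := by
        rw [← Real.exp_add, show 2 * θ + θ = 3 * θ by ring]
        conv_lhs => rw [← Real.exp_log hv0, hlog]
        rw [← Real.exp_add]; simp
  have hset : {ω | 3 * r * y ≤ ∑ i ∈ S, (ξ i ω - ∫ ω', ξ i ω' ∂μ)} =
      {ω | 3 * r * y + ∑ i ∈ S, ∫ ω', ξ i ω' ∂μ ≤ (∑ i ∈ S, ξ i) ω} := by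
    ext ω
    simp only [mem_ofPred_eq, Finset.sum_sub_distrib, Finset.sum_apply]
    constructor <;> intro h <;> linarith
  rw [hset]
  have hch := measure_ge_le_exp_mul_mgf (μ := μ) (X := ∑ i ∈ S, ξ i)
    (3 * r * y + ∑ i ∈ S, ∫ ω', ξ i ω' ∂μ) hl0.le (by
      refine Integrable.of_bound (C := Real.exp (l * (S.card * y))) ?_ (Eventually.of_forall fun ω => ?_)
      · simp only [Finset.sum_apply]
        exact (Real.measurable_exp.comp
          ((Finset.measurable_sum S fun i _ => hmeas i).const_mul l)).aestronglyMeasurable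
      · rw [Real.norm_eq_abs, Real.abs_exp, Real.exp_le_exp]
        gcongr
        rw [Finset.sum_apply, ← nsmul_eq_mul]
        exact Finset.sum_le_card_nsmul _ _ _ fun i _ => (le_abs_self _).trans (hbd i ω))
  refine hch.trans ?_
  rw [hind.mgf_sum hmeas S]
  calc Real.exp (-l * (3 * r * y + ∑ i ∈ S, ∫ ω', ξ i ω' ∂μ)) * ∏ i ∈ S, mgf (ξ i) μ l
      ≤ Real.exp (-l * (3 * r * y + ∑ i ∈ S, ∫ ω', ξ i ω' ∂μ)) *
        ∏ i ∈ S, Real.exp (l * ∫ ω, ξ i ω ∂μ + c) := by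
        gcongr with i hi
        · exact fun i _ => mgf_nonneg
        · exact hmgf i hi
    _ = Real.exp (-(3 * r * θ) + S.card * c) := by
        rw [← Real.exp_sum, ← Real.exp_add, Finset.sum_add_distrib, ← Finset.mul_sum,
          Finset.sum_const, nsmul_eq_mul]
        congr 1
        have : l * y = θ := by rw [hl]; field_simp
        linear_combination (-3 * r) * this
    _ ≤ Real.exp (-(3 * r * θ) + 1) := by rw [Real.exp_le_exp]; linarith
    _ = Real.exp 1 * v ^ r := by
        rw [add_comm, Real.exp_add]
        congr 1
        conv_rhs => rw [← Real.exp_log hv0, hlog, ← Real.exp_nat_mul]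
        congr 1; ring

/-- A Fuk–Nagaev type inequality. -/
lemma nagaev_bound [IsProbabilityMeasure μ] {ι : Type*} {ζ : ι → Ω → ℝ} (hind : iIndepFun ζ μ)
    (hmeas : ∀ i, Measurable (ζ i)) (S : Finset ι) {Q a x N : ℝ} (hQ : 1 < Q) (ha : 0 < a)
    (hx : 0 < x) (hmom : ∀ i ∈ S, nq μ Q (ζ i) ≤ ENNReal.ofReal a) (hN0 : 0 < N)
    (hN : (S.card : ℝ) ≤ N) {r : ℕ} (hr : 0 < r) :
    μ.real {ω | x ≤ |∑ i ∈ S, (ζ i ω - ∫ ω', ζ i ω' ∂μ)|} ≤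
      N * (6 * r * a / x) ^ Q + 2 * Real.exp 1 * (N * (6 * r * a / x) ^ min Q 2) ^ r := by
  set s := min Q 2 with hs
  have hs1 : 1 < s := lt_min hQ one_lt_two
  have hs2 : s ≤ 2 := min_le_right _ _
  have hr' : (1 : ℝ) ≤ r := by exact_mod_cast hr
  -- Truncation level: of `x = 6 r y` at most `y` is lost to the truncation bias, and what remains
  -- is at least the `3 r y` of `chernoff_bound`.
  set y := x / (6 * r) with hy
  have hy0 : 0 < y := by positivity
  have hay : 6 * r * a / x = a / y := by rw [hy]; field_simp
  rw [hay]
  -- If the base of the `r`-th power is at least one, the claimed bound exceeds one.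
  rcases le_or_gt 1 (N * (a / y) ^ s) with hv | hv
  · have h1 : (1 : ℝ) ≤ (N * (a / y) ^ s) ^ r := one_le_pow₀ hv
    have h2 : 0 ≤ N * (a / y) ^ Q := by positivity
    have h3 : (1 : ℝ) ≤ Real.exp 1 := Real.one_le_exp zero_le_one
    have h4 : μ.real {ω | x ≤ |∑ i ∈ S, (ζ i ω - ∫ ω', ζ i ω' ∂μ)|} ≤ 1 := measureReal_le_one
    nlinarith
  set τ : ℝ → ℝ := fun z => if |z| ≤ y then z else 0 with hτ
  have hτm : Measurable τ := Measurable.ite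
    (measurableSet_le continuous_abs.measurable measurable_const) measurable_id measurable_const
  have hτy : ∀ z, |τ z| ≤ y := fun z => by
    simp only [hτ]; split_ifs with h
    · exact h
    · simpa using hy0.le
  have hτle : ∀ z, |τ z| ≤ |z| := fun z => by
    simp only [hτ]; split_ifs with h
    · exact le_rfl
    · simp
  have hmom_s : ∀ i ∈ S, Integrable (fun ω => |ζ i ω| ^ s) μ ∧ ∫ ω, |ζ i ω| ^ s ∂μ ≤ a ^ s :=
    fun i hi => integral_rpow_le_of_nq (by linarith) ha.le (hmeas i).aestronglyMeasurable
      ((eLpNorm_le_eLpNorm_of_exponent_le (ENNReal.ofReal_le_ofReal (min_le_left _ _))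
        (hmeas i).aestronglyMeasurable).trans (hmom i hi))
  have hint : ∀ i ∈ S, Integrable (ζ i) μ := fun i hi =>
    (integrable_of_nq hQ.le (hmeas i).aestronglyMeasurable ha.le (hmom i hi)).1
  have hintτ : ∀ i, Integrable (fun ω => τ (ζ i ω)) μ := fun i =>
    Integrable.of_bound (hτm.comp (hmeas i)).aestronglyMeasurable y
      (Eventually.of_forall fun ω => hτy _)
  have hmomτ : ∀ i ∈ S, ∫ ω, |τ (ζ i ω)| ^ s ∂μ ≤ a ^ s := fun i hi => by
    refine (integral_mono_of_nonneg (Eventually.of_forall fun ω => ?_) (hmom_s i hi).1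
      (Eventually.of_forall fun ω => ?_)).trans (hmom_s i hi).2
    · exact Real.rpow_nonneg (abs_nonneg _) _
    · exact Real.rpow_le_rpow (abs_nonneg _) (hτle _) (by linarith)
  -- Above the level `y` one has `|z| ≤ y^(1-s) |z|^s`, so the `s`-th moment controls what is cut
  -- off.
  have hmean : ∀ i ∈ S, |∫ ω, τ (ζ i ω) ∂μ - ∫ ω, ζ i ω ∂μ| ≤ y * (a / y) ^ s := fun i hi => by
    rw [← integral_sub (hintτ i) (hint i hi)]
    refine abs_integral_le_integral_abs.trans ?_
    have hpt : ∀ ω, |τ (ζ i ω) - ζ i ω| ≤ y ^ (1 - s) * |ζ i ω| ^ s := by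
      intro ω
      simp only [hτ]; split_ifs with h
      · simp; positivity
      · rw [zero_sub, abs_neg]
        have hz : 0 < |ζ i ω| := hy0.trans (not_le.1 h)
        have h1 : |ζ i ω| = |ζ i ω| ^ (1 - s) * |ζ i ω| ^ s := by
          rw [← Real.rpow_add hz]; simp
        conv_lhs => rw [h1]
        gcongr ?_ * _
        exact Real.rpow_le_rpow_of_nonpos hy0 (not_le.1 h).le (by linarith)
    refine (integral_mono ((hintτ i).sub (hint i hi)).abs ((hmom_s i hi).1.const_mul _) hpt).trans ?_
    rw [integral_const_mul]
    calc y ^ (1 - s) * ∫ ω, |ζ i ω| ^ s ∂μ ≤ y ^ (1 - s) * a ^ s := by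
          gcongr; exact (hmom_s i hi).2
      _ = y * (a / y) ^ s := by
          rw [Real.rpow_sub hy0, Real.rpow_one, Real.div_rpow ha.le hy0.le]; ring
  have hmeanS : |∑ i ∈ S, (∫ ω, τ (ζ i ω) ∂μ - ∫ ω, ζ i ω ∂μ)| ≤ y := by
    refine (Finset.abs_sum_le_sum_abs _ _).trans ((Finset.sum_le_sum hmean).trans ?_)
    rw [Finset.sum_const, nsmul_eq_mul]
    have h0 : 0 ≤ (a / y) ^ s := by positivity
    calc (S.card : ℝ) * (y * (a / y) ^ s) ≤ N * (y * (a / y) ^ s) := by gcongr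
      _ = y * (N * (a / y) ^ s) := by ring
      _ ≤ y * 1 := by gcongr
      _ = y := mul_one y
  have c1 := chernoff_bound (hind.comp (fun _ => τ) (fun _ => hτm)) (fun i => hτm.comp (hmeas i)) S
    hs1.le hs2 ha hy0 (fun i ω => hτy _) hmomτ hN0 hN r hv
  have c2 := chernoff_bound (hind.comp (fun _ z => - τ z) (fun _ => hτm.neg))
    (fun i => hτm.neg.comp (hmeas i)) S
    hs1.le hs2 ha hy0 (fun i ω => by simpa using hτy _) (fun i hi => by simpa using hmomτ i hi)
    hN0 hN r hv
  simp only [Function.comp_apply] at c1 c2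
  have htail : μ.real (⋃ i ∈ S, {ω | y < |ζ i ω|}) ≤ N * (a / y) ^ Q := by
    refine (measureReal_biUnion_finset_le _ _).trans ((Finset.sum_le_sum fun i hi =>
      measureReal_lt_abs_le (by linarith) ha.le hy0 (hmeas i).aestronglyMeasurable
        (hmom i hi)).trans ?_)
    rw [Finset.sum_const, nsmul_eq_mul]
    gcongr
  have hx6 : x = 6 * r * y := by rw [hy]; field_simp
  have hsub : {ω | x ≤ |∑ i ∈ S, (ζ i ω - ∫ ω', ζ i ω' ∂μ)|} ⊆
      (⋃ i ∈ S, {ω | y < |ζ i ω|}) ∪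
      ({ω | 3 * r * y ≤ ∑ i ∈ S, (τ (ζ i ω) - ∫ ω', τ (ζ i ω') ∂μ)} ∪
      {ω | 3 * r * y ≤ ∑ i ∈ S, (- τ (ζ i ω) - ∫ ω', - τ (ζ i ω') ∂μ)}) := by
    intro ω hω
    by_cases hbig : ω ∈ ⋃ i ∈ S, {ω | y < |ζ i ω|}
    · exact Or.inl hbig
    right
    simp only [mem_iUnion, mem_ofPred_eq, not_exists, not_lt] at hbig
    simp only [mem_ofPred_eq] at hω
    have e1 : ∑ i ∈ S, (ζ i ω - ∫ ω', ζ i ω' ∂μ) = ∑ i ∈ S, (τ (ζ i ω) - ∫ ω', τ (ζ i ω') ∂μ) +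
        ∑ i ∈ S, (∫ ω, τ (ζ i ω) ∂μ - ∫ ω, ζ i ω ∂μ) := by
      rw [← Finset.sum_add_distrib]
      refine Finset.sum_congr rfl fun i hi => ?_
      have : τ (ζ i ω) = ζ i ω := by simp only [hτ]; rw [if_pos (hbig i hi)]
      rw [this]; ring
    have e2 : ∑ i ∈ S, (- τ (ζ i ω) - ∫ ω', - τ (ζ i ω') ∂μ) =
        - ∑ i ∈ S, (τ (ζ i ω) - ∫ ω', τ (ζ i ω') ∂μ) := by
      rw [← Finset.sum_neg_distrib]
      refine Finset.sum_congr rfl fun i hi => ?_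
      rw [integral_neg]; ring
    simp only [mem_union, mem_ofPred_eq]
    rw [e2]
    rw [e1] at hω
    have h1 := abs_add_le (∑ i ∈ S, (τ (ζ i ω) - ∫ ω', τ (ζ i ω') ∂μ))
      (∑ i ∈ S, (∫ ω, τ (ζ i ω) ∂μ - ∫ ω, ζ i ω ∂μ))
    have h2 : 3 * r * y ≤ |∑ i ∈ S, (τ (ζ i ω) - ∫ ω', τ (ζ i ω') ∂μ)| := by nlinarith
    exact le_abs.1 h2
  refine (measureReal_mono hsub).trans ((measureReal_union_le _ _).trans ?_)
  have := measureReal_union_le (μ := μ)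
    {ω | 3 * r * y ≤ ∑ i ∈ S, (τ (ζ i ω) - ∫ ω', τ (ζ i ω') ∂μ)}
    {ω | 3 * r * y ≤ ∑ i ∈ S, (- τ (ζ i ω) - ∫ ω', - τ (ζ i ω') ∂μ)}
  linarith

end LocStat

end

/-! ### Deviation inequalities for weakly dependent sums -/

noncomputable section


namespace LocStat

variable {Ω : Type*} [mΩ : MeasurableSpace Ω] {μ : Measure Ω} [IsProbabilityMeasure μ]
  {ε : ℤ → Ω → ℝ}

/-- A Fuk–Nagaev type inequality for sums of `D`-dependent variables. -/
lemma nagaev_bound_dependent (hε : IsIIDInnovations μ ε) {D : ℕ} (hD : 0 < D) {ζ : ℤ → Ω → ℝ}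
    (hζ : ∀ t, Measurable[sigmaOn ε (Ioc (t - D) t)] (ζ t)) (S : Finset ℤ) {Q a x N : ℝ}
    (hQ : 1 < Q) (ha : 0 < a) (hx : 0 < x) (hmom : ∀ t ∈ S, nq μ Q (ζ t) ≤ ENNReal.ofReal a)
    (hN0 : 0 < N) (hN : (S.card : ℝ) ≤ N) {r : ℕ} (hr : 0 < r) :
    μ.real {ω | x ≤ |∑ t ∈ S, (ζ t ω - ∫ ω', ζ t ω' ∂μ)|} ≤
      D * (N * (6 * r * a * D / x) ^ Q +
        2 * Real.exp 1 * (N * (6 * r * a * D / x) ^ min Q 2) ^ r) := by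
  have hDr : (0 : ℝ) < D := by exact_mod_cast hD
  have hDz : (D : ℤ) ≠ 0 := by exact_mod_cast hD.ne'
  set f : ℤ → Ω → ℝ := fun t ω => ζ t ω - ∫ ω', ζ t ω' ∂μ with hf
  -- Indices of equal residue modulo `D` give independent variables, and a total deviation `x`
  -- forces a deviation `x / D` in one of the `D` classes.
  set cls : ℕ → Finset ℤ := fun ρ => S.filter fun t => t % (D : ℤ) = ρ with hcls
  have hclass : ∀ ρ, μ.real {ω | x / D ≤ |∑ t ∈ cls ρ, f t ω|} ≤
      N * (6 * r * a * D / x) ^ Q + 2 * Real.exp 1 * (N * (6 * r * a * D / x) ^ min Q 2) ^ r := by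
    intro ρ
    have hinj : Set.InjOn (fun t : ℤ => t / (D : ℤ)) (cls ρ) := by
      intro t ht t' ht' heq
      have h1 := (Finset.mem_filter.1 ht).2
      have h2 := (Finset.mem_filter.1 ht').2
      have e1 := Int.emod_add_mul_ediv t D
      have e2 := Int.emod_add_mul_ediv t' D
      simp only at heq
      rw [← e1, ← e2, h1, h2, heq]
    have hback : ∀ t ∈ cls ρ, (ρ : ℤ) + D * (t / (D : ℤ)) = t := fun t ht => by
      have h1 := (Finset.mem_filter.1 ht).2
      rw [← h1]; exact Int.emod_add_mul_ediv t D
    have hsum : ∀ ω, ∑ t ∈ cls ρ, f t ω =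
        ∑ j ∈ (cls ρ).image (fun t : ℤ => t / (D : ℤ)), f (ρ + D * j) ω := by
      intro ω
      rw [Finset.sum_image hinj]
      exact Finset.sum_congr rfl fun t ht => by rw [hback t ht]
    have hb := nagaev_bound (hε.iIndepFun_blocks D ρ hζ)
      (fun j => (hζ _).mono (hε.sigmaOn_le _) le_rfl)
      ((cls ρ).image (fun t : ℤ => t / (D : ℤ))) (a := a) (x := x / D) (N := N) hQ ha
      (by positivity) (by
        intro j hj
        obtain ⟨t, ht, rfl⟩ := Finset.mem_image.1 hj
        rw [hback t ht]
        exact hmom t (Finset.mem_filter.1 ht).1) hN0 (by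
        refine le_trans ?_ hN
        exact_mod_cast Finset.card_image_le.trans (Finset.card_filter_le _ _)) hr
    simp_rw [hsum]
    have e : 6 * r * a * D / x = 6 * r * a / (x / D) := by field_simp
    rw [e]
    exact hb
  have hsplit : ∀ ω, ∑ t ∈ S, f t ω = ∑ ρ ∈ Finset.range D, ∑ t ∈ cls ρ, f t ω := by
    intro ω
    have h1 : ∀ t ∈ S, (t % (D : ℤ)).toNat ∈ Finset.range D := fun t _ => by
      have h2 := Int.emod_nonneg t hDz
      have h3 := Int.emod_lt_of_pos t (by exact_mod_cast hD : (0 : ℤ) < D)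
      rw [Finset.mem_range]; omega
    rw [← Finset.sum_fiberwise_of_maps_to h1]
    refine Finset.sum_congr rfl fun ρ _ => ?_
    refine Finset.sum_congr (Finset.filter_congr fun t _ => ?_) fun _ _ => rfl
    have h2 := Int.emod_nonneg t hDz
    omega
  have hsub : {ω | x ≤ |∑ t ∈ S, f t ω|} ⊆
      ⋃ ρ ∈ Finset.range D, {ω | x / D ≤ |∑ t ∈ cls ρ, f t ω|} := by
    intro ω hω
    by_contra hcon
    simp only [mem_iUnion, mem_ofPred_eq, not_exists, not_le] at hcon
    have h1 : |∑ t ∈ S, f t ω| < x := by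
      rw [hsplit ω]
      refine (Finset.abs_sum_le_sum_abs _ _).trans_lt
        ((Finset.sum_lt_sum_of_nonempty ⟨0, Finset.mem_range.2 hD⟩ hcon).trans_le ?_)
      rw [Finset.sum_const, Finset.card_range, nsmul_eq_mul]
      field_simp
      exact le_rfl
    exact absurd hω (not_le.2 h1)
  refine (measureReal_mono hsub (measure_ne_top _ _)).trans ((measureReal_biUnion_finset_le _ _).trans
    ((Finset.sum_le_sum fun ρ _ => hclass ρ).trans ?_))
  rw [Finset.sum_const, Finset.card_range, nsmul_eq_mul]

/-- The dependence range grows linearly with the level; part of the geometric decay absorbs it. -/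
lemma exists_bound_mul_pow (d : ℕ) {β : ℝ} (h0 : 0 < β) (h1 : β < 1) :
    ∃ C, 0 < C ∧ ∀ k : ℕ, (((k + 2) * d : ℕ) : ℝ) * β ^ k ≤ C := by
  have t1 := tendsto_self_mul_const_pow_of_lt_one h0.le h1
  have t2 := tendsto_pow_atTop_nhds_zero_of_lt_one h0.le h1
  have t3 := (t1.add (t2.const_mul 2)).mul_const (d : ℝ)
  obtain ⟨C, hC⟩ := t3.bddAbove_range
  refine ⟨max C 1, by positivity, fun k => le_trans (le_of_eq ?_)
    ((hC ⟨k, rfl⟩).trans (le_max_left _ _))⟩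
  push_cast; ring

/-- Deviation inequality for sums of variables which are well approximated by functions of finitely
many innovations. -/
lemma exists_deviation_bound (hε : IsIIDInnovations μ ε) {Q a γ δ : ℝ} (hQ : 1 < Q) (ha : 0 < a)
    (hγ0 : 0 < γ) (hγ1 : γ < 1) (d : ℕ) (hd : 0 < d) (hδ : 0 < δ) :
    ∃ C : ℝ, ∀ (ξ : ℤ → Ω → ℝ) (ξk : ℕ → ℤ → Ω → ℝ) (S : Finset ℤ) (h : ℕ), 0 < h → S.card ≤ h →
      (∀ t, ∃ c, ∀ ω, ξk 0 t ω = c) →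
      (∀ k t, Measurable[sigmaOn ε (Ioc (t - ((k + 1) * d : ℕ)) t)] (ξk k t)) →
      (∀ k, ∀ t ∈ S, nq μ Q (fun ω => ξk (k + 1) t ω - ξk k t ω) ≤ ENNReal.ofReal (a * γ ^ k)) →
      (∀ t ∈ S, AEStronglyMeasurable (ξ t) μ) →
      (∀ k, ∀ t ∈ S, nq μ Q (fun ω => ξ t ω - ξk k t ω) ≤ ENNReal.ofReal (a * γ ^ k)) →
      μ.real {ω | δ * h ≤ |∑ t ∈ S, (ξ t ω - ∫ ω', ξ t ω' ∂μ)|} ≤ C * (h : ℝ) ^ (1 - Q) := by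
  set s := min Q 2 with hs
  have hs1 : 1 < s := lt_min hQ one_lt_two
  -- Large enough that the second Fuk–Nagaev term, of order `h^(r(1-s))`, is dominated by the first,
  -- of order `h^(1-Q)`.
  obtain ⟨r, hr⟩ := exists_nat_gt ((Q - 1) / (s - 1))
  have hr0 : 0 < r := by
    have : (0 : ℝ) < r := lt_of_le_of_lt (div_nonneg (by linarith) (by linarith)) hr
    exact_mod_cast this
  have hrr : (1 : ℝ) ≤ r := by exact_mod_cast hr0
  have hrs : Q - 1 ≤ r * (s - 1) := by
    rw [div_lt_iff₀ (by linarith)] at hr; exact hr.le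
  -- The decay `γ = β^4` is shared out: one factor `β^k` pays for the threshold of level `k`, one
  -- for the range `D` inside the powers, one for `D` as a prefactor, and one makes the levels
  -- summable.
  set β := γ ^ ((4 : ℝ)⁻¹) with hβ
  have hβ0 : 0 < β := Real.rpow_pos_of_pos hγ0 _
  have hβ1 : β < 1 := Real.rpow_lt_one hγ0.le hγ1 (by norm_num)
  have hβ4 : β ^ 4 = γ := by
    rw [hβ, ← Real.rpow_natCast, ← Real.rpow_mul hγ0.le]; norm_num
  obtain ⟨CD, hCD0, hCD⟩ := exists_bound_mul_pow d hβ0 hβ1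
  have h1β : 0 < 1 - β := by linarith
  -- Thresholds with sum at most `δ / 2`; the other half is kept for the remainder.
  set δk : ℕ → ℝ := fun k => δ * (1 - β) / 2 * β ^ k with hδk
  have hδk0 : ∀ k, 0 < δk k := fun k => by positivity
  set Cw := 6 * r * a * CD / (δ * (1 - β) / 2) with hCw
  have hCw0 : 0 < Cw := by positivity
  set C := CD * (Cw ^ Q + 2 * Real.exp 1 * (Cw ^ s) ^ r) / (1 - β) with hC
  refine ⟨C, ?_⟩
  intro ξ ξk S h hh hcard hconst hmeas hsucc hξm hξ
  have hhr : (1 : ℝ) ≤ h := by exact_mod_cast hh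
  have hh0 : (0 : ℝ) < h := by linarith
  have hmeas' : ∀ k t, Measurable (ξk k t) := fun k t => (hmeas k t).mono (hε.sigmaOn_le _) le_rfl
  set ζ : ℕ → ℤ → Ω → ℝ := fun k t ω => ξk (k + 1) t ω - ξk k t ω with hζ
  have hlevel : ∀ k, μ.real {ω | δk k * h ≤ |∑ t ∈ S, (ζ k t ω - ∫ ω', ζ k t ω' ∂μ)|} ≤
      (CD * (Cw ^ Q + 2 * Real.exp 1 * (Cw ^ s) ^ r) * (h : ℝ) ^ (1 - Q)) * β ^ k := by
    intro k
    set D : ℕ := (k + 2) * d with hDdef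
    have hD0 : 0 < D := by positivity
    have hDr : (0 : ℝ) < D := by exact_mod_cast hD0
    have hζm : ∀ t, Measurable[sigmaOn ε (Ioc (t - D) t)] (ζ k t) := by
      intro t
      refine Measurable.sub (hmeas (k + 1) t) ((hmeas k t).mono (sigmaOn_mono ε ?_) le_rfl)
      refine Ioc_subset_Ioc_left ?_
      have : (k + 1) * d ≤ D := Nat.mul_le_mul_right _ (by omega)
      have : (((k + 1) * d : ℕ) : ℤ) ≤ D := by exact_mod_cast this
      linarith
    have hb := nagaev_bound_dependent hε hD0 hζm S (a := a * γ ^ k) (x := δk k * h) (N := h) hQ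
      (by positivity) (mul_pos (hδk0 k) hh0) (hsucc k) hh0 (by exact_mod_cast hcard) hr0
    refine hb.trans ?_
    set w := 6 * r * (a * γ ^ k) * D / δk k with hw
    have hw0 : 0 < w := by have := hδk0 k; positivity
    have ew : 6 * r * (a * γ ^ k) * D / (δk k * h) = w / h := by
      have := (hδk0 k).ne'
      rw [hw]; field_simp
    have hwle : w ≤ Cw * (β ^ k) ^ 2 := by
      have e : w = (6 * r * a / (δ * (1 - β) / 2)) * (β ^ k) ^ 2 * (D * β ^ k) := by
        simp only [hw, hδk]
        rw [← hβ4, ← pow_mul, mul_comm 4 k, pow_mul]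
        have := (pow_pos hβ0 k).ne'
        field_simp
      rw [e, hCw]
      calc _ ≤ (6 * r * a / (δ * (1 - β) / 2)) * (β ^ k) ^ 2 * CD := by
            gcongr; exact hCD k
        _ = _ := by ring
    have hbk0 : 0 < β ^ k := pow_pos hβ0 k
    have hbk1 : β ^ k ≤ 1 := pow_le_one₀ hβ0.le hβ1.le
    have hb2 : (β ^ k) ^ 2 ≤ 1 := pow_le_one₀ hbk0.le hbk1
    have hpw : ∀ {z : ℝ}, 1 ≤ z → w ^ z ≤ Cw ^ z * (β ^ k) ^ 2 := by
      intro z hz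
      calc w ^ z ≤ (Cw * (β ^ k) ^ 2) ^ z := Real.rpow_le_rpow hw0.le hwle (by linarith)
        _ = Cw ^ z * ((β ^ k) ^ 2) ^ z := Real.mul_rpow hCw0.le (by positivity)
        _ ≤ Cw ^ z * (β ^ k) ^ 2 := by
            gcongr
            simpa using Real.rpow_le_rpow_of_exponent_ge (by positivity) hb2 hz
    have hQterm : h * (w / h) ^ Q ≤ Cw ^ Q * (β ^ k) ^ 2 * (h : ℝ) ^ (1 - Q) := by
      have e : h * (w / h) ^ Q = w ^ Q * (h : ℝ) ^ (1 - Q) := by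
        rw [Real.div_rpow hw0.le hh0.le, Real.rpow_sub hh0, Real.rpow_one]; ring
      rw [e]
      gcongr
      exact hpw hQ.le
    have hsterm : (h * (w / h) ^ s) ^ r ≤ (Cw ^ s) ^ r * (β ^ k) ^ 2 * (h : ℝ) ^ (1 - Q) := by
      have e : h * (w / h) ^ s = w ^ s * (h : ℝ) ^ (1 - s) := by
        rw [Real.div_rpow hw0.le hh0.le, Real.rpow_sub hh0, Real.rpow_one]; ring
      rw [e, mul_pow]
      refine mul_le_mul ?_ ?_ (by positivity) (by positivity)
      · calc (w ^ s) ^ r ≤ (Cw ^ s * (β ^ k) ^ 2) ^ r := by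
              gcongr; exact hpw hs1.le
          _ = (Cw ^ s) ^ r * ((β ^ k) ^ 2) ^ r := mul_pow _ _ _
          _ ≤ (Cw ^ s) ^ r * (β ^ k) ^ 2 := by
              gcongr
              exact pow_le_of_le_one (by positivity) hb2 hr0.ne'
      · rw [← Real.rpow_natCast, ← Real.rpow_mul hh0.le]
        exact Real.rpow_le_rpow_of_exponent_le hhr (by nlinarith)
    rw [ew]
    calc D * (h * (w / h) ^ Q + 2 * Real.exp 1 * (h * (w / h) ^ s) ^ r)
        ≤ D * (Cw ^ Q * (β ^ k) ^ 2 * (h : ℝ) ^ (1 - Q) +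
          2 * Real.exp 1 * ((Cw ^ s) ^ r * (β ^ k) ^ 2 * (h : ℝ) ^ (1 - Q))) := by
          gcongr
      _ = (D * β ^ k) * ((Cw ^ Q + 2 * Real.exp 1 * (Cw ^ s) ^ r) * (h : ℝ) ^ (1 - Q) * β ^ k) := by
          ring
      _ ≤ CD * ((Cw ^ Q + 2 * Real.exp 1 * (Cw ^ s) ^ r) * (h : ℝ) ^ (1 - Q) * β ^ k) := by
          gcongr; exact hCD k
      _ = _ := by ring
  -- Telescope through `L` levels; the deterministic `ξk 0` drops out on centring. The remainder is
  -- bounded in mean only, and Markov gives a term free of `h` that vanishes as `L → ∞`.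
  have hfin : ∀ L : ℕ, μ.real {ω | δ * h ≤ |∑ t ∈ S, (ξ t ω - ∫ ω', ξ t ω' ∂μ)|} ≤
      C * (h : ℝ) ^ (1 - Q) + (4 * a / δ) * γ ^ L := by
    intro L
    set rem : ℤ → Ω → ℝ := fun t ω => ξ t ω - ξk L t ω with hrem
    have hremm : ∀ t ∈ S, AEStronglyMeasurable (rem t) μ := fun t ht =>
      (hξm t ht).sub (hmeas' L t).aestronglyMeasurable
    have hremi : ∀ t ∈ S, Integrable (rem t) μ ∧ ∫ ω, |rem t ω| ∂μ ≤ a * γ ^ L := fun t ht =>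
      integrable_of_nq hQ.le (hremm t ht) (by positivity) (hξ L t ht)
    have hζi : ∀ k, ∀ t ∈ S, Integrable (ζ k t) μ := fun k t ht =>
      (integrable_of_nq hQ.le ((hmeas' (k + 1) t).sub (hmeas' k t)).aestronglyMeasurable
        (by positivity) (hsucc k t ht)).1
    have htel : ∀ t ω, ∑ k ∈ Finset.range L, ζ k t ω = ξk L t ω - ξk 0 t ω := fun t ω =>
      Finset.sum_range_sub (fun k => ξk k t ω) L
    have hdec : ∀ t ∈ S, ∀ ω, ξ t ω - ∫ ω', ξ t ω' ∂μ =
        ∑ k ∈ Finset.range L, (ζ k t ω - ∫ ω', ζ k t ω' ∂μ) + (rem t ω - ∫ ω', rem t ω' ∂μ) := by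
      intro t ht ω
      obtain ⟨c, hc⟩ := hconst t
      have e1 : ∀ ω, ξ t ω = ∑ k ∈ Finset.range L, ζ k t ω + rem t ω + c := fun ω => by
        rw [htel, hc ω]; simp only [hrem]; ring
      have hi1 : Integrable (fun ω => ∑ k ∈ Finset.range L, ζ k t ω) μ :=
        integrable_finsetSum _ fun k _ => hζi k t ht
      have e2 : ∫ ω', ξ t ω' ∂μ =
          ∑ k ∈ Finset.range L, ∫ ω', ζ k t ω' ∂μ + ∫ ω', rem t ω' ∂μ + c := by
        have hi2 : Integrable (fun ω => ∑ k ∈ Finset.range L, ζ k t ω + rem t ω) μ :=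
          hi1.add (hremi t ht).1
        simp_rw [e1]
        rw [integral_add hi2 (integrable_const c),
          integral_add hi1 (hremi t ht).1, integral_finsetSum _ fun k _ => hζi k t ht]
        simp
      have e3 : ∑ k ∈ Finset.range L, (ζ k t ω - ∫ ω', ζ k t ω' ∂μ) =
          ∑ k ∈ Finset.range L, ζ k t ω - ∑ k ∈ Finset.range L, ∫ ω', ζ k t ω' ∂μ :=
        Finset.sum_sub_distrib _ _
      rw [e2, e1 ω, e3]; abel
    set Rm : Ω → ℝ := fun ω => ∑ t ∈ S, (rem t ω - ∫ ω', rem t ω' ∂μ) with hRm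
    have hRmi : Integrable Rm μ := integrable_finsetSum _ fun t ht =>
      (hremi t ht).1.sub (integrable_const _)
    have hRmle : ∫ ω, |Rm ω| ∂μ ≤ h * (2 * (a * γ ^ L)) := by
      have hri : ∀ t ∈ S, Integrable (fun ω => |rem t ω - ∫ ω', rem t ω' ∂μ|) μ := fun t ht =>
        ((hremi t ht).1.sub (integrable_const _)).abs
      have h1 : ∫ ω, |Rm ω| ∂μ ≤ ∫ ω, ∑ t ∈ S, |rem t ω - ∫ ω', rem t ω' ∂μ| ∂μ :=
        integral_mono hRmi.abs (integrable_finsetSum _ hri) fun ω => Finset.abs_sum_le_sum_abs _ _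
      rw [integral_finsetSum _ hri] at h1
      refine h1.trans ((Finset.sum_le_sum (g := fun _ => 2 * (a * γ ^ L)) fun t ht => ?_).trans ?_)
      · have h2 : ∫ ω, |rem t ω - ∫ ω', rem t ω' ∂μ| ∂μ ≤
            ∫ ω, (|rem t ω| + |∫ ω', rem t ω' ∂μ|) ∂μ :=
          integral_mono (hri t ht)
            ((hremi t ht).1.abs.add (integrable_const _)) fun ω => abs_sub _ _
        rw [integral_add (hremi t ht).1.abs (integrable_const _), integral_const] at h2
        simp only [probReal_univ, smul_eq_mul, one_mul] at h2
        have h3 : |∫ ω', rem t ω' ∂μ| ≤ ∫ ω, |rem t ω| ∂μ := abs_integral_le_integral_abs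
        linarith [(hremi t ht).2]
      · rw [Finset.sum_const, nsmul_eq_mul]
        have : (S.card : ℝ) ≤ h := by exact_mod_cast hcard
        gcongr
    have hRprob : μ.real {ω | δ / 2 * h ≤ |Rm ω|} ≤ (4 * a / δ) * γ ^ L := by
      have h1 := mul_meas_ge_le_integral_of_nonneg (μ := μ)
        (Eventually.of_forall fun ω => abs_nonneg (Rm ω)) hRmi.abs (δ / 2 * h)
      have h2 := h1.trans hRmle
      have h3 : 0 < δ / 2 * h := by positivity
      rw [← le_div_iff₀' h3] at h2
      refine h2.trans (le_of_eq ?_)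
      field_simp; ring
    have hsub : {ω | δ * h ≤ |∑ t ∈ S, (ξ t ω - ∫ ω', ξ t ω' ∂μ)|} ⊆
        (⋃ k ∈ Finset.range L, {ω | δk k * h ≤ |∑ t ∈ S, (ζ k t ω - ∫ ω', ζ k t ω' ∂μ)|}) ∪
        {ω | δ / 2 * h ≤ |Rm ω|} := by
      intro ω hω
      by_contra hcon
      simp only [mem_union, mem_iUnion, mem_ofPred_eq, not_or, not_exists, not_le] at hcon
      obtain ⟨hc1, hc2⟩ := hcon
      have e : ∑ t ∈ S, (ξ t ω - ∫ ω', ξ t ω' ∂μ) =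
          ∑ k ∈ Finset.range L, ∑ t ∈ S, (ζ k t ω - ∫ ω', ζ k t ω' ∂μ) + Rm ω := by
        rw [Finset.sum_comm, hRm, ← Finset.sum_add_distrib]
        exact Finset.sum_congr rfl fun t ht => hdec t ht ω
      have h1 : |∑ k ∈ Finset.range L, ∑ t ∈ S, (ζ k t ω - ∫ ω', ζ k t ω' ∂μ)| ≤ δ / 2 * h := by
        refine (Finset.abs_sum_le_sum_abs _ _).trans
          ((Finset.sum_le_sum fun k hk => (hc1 k hk).le).trans ?_)
        rw [← Finset.sum_mul]
        gcongr
        simp only [hδk]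
        rw [← Finset.mul_sum]
        have hg : ∑ k ∈ Finset.range L, β ^ k ≤ 1 / (1 - β) := by
          have := (summable_geometric_of_lt_one hβ0.le hβ1).sum_le_tsum (Finset.range L)
            fun k _ => pow_nonneg hβ0.le k
          rwa [tsum_geometric_of_lt_one hβ0.le hβ1, ← one_div] at this
        calc δ * (1 - β) / 2 * ∑ k ∈ Finset.range L, β ^ k
            ≤ δ * (1 - β) / 2 * (1 / (1 - β)) := by gcongr
          _ = δ / 2 := by field_simp
      have h2 := abs_add_le (∑ k ∈ Finset.range L, ∑ t ∈ S, (ζ k t ω - ∫ ω', ζ k t ω' ∂μ)) (Rm ω)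
      simp only [mem_ofPred_eq] at hω
      rw [e] at hω
      linarith
    refine (measureReal_mono hsub).trans ((measureReal_union_le _ _).trans
      (add_le_add ?_ hRprob))
    refine (measureReal_biUnion_finset_le _ _).trans
      ((Finset.sum_le_sum fun k _ => hlevel k).trans ?_)
    rw [← Finset.mul_sum]
    have hg : ∑ k ∈ Finset.range L, β ^ k ≤ 1 / (1 - β) := by
      have := (summable_geometric_of_lt_one hβ0.le hβ1).sum_le_tsum (Finset.range L)
        fun k _ => pow_nonneg hβ0.le k
      rwa [tsum_geometric_of_lt_one hβ0.le hβ1, ← one_div] at this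
    calc _ ≤ CD * (Cw ^ Q + 2 * Real.exp 1 * (Cw ^ s) ^ r) * (h : ℝ) ^ (1 - Q) * (1 / (1 - β)) := by
          gcongr
      _ = C * (h : ℝ) ^ (1 - Q) := by rw [hC]; ring
  refine ge_of_tendsto' (x := atTop) ?_ hfin
  have := (tendsto_pow_atTop_nhds_zero_of_lt_one hγ0.le hγ1).const_mul (4 * a / δ)
  simpa using this.const_add (C * (h : ℝ) ^ (1 - Q))

end LocStat

end

/-! ### Moments, approximation and deviations for `g` along the process -/

noncomputable section


namespace LocStat

variable {Ω : Type*} [mΩ : MeasurableSpace Ω] {μ : Measure Ω} [IsProbabilityMeasure μ]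
  {p : ℕ} {ε : ℤ → Ω → ℝ} {F : ℝ → (Fin p → ℝ) → ℝ → ℝ}
  {q : ℝ} {χ : Fin p → ℝ} {C₁ : ℝ} {Xt : ℤ → ℝ → Ω → ℝ} {X : ℕ → ℤ → Ω → ℝ}

/-- The locally stationary model together with the quality of its stationary approximation. -/
structure Setup (μ : Measure Ω) (ε : ℤ → Ω → ℝ) (F : ℝ → (Fin p → ℝ) → ℝ → ℝ) (q : ℝ)
    (χ : Fin p → ℝ) (C₁ : ℝ) (Xt : ℤ → ℝ → Ω → ℝ) (X : ℕ → ℤ → Ω → ℝ) (A c α : ℝ) : Prop where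
  model : Model μ ε F q χ C₁
  stat : IsStationaryApprox μ ε F Xt
  loc : IsLocallyStationary μ ε F Xt X
  const_nonneg : 0 ≤ A
  shift_nonneg : 0 ≤ c
  exponent_pos : 0 < α
  approx : ∀ (n : ℕ) (t : ℤ), t ≤ n → ∀ u ∈ Icc (0 : ℝ) 1,
    nq μ q (fun ω => X n t ω - Xt t u ω) ≤ ENNReal.ofReal (A * (|path n t - u| + c / n) ^ α)
  stat_approx : ∀ u ∈ Icc (0 : ℝ) 1, ∀ u' ∈ Icc (0 : ℝ) 1, ∀ t : ℤ,
    nq μ q (fun ω => Xt t u ω - Xt t u' ω) ≤ ENNReal.ofReal (A * |u - u'| ^ α)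

namespace Model

variable {v : ℤ → ℝ} {M C : ℝ} {g : (Fin (p + 1) → ℝ) → ℝ}

lemma measurable_lags_picard (hm : Model μ ε F q χ C₁) (hv : ∀ t, v t ∈ Icc (0 : ℝ) 1)
    (k : ℕ) (t : ℤ) :
    Measurable[sigmaOn ε (Ioc (t - ((k + 1) * (p + 1) : ℕ)) t)]
      (fun ω => lags (p + 1) (fun s => picard ε F v k s ω) t) := by
  refine @measurable_pi_lambda _ _ _ (_) _ _ fun i => ?_
  refine (hm.measurable_picard hv k (t - i)).mono (sigmaOn_mono ε ?_) le_rfl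
  refine Ioc_subset_Ioc ?_ (by omega)
  have := i.2
  push_cast
  nlinarith

lemma one_le_exponent (hq : M + 1 ≤ q) (hg : ClassL univ M C g) : 1 ≤ q / (M + 1) := by
  have := hg.1
  rwa [one_le_div (by linarith)]

/-- The geometric decay of Picard differences survives the passage to `g`; it is the input `a * γ ^
k` of the deviation inequality. -/
lemma nq_class_picard_succ (hm : Model μ ε F q χ C₁) (hv : ∀ t, v t ∈ Icc (0 : ℝ) 1)
    (hg : ClassL univ M C g) (hC : 0 ≤ C) (k : ℕ) (t : ℤ) :
    nq μ (q / (M + 1)) (fun ω => g (lags (p + 1) (fun s => picard ε F v (k + 1) s ω) t)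
      - g (lags (p + 1) (fun s => picard ε F v k s ω) t)) ≤
      ENNReal.ofReal (lipConst (p + 1) M C (bound χ C₁) * (bound χ C₁ * (∑ i, χ i) ^ k)) :=
  hg.nq_sub_le hC hm.one_le
    ((Causal.lags fun s _ => hm.causal_picard hv (k + 1) s).aemeasurable hm.iid)
    ((Causal.lags fun s _ => hm.causal_picard hv k s).aemeasurable hm.iid)
    hm.bound_nonneg (mul_nonneg hm.bound_nonneg (pow_nonneg hm.sum_nonneg _))
    (fun _ => hm.picard_bound hv _ _) (fun _ => hm.picard_bound hv _ _)
    (fun _ => hm.picard_succ_sub hv _ _)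

lemma nq_class_sub_picard (hm : Model μ ε F q χ C₁) (hv : ∀ t, v t ∈ Icc (0 : ℝ) 1)
    (hg : ClassL univ M C g) (hC : 0 ≤ C) {T : ℤ} {Z : ℤ → Ω → ℝ} (hZ : IsSol μ ε F v T Z)
    (hb : ∀ t ≤ T, nq μ q (Z t) ≤ ENNReal.ofReal (bound χ C₁)) (k : ℕ) {t : ℤ} (ht : t ≤ T) :
    nq μ (q / (M + 1)) (fun ω => g (lags (p + 1) (fun s => Z s ω) t)
      - g (lags (p + 1) (fun s => picard ε F v k s ω) t)) ≤
      ENNReal.ofReal (lipConst (p + 1) M C (bound χ C₁) * (bound χ C₁ * (∑ i, χ i) ^ k)) :=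
  hg.nq_sub_le hC hm.one_le
    ((Causal.lags fun s hs => hZ.causal s (by omega)).aemeasurable hm.iid)
    ((Causal.lags fun s _ => hm.causal_picard hv k s).aemeasurable hm.iid)
    hm.bound_nonneg (mul_nonneg hm.bound_nonneg (pow_nonneg hm.sum_nonneg _))
    (fun _ => hb _ (by omega)) (fun _ => hm.picard_bound hv _ _)
    (fun _ => hm.sub_picard hv hZ hb _ (by omega))

/-- First moments of `g` along a solution. -/
lemma integrable_class (hm : Model μ ε F q χ C₁) (hq : M + 1 ≤ q)
    (hg : ClassL univ M C g) (hC : 0 ≤ C) {T : ℤ} {Z : ℤ → Ω → ℝ} (hZ : IsSol μ ε F v T Z)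
    (hb : ∀ t ≤ T, nq μ q (Z t) ≤ ENNReal.ofReal (bound χ C₁)) {t : ℤ} (ht : t ≤ T) :
    Integrable (fun ω => g (lags (p + 1) (fun s => Z s ω) t)) μ ∧
      ∫ ω, |g (lags (p + 1) (fun s => Z s ω) t)| ∂μ ≤
        |g 0| + lipConst (p + 1) M C (bound χ C₁) * bound χ C₁ := by
  have hR := hm.bound_nonneg
  have hc : Causal μ ε t (fun ω => lags (p + 1) (fun s => Z s ω) t) :=
    Causal.lags fun s hs => hZ.causal s (by omega)
  have h1 : nq μ (q / (M + 1)) (fun ω => g (lags (p + 1) (fun s => Z s ω) t) - g 0) ≤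
      ENNReal.ofReal (lipConst (p + 1) M C (bound χ C₁) * bound χ C₁) :=
    hg.nq_sub_le hC hm.one_le (hc.aemeasurable hm.iid) (z' := fun _ => 0) aemeasurable_const hR hR
      (fun _ => hb _ (by omega)) (fun _ => by simp [nq_const hm.one_le])
      (fun i => by simpa [lags] using hb (t - i) (by omega))
  have hgm := (hc.comp hg.continuous.measurable).aestronglyMeasurable hm.iid
  obtain ⟨hi, hle⟩ := integrable_of_nq (one_le_exponent hq hg)
    (f := fun ω => g (lags (p + 1) (fun s => Z s ω) t) - g 0)
    (hgm.sub aestronglyMeasurable_const) (mul_nonneg (lipConst_nonneg hC hR) hR) h1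
  have hi' : Integrable (fun ω => g (lags (p + 1) (fun s => Z s ω) t)) μ := by
    have := hi.add (integrable_const (g 0))
    refine this.congr (Eventually.of_forall fun ω => ?_)
    simp
  refine ⟨hi', ?_⟩
  have h2 : ∫ ω, |g (lags (p + 1) (fun s => Z s ω) t)| ∂μ ≤
      ∫ ω, (|g 0| + |g (lags (p + 1) (fun s => Z s ω) t) - g 0|) ∂μ := by
    refine integral_mono hi'.abs ((integrable_const _).add hi.abs) fun ω => ?_
    have := abs_add_le (g 0) (g (lags (p + 1) (fun s => Z s ω) t) - g 0)
    simpa using this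
  rw [integral_add (integrable_const _) hi.abs, integral_const] at h2
  simp only [probReal_univ, smul_eq_mul, one_mul] at h2
  linarith

end Model

namespace Setup

variable {A c α : ℝ} {M C : ℝ} {g : (Fin (p + 1) → ℝ) → ℝ}

lemma bound_X (hS : Setup μ ε F q χ C₁ Xt X A c α) (n : ℕ) :
    ∀ t ≤ (n : ℤ), nq μ q (X n t) ≤ ENNReal.ofReal (Model.bound χ C₁) :=
  fun _ ht => hS.loc.nq_le hS.model hS.stat ht

lemma integrable_X (hS : Setup μ ε F q χ C₁ Xt X A c α) (hq : M + 1 ≤ q)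
    (hg : ClassL univ M C g) (hC : 0 ≤ C) {n : ℕ} {t : ℤ} (ht : t ≤ n) :
    Integrable (fun ω => g (lags (p + 1) (fun s => X n s ω) t)) μ ∧
      ∫ ω, |g (lags (p + 1) (fun s => X n s ω) t)| ∂μ ≤
        |g 0| + lipConst (p + 1) M C (Model.bound χ C₁) * Model.bound χ C₁ :=
  hS.model.integrable_class hq hg hC (hS.loc.isSol hS.model hS.stat n) (hS.bound_X n) ht

lemma integrable_Xt (hS : Setup μ ε F q χ C₁ Xt X A c α) (hq : M + 1 ≤ q)
    (hg : ClassL univ M C g) (hC : 0 ≤ C) {u : ℝ} (hu : u ∈ Icc (0 : ℝ) 1) (t : ℤ) :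
    Integrable (fun ω => g (lags (p + 1) (fun s => Xt s u ω) t)) μ ∧
      ∫ ω, |g (lags (p + 1) (fun s => Xt s u ω) t)| ∂μ ≤
        |g 0| + lipConst (p + 1) M C (Model.bound χ C₁) * Model.bound χ C₁ :=
  hS.model.integrable_class hq hg hC (hS.stat.isSol hu t) (fun t _ => hS.stat.nq_le hS.model hu t)
    le_rfl

lemma integral_Xt_eq (hS : Setup μ ε F q χ C₁ Xt X A c α)
    (hg : ClassL univ M C g) {u : ℝ} (hu : u ∈ Icc (0 : ℝ) 1) (t : ℤ) :
    ∫ ω, g (lags (p + 1) (fun s => Xt s u ω) t) ∂μ =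
      ∫ ω, g (lags (p + 1) (fun s => Xt s u ω) 0) ∂μ :=
  ((hS.stat.identDistrib_lags hS.model.iid hu (p + 1) t 0).comp
    hg.continuous.measurable).integral_eq

/-- Replacing the locally stationary process by its stationary approximation. -/
lemma integral_abs_sub_le (hS : Setup μ ε F q χ C₁ Xt X A c α) (hq : M + 1 ≤ q)
    (hg : ClassL univ M C g) (hC : 0 ≤ C) {n : ℕ} {t : ℤ} (ht : t ≤ n) {u : ℝ}
    (hu : u ∈ Icc (0 : ℝ) 1) :
    ∫ ω, |g (lags (p + 1) (fun s => X n s ω) t) - g (lags (p + 1) (fun s => Xt s u ω) t)| ∂μ ≤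
      lipConst (p + 1) M C (Model.bound χ C₁) * (A * (|path n t - u| + (c + p) / n) ^ α) := by
  have hm := hS.model
  have hA := hS.const_nonneg
  have hc := hS.shift_nonneg
  have hX := hS.loc.isSol hm hS.stat n
  have c1 : Causal μ ε t (fun ω => lags (p + 1) (fun s => X n s ω) t) :=
    Causal.lags fun s hs => hX.causal s (by omega)
  have c2 : Causal μ ε t (fun ω => lags (p + 1) (fun s => Xt s u ω) t) :=
    Causal.lags fun s hs => (hS.stat.isSol hu s).causal s le_rfl
  have h1 := hg.nq_sub_le hC hm.one_le (c1.aemeasurable hm.iid) (c2.aemeasurable hm.iid)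
    hm.bound_nonneg (δ := A * (|path n t - u| + (c + p) / n) ^ α) (by positivity)
    (fun _ => hS.bound_X n _ (by omega)) (fun _ => hS.stat.nq_le hm hu _) (fun i => by
      refine (hS.approx n (t - i) (by omega) u hu).trans (ENNReal.ofReal_le_ofReal ?_)
      -- The older coordinates of the lag vector shift the rescaled time by at most `p / n`.
      have hle : |path n (t - i) - u| + c / n ≤ |path n t - u| + (c + p) / n := by
        have h2 := abs_sub_le (path n (t - i)) (path n t) u
        have h3 := abs_path_sub_le n (t - i) t
        have h4 : |((t - i : ℤ) : ℝ) - t| / n ≤ p / n := by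
          gcongr
          have : (i : ℝ) ≤ p := by exact_mod_cast Nat.lt_succ_iff.1 i.2
          push_cast
          rw [abs_le]; constructor <;> linarith [(Nat.cast_nonneg (i : ℕ) : (0 : ℝ) ≤ (i : ℕ))]
        rw [add_div]; linarith
      gcongr
      exact hS.exponent_pos.le)
  exact (integrable_of_nq (Model.one_le_exponent hq hg)
    (((c1.comp hg.continuous.measurable).aestronglyMeasurable hm.iid).sub
      ((c2.comp hg.continuous.measurable).aestronglyMeasurable hm.iid))
    (mul_nonneg (lipConst_nonneg hC hm.bound_nonneg) (by positivity)) h1).2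

lemma abs_integral_sub_le (hS : Setup μ ε F q χ C₁ Xt X A c α) (hq : M + 1 ≤ q)
    (hg : ClassL univ M C g) (hC : 0 ≤ C) {n : ℕ} {t : ℤ} (ht : t ≤ n) {u : ℝ}
    (hu : u ∈ Icc (0 : ℝ) 1) :
    |∫ ω, g (lags (p + 1) (fun s => X n s ω) t) ∂μ -
      ∫ ω, g (lags (p + 1) (fun s => Xt s u ω) 0) ∂μ| ≤
      lipConst (p + 1) M C (Model.bound χ C₁) * (A * (|path n t - u| + (c + p) / n) ^ α) := by
  rw [← hS.integral_Xt_eq hg hu t, ← integral_sub (hS.integrable_X hq hg hC ht).1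
    (hS.integrable_Xt hq hg hC hu t).1]
  exact abs_integral_le_integral_abs.trans (hS.integral_abs_sub_le hq hg hC ht hu)

lemma abs_integral_Xt_sub_le (hS : Setup μ ε F q χ C₁ Xt X A c α) (hq : M + 1 ≤ q)
    (hg : ClassL univ M C g) (hC : 0 ≤ C) {u u' : ℝ}
    (hu : u ∈ Icc (0 : ℝ) 1) (hu' : u' ∈ Icc (0 : ℝ) 1) :
    |∫ ω, g (lags (p + 1) (fun s => Xt s u ω) 0) ∂μ -
      ∫ ω, g (lags (p + 1) (fun s => Xt s u' ω) 0) ∂μ| ≤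
      lipConst (p + 1) M C (Model.bound χ C₁) * (A * |u - u'| ^ α) := by
  have hm := hS.model
  have hA := hS.const_nonneg
  rw [← integral_sub (hS.integrable_Xt hq hg hC hu 0).1 (hS.integrable_Xt hq hg hC hu' 0).1]
  refine abs_integral_le_integral_abs.trans ?_
  have c2 : ∀ u ∈ Icc (0 : ℝ) 1, Causal μ ε 0 (fun ω => lags (p + 1) (fun s => Xt s u ω) 0) :=
    fun u hu => Causal.lags fun s hs => (hS.stat.isSol hu s).causal s le_rfl
  have h1 := hg.nq_sub_le hC hm.one_le ((c2 u hu).aemeasurable hm.iid)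
    ((c2 u' hu').aemeasurable hm.iid)
    hm.bound_nonneg (δ := A * |u - u'| ^ α) (by positivity)
    (fun _ => hS.stat.nq_le hm hu _) (fun _ => hS.stat.nq_le hm hu' _)
    (fun i => hS.stat_approx u hu u' hu' _)
  exact (integrable_of_nq (Model.one_le_exponent hq hg)
    ((((c2 u hu).comp hg.continuous.measurable).aestronglyMeasurable hm.iid).sub
      (((c2 u' hu').comp hg.continuous.measurable).aestronglyMeasurable hm.iid))
    (mul_nonneg (lipConst_nonneg hC hm.bound_nonneg) (by positivity)) h1).2

/-- Deviation inequality for partial sums of `g` along the locally stationary process. -/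
lemma exists_deviation_bound (hS : Setup μ ε F q χ C₁ Xt X A c α) (hq : M + 1 < q)
    (hg : ClassL univ M C g) (hC : 0 ≤ C) {δ : ℝ} (hδ : 0 < δ) :
    ∃ C' : ℝ, ∀ (n : ℕ) (S : Finset ℤ) (h : ℕ), 0 < h → S.card ≤ h → (∀ t ∈ S, t ≤ (n : ℤ)) →
      μ.real {ω | δ * h ≤ |∑ t ∈ S, (g (lags (p + 1) (fun s => X n s ω) t) -
        ∫ ω', g (lags (p + 1) (fun s => X n s ω') t) ∂μ)|} ≤ C' * (h : ℝ) ^ (1 - q / (M + 1)) := by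
  have hm := hS.model
  have hM := hg.1
  have hR := hm.bound_nonneg
  set Λ := lipConst (p + 1) M C (Model.bound χ C₁) * Model.bound χ C₁
  have hΛ : 0 ≤ Λ := mul_nonneg (lipConst_nonneg hC hR) hR
  -- The weights may sum to zero while the deviation inequality needs a positive rate; likewise `Λ +
  -- 1` replaces `Λ` below.
  set γ := max (∑ i, χ i) (1 / 2) with hγ
  have hγ0 : 0 < γ := lt_max_of_lt_right (by norm_num)
  have hle : ∀ k : ℕ, lipConst (p + 1) M C (Model.bound χ C₁) *
      (Model.bound χ C₁ * (∑ i, χ i) ^ k) ≤ (Λ + 1) * γ ^ k := fun k => by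
    rw [← mul_assoc]
    refine mul_le_mul (by simp [Λ]) (pow_le_pow_left₀ hm.sum_nonneg (le_max_left _ _) k)
      (pow_nonneg hm.sum_nonneg _) (by positivity)
  obtain ⟨C', hC'⟩ := LocStat.exists_deviation_bound hm.iid (Q := q / (M + 1)) (a := Λ + 1)
    (γ := γ) (δ := δ) (by rwa [one_lt_div (by linarith)]) (by positivity) hγ0
    (max_lt hm.weight_lt (by norm_num)) (p + 1) (by omega) hδ
  refine ⟨C', fun n S h hh hcard hSn => ?_⟩
  have hX := hS.loc.isSol hm hS.stat n
  refine hC' (fun t ω => g (lags (p + 1) (fun s => X n s ω) t))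
    (fun k t ω => g (lags (p + 1) (fun s => picard ε F (path n) k s ω) t)) S h hh hcard ?_ ?_ ?_ ?_ ?_
  · intro t
    exact ⟨g (fun _ => 0), fun ω => rfl⟩
  · intro k t
    exact hg.continuous.measurable.comp (hm.measurable_lags_picard (path_mem n) k t)
  · intro k t _
    exact (hm.nq_class_picard_succ (path_mem n) hg hC k t).trans (ENNReal.ofReal_le_ofReal (hle k))
  · intro t ht
    exact (hS.integrable_X hq.le hg hC (hSn t ht)).1.aestronglyMeasurable
  · intro k t ht
    exact (hm.nq_class_sub_picard (path_mem n) hg hC hX (hS.bound_X n) k (hSn t ht)).trans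
      (ENNReal.ofReal_le_ofReal (hle k))

end Setup

end LocStat

end

/-! ### Local averages: bias and uniform law of large numbers -/

noncomputable section


namespace LocStat

/-- The kernel-weighted local average of `f (p+1), …, f n`. -/
def localAvg (p : ℕ) (K : ℝ → ℝ) (n : ℕ) (b u : ℝ) (f : ℕ → ℝ) : ℝ :=
  1 / (n : ℝ) * ∑ t ∈ Finset.Icc (p + 1) n, scaled K b ((t : ℝ) / (n : ℝ) - u) * f t

lemma localAvg_eq (p : ℕ) (K : ℝ → ℝ) {n : ℕ} {b : ℝ} (hn : 0 < n) (hb : 0 < b) (u : ℝ)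
    (f : ℕ → ℝ) : localAvg p K n b u f =
      1 / (n * b) * ∑ t ∈ Finset.Icc (p + 1) n, K (((t : ℝ) - n * u) / (n * b)) * f t := by
  have hn' : (0 : ℝ) < n := by exact_mod_cast hn
  rw [localAvg, Finset.mul_sum, Finset.mul_sum]
  refine Finset.sum_congr rfl fun t _ => ?_
  have : ((t : ℝ) / n - u) / b = ((t : ℝ) - n * u) / (n * b) := by field_simp
  rw [scaled, this]
  field_simp

lemma localAvg_sub (p : ℕ) (K : ℝ → ℝ) (n : ℕ) (b u : ℝ) (f g : ℕ → ℝ) :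
    localAvg p K n b u (fun t => f t - g t) = localAvg p K n b u f - localAvg p K n b u g := by
  simp only [localAvg, mul_sub, Finset.sum_sub_distrib]

lemma IsBVKernel.sum_abs_div_le {K V : ℝ → ℝ} {B : ℝ} (hK : IsBVKernel K V B) {m : ℝ} (hm : 1 ≤ m)
    (x : ℝ) (S : Finset ℕ) : 1 / m * ∑ t ∈ S, |K (((t : ℝ) - x) / m)| ≤ 2 * B := by
  have hm0 : 0 < m := by linarith
  have h1 := hK.sum_abs_le' hm0 S (x := x)
  rw [one_div_mul_eq_div, div_le_iff₀ hm0]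
  nlinarith [hK.bound_nonneg]

lemma IsBVKernel.div_sub_abs_le {K V : ℝ → ℝ} {B : ℝ} (hK : IsBVKernel K V B) {n : ℕ} {b u : ℝ}
    (hn : 0 < n) (hb : 0 < b) {t : ℕ} (h : K (((t : ℝ) - n * u) / (n * b)) ≠ 0) :
    |(t : ℝ) / n - u| ≤ b / 2 := by
  have hn' : (0 : ℝ) < n := by exact_mod_cast hn
  have h1 := hK.abs_sub_le_of_ne (by positivity) h
  have e : (t : ℝ) - n * u = n * ((t : ℝ) / n - u) := by field_simp
  rw [e, abs_mul, abs_of_pos hn'] at h1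
  have : n * |(t : ℝ) / n - u| ≤ n * (b / 2) := by linarith
  exact le_of_mul_le_mul_left this hn'

variable {Ω : Type*} [mΩ : MeasurableSpace Ω] {μ : Measure Ω}

/-- Uniform convergence to zero in outer probability over the sets `U n`. -/
def UnifTendsto (μ : Measure Ω) (U : ℕ → Set ℝ) (D : ℕ → ℝ → Ω → ℝ) : Prop :=
  ∀ δ > 0, Tendsto (fun n => μ {ω | ∃ u ∈ U n, δ ≤ |D n u ω|}) atTop (𝓝 0)

namespace UnifTendsto

variable {U : ℕ → Set ℝ} {D D' : ℕ → ℝ → Ω → ℝ}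

lemma of_eventually_le (h : ∀ δ > 0, ∃ a : ℕ → ℝ≥0∞, Tendsto a atTop (𝓝 0) ∧
    ∀ᶠ n in atTop, μ {ω | ∃ u ∈ U n, δ ≤ |D n u ω|} ≤ a n) : UnifTendsto μ U D := by
  intro δ hδ
  obtain ⟨a, ha, hle⟩ := h δ hδ
  exact tendsto_of_tendsto_of_tendsto_of_le_of_le' tendsto_const_nhds ha
    (Eventually.of_forall fun _ => zero_le) hle

lemma add (h : UnifTendsto μ U D) (h' : UnifTendsto μ U D') :
    UnifTendsto μ U (fun n u ω => D n u ω + D' n u ω) := by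
  refine of_eventually_le fun δ hδ => ?_
  have hadd := (h (δ / 2) (by positivity)).add (h' (δ / 2) (by positivity))
  rw [add_zero] at hadd
  refine ⟨_, hadd, Eventually.of_forall fun n => ?_⟩
  refine (measure_mono ?_).trans (measure_union_le _ _)
  rintro ω ⟨u, hu, hle⟩
  by_contra hcon
  simp only [mem_union, mem_ofPred_eq, not_or, not_exists, not_and, not_le] at hcon
  have h1 := hcon.1 u hu
  have h2 := hcon.2 u hu
  linarith [abs_add_le (D n u ω) (D' n u ω)]

lemma of_bound {a : ℕ → ℝ} (ha : Tendsto a atTop (𝓝 0))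
    (h : ∀ᶠ n in atTop, ∀ u ∈ U n, ∀ ω, |D n u ω| ≤ a n) : UnifTendsto μ U D := by
  refine of_eventually_le fun δ hδ => ⟨fun _ => 0, tendsto_const_nhds, ?_⟩
  filter_upwards [h, ha.eventually_lt_const hδ] with n hn han
  have : {ω | ∃ u ∈ U n, δ ≤ |D n u ω|} = ∅ := by
    ext ω
    simp only [mem_ofPred_eq, mem_empty_iff_false, iff_false, not_exists, not_and, not_le]
    exact fun u hu => (hn u hu ω).trans_lt han
  simp [this]

lemma congr (h : UnifTendsto μ U D) (he : ∀ n u ω, D n u ω = D' n u ω) : UnifTendsto μ U D' := by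
  have : D = D' := by ext; exact he _ _ _
  exact this ▸ h

end UnifTendsto

lemma IsBandwidth.eventually_pos {b : ℕ → ℝ} (hb : IsBandwidth b) (C : ℝ) :
    ∀ᶠ n : ℕ in atTop, 0 < n ∧ C ≤ n * b n :=
  (eventually_gt_atTop 0).and (hb.tendsto_mul.eventually_ge_atTop C)

lemma IsBandwidth.tendsto_rate {b : ℕ → ℝ} (hb : IsBandwidth b) (c C : ℝ) {α : ℝ} (hα : 0 < α) :
    Tendsto (fun n : ℕ => C * (b n / 2 + c / n) ^ α) atTop (𝓝 0) := by
  have h1 : Tendsto (fun n : ℕ => b n / 2 + c / n) atTop (𝓝 0) := by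
    simpa using (hb.tendsto_zero.div_const 2).add (tendsto_const_div_atTop_nhds_zero_nat c)
  have h2 := h1.rpow_const (p := α) (Or.inr hα.le)
  rw [Real.zero_rpow hα.ne'] at h2
  simpa using h2.const_mul C

variable [IsProbabilityMeasure μ]
  {p : ℕ} {ε : ℤ → Ω → ℝ} {F : ℝ → (Fin p → ℝ) → ℝ → ℝ}
  {q : ℝ} {χ : Fin p → ℝ} {C₁ : ℝ} {Xt : ℤ → ℝ → Ω → ℝ} {X : ℕ → ℤ → Ω → ℝ}

lemma card_cell_le (S : Finset ℕ) {h : ℕ} (hh : 0 < h) (j : ℕ) :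
    (S.filter fun t => t / h = j).card ≤ h := by
  have hsub : (S.filter fun t => t / h = j) ⊆ Finset.Ico (j * h) (j * h + h) := by
    intro t ht
    have h1 := (Finset.mem_filter.1 ht).2
    rw [Finset.mem_Ico, ← h1]
    exact ⟨Nat.div_mul_le_self t h, Nat.lt_div_mul_add hh⟩
  refine (Finset.card_le_card hsub).trans ?_
  simp

/-- About `n / h` cells fail with probability of order `h^(1-Q)` each, where `Q = q/(M+1)`; for `h ≥
η n b` the total `n h^(-Q)` is at most a multiple of a power of `b⁻¹ / n^(1 - (M+1)/q)`. The
bandwidth condition enters here. -/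
lemma div_mul_rpow_le {M q η n b h : ℝ} (hM : 0 ≤ M) (hq : 0 < q) (hη : 0 < η) (hn : 0 < n)
    (hb : 0 < b) (hh : 0 < h) (hle : η * (n * b) ≤ h) :
    n / h * h ^ (1 - q / (M + 1)) ≤
      η ^ (-(q / (M + 1))) * ((b⁻¹ / n ^ (1 - (M + 1) / q)) ^ (q / (M + 1))) := by
  set Q := q / (M + 1) with hQdef
  have hM1 : 0 < M + 1 := by linarith
  have hQ : 0 < Q := by positivity
  have e1 : n / h * h ^ (1 - Q) = n * h ^ (-Q) := by
    rw [sub_eq_add_neg, Real.rpow_add hh, Real.rpow_one]; field_simp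
  have e2 : η ^ (-Q) * ((b⁻¹ / n ^ (1 - (M + 1) / q)) ^ Q) = n * (η * (n * b)) ^ (-Q) := by
    have hMq : (1 - (M + 1) / q) * Q = Q - 1 := by
      rw [hQdef]; field_simp
    rw [Real.div_rpow (by positivity) (by positivity), ← Real.rpow_mul hn.le, hMq,
      Real.mul_rpow hη.le (by positivity), Real.mul_rpow hn.le hb.le,
      Real.inv_rpow hb.le, Real.rpow_sub hn, Real.rpow_one, Real.rpow_neg hn.le,
      Real.rpow_neg hb.le]
    field_simp
  rw [e1, e2]
  gcongr ?_ * ?_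
  exact Real.rpow_le_rpow_of_nonpos (by positivity) hle (by linarith)

namespace Setup

variable {A c α : ℝ} {M C : ℝ} {g : (Fin (p + 1) → ℝ) → ℝ} {K V : ℝ → ℝ} {B : ℝ} {b : ℕ → ℝ}

/-- The bias of the local averages. -/
lemma unifTendsto_bias (hS : Setup μ ε F q χ C₁ Xt X A c α) (hq : M + 1 ≤ q)
    (hg : ClassL univ M C g) (hC : 0 ≤ C) (hK : IsBVKernel K V B) (hb : IsBandwidth b)
    {U : ℕ → Set ℝ} (hU : ∀ᶠ n in atTop, U n ⊆ Icc (b n / 2) (1 - b n / 2)) :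
    UnifTendsto μ U (fun n u _ =>
      localAvg p K n (b n) u (fun t => ∫ ω, g (lags (p + 1) (fun s => X n s ω) t) ∂μ) -
        ∫ ω, g (lags (p + 1) (fun s => Xt s u ω) 0) ∂μ) := by
  have hm := hS.model
  have hR := hm.bound_nonneg
  have hA := hS.const_nonneg
  set Λ := lipConst (p + 1) M C (Model.bound χ C₁) with hΛdef
  have hΛ : 0 ≤ Λ := lipConst_nonneg hC hR
  set L₀ := |g 0| + Λ * Model.bound χ C₁ with hL₀
  have hL₀0 : 0 ≤ L₀ := by positivity
  have hB := hK.bound_nonneg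
  have h1 := hb.tendsto_rate (c + p) (2 * B * (Λ * A)) hS.exponent_pos
  have h2 := (tendsto_const_nhds (x := L₀ * (B * (p + 1)))).div_atTop hb.tendsto_mul
  refine UnifTendsto.of_bound (by simpa using h1.add h2) ?_
  filter_upwards [hU, hb.eventually_pos 1] with n hUn ⟨hn, hm1⟩ u hu ω
  obtain ⟨hu1, hu2⟩ := hUn hu
  have hb0 := (hb.mem n).1
  have hn' : (0 : ℝ) < n := by exact_mod_cast hn
  have huI : u ∈ Icc (0 : ℝ) 1 := ⟨by linarith, by linarith⟩
  set m := (n : ℝ) * b n with hmdef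
  have hm0 : 0 < m := by positivity
  set L := ∫ ω, g (lags (p + 1) (fun s => Xt s u ω) 0) ∂μ with hL
  have hLle : |L| ≤ L₀ :=
    abs_integral_le_integral_abs.trans (hS.integrable_Xt hq hg hC huI 0).2
  rw [localAvg_eq p K hn hb0]
  set k : ℕ → ℝ := fun t => K (((t : ℝ) - n * u) / m) with hk
  -- The first term compares the process with the stationary one inside the window, the second the
  -- kernel weights with total mass one.
  have e : 1 / m * ∑ t ∈ Finset.Icc (p + 1) n, k t *
      ∫ ω, g (lags (p + 1) (fun s => X n s ω) t) ∂μ - L =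
      1 / m * ∑ t ∈ Finset.Icc (p + 1) n, k t *
        (∫ ω, g (lags (p + 1) (fun s => X n s ω) t) ∂μ - L) +
      L * ((∑ t ∈ Finset.Icc (p + 1) n, k t - m) / m) := by
    simp only [mul_sub, Finset.sum_sub_distrib, ← Finset.sum_mul]
    field_simp
    ring
  rw [e]
  refine (abs_add_le _ _).trans (add_le_add ?_ ?_)
  · have hterm : ∀ t ∈ Finset.Icc (p + 1) n,
        |k t * (∫ ω, g (lags (p + 1) (fun s => X n s ω) t) ∂μ - L)| ≤
          |k t| * (Λ * (A * (b n / 2 + (c + p) / n) ^ α)) := by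
      intro t ht
      rw [abs_mul]
      rcases eq_or_ne (k t) 0 with h0 | h0
      · simp [h0]
      have htn : t ≤ n := (Finset.mem_Icc.1 ht).2
      refine mul_le_mul_of_nonneg_left ?_ (abs_nonneg _)
      refine (hS.abs_integral_sub_le hq hg hC (by exact_mod_cast htn) huI).trans ?_
      rw [path_eq_div htn]
      have := hK.div_sub_abs_le hn hb0 h0
      have hc := hS.shift_nonneg
      have := hS.exponent_pos
      gcongr
    rw [abs_mul, abs_of_pos (by positivity)]
    calc 1 / m * |∑ t ∈ Finset.Icc (p + 1) n, k t *
          (∫ ω, g (lags (p + 1) (fun s => X n s ω) t) ∂μ - L)|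
        ≤ 1 / m * ∑ t ∈ Finset.Icc (p + 1) n, |k t| * (Λ * (A * (b n / 2 + (c + p) / n) ^ α)) := by
          gcongr
          exact (Finset.abs_sum_le_sum_abs _ _).trans (Finset.sum_le_sum hterm)
      _ = (1 / m * ∑ t ∈ Finset.Icc (p + 1) n, |k t|) *
          (Λ * (A * (b n / 2 + (c + p) / n) ^ α)) := by rw [← Finset.sum_mul]; ring
      _ ≤ (2 * B) * (Λ * (A * (b n / 2 + (c + p) / n) ^ α)) := by
          have hc := hS.shift_nonneg
          refine mul_le_mul_of_nonneg_right (hK.sum_abs_div_le hm1 _ _) (by positivity)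
      _ = _ := by ring
  · have h3 := hK.abs_sum_sub_le hm0 (x := n * u) (n := n) p (by rw [hmdef]; nlinarith)
      (by rw [hmdef]; nlinarith)
    rw [abs_mul, abs_div, abs_of_pos hm0, mul_div_assoc]
    gcongr

set_option maxHeartbeats 600000 in
/-- Uniform law of large numbers for local averages. -/
lemma unifTendsto_centered (hS : Setup μ ε F q χ C₁ Xt X A c α) (hq : M + 1 < q)
    (hg : ClassL univ M C g) (hC : 0 ≤ C) (hK : IsBVKernel K V B) (hb : IsBandwidth b)
    (hbo : (fun n : ℕ => (b n)⁻¹) =o[atTop] (fun n : ℕ => (n : ℝ) ^ (1 - (M + 1) / q)))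
    (U : ℕ → Set ℝ) :
    UnifTendsto μ U (fun n u ω => localAvg p K n (b n) u (fun t =>
      g (lags (p + 1) (fun s => X n s ω) t) -
        ∫ ω, g (lags (p + 1) (fun s => X n s ω) t) ∂μ)) := by
  have hm := hS.model
  have hM := hg.1
  have hR := hm.bound_nonneg
  have hB := hK.bound_nonneg
  set L₀ := |g 0| + lipConst (p + 1) M C (Model.bound χ C₁) * Model.bound χ C₁ with hL₀
  have hL₀0 : 0 ≤ L₀ := by
    have := mul_nonneg (lipConst_nonneg (r := p + 1) (M := M) hC hR) hR
    positivity
  set Q := q / (M + 1) with hQdef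
  have hQ1 : 1 < Q := by rw [hQdef, one_lt_div (by linarith)]; exact hq
  refine UnifTendsto.of_eventually_le fun δ hδ => ?_
  -- In a good cell the absolute centred values sum to at most `D h`. The constants `δ'` and `η`
  -- make each of the two errors in `abs_sum_mul_le` at most `δ m / 4`.
  set D := 1 + 2 * L₀ with hD
  have hD0 : 0 < D := by positivity
  set δ' := min 1 (δ / (12 * (B + 1))) with hδ'
  have hδ'0 : 0 < δ' := lt_min one_pos (by positivity)
  have hδ'1 : δ' ≤ 1 := min_le_left _ _
  have hδ'2 : 3 * B * δ' ≤ δ / 4 := by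
    have h1 : δ' ≤ δ / (12 * (B + 1)) := min_le_right _ _
    rw [le_div_iff₀ (by positivity)] at h1
    nlinarith
  set η := min 1 (δ / (8 * (B + 1) * D)) with hη
  have hη0 : 0 < η := lt_min one_pos (by positivity)
  have hη1 : η ≤ 1 := min_le_left _ _
  have hη2 : 2 * B * D * η ≤ δ / 4 := by
    have h1 : η ≤ δ / (8 * (B + 1) * D) := min_le_right _ _
    rw [le_div_iff₀ (by positivity)] at h1
    have := mul_pos hη0 hD0
    nlinarith
  obtain ⟨Ca, hCa⟩ := hS.exists_deviation_bound hq hg hC hδ'0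
  -- Deviations of `|g|` are needed as well, to control absolute sums in a cell.
  obtain ⟨Cb, hCb⟩ := hS.exists_deviation_bound hq hg.abs hC hδ'0
  set C' := |Ca| + |Cb| with hC'
  set a : ℕ → ℝ := fun n => C' * (η ^ (-Q) * (((b n)⁻¹ / (n : ℝ) ^ (1 - (M + 1) / q)) ^ Q) +
    (η * (n * b n)) ^ (1 - Q)) with ha
  refine ⟨fun n => ENNReal.ofReal (a n), ?_, ?_⟩
  · have h1 := (hbo.tendsto_div_nhds_zero).rpow_const (p := Q) (Or.inr (by linarith))
    rw [Real.zero_rpow (by linarith)] at h1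
    have h2 : Tendsto (fun n : ℕ => (η * (n * b n)) ^ (1 - Q)) atTop (𝓝 0) := by
      have := (tendsto_rpow_neg_atTop (y := Q - 1) (by linarith)).comp
        (hb.tendsto_mul.const_mul_atTop hη0)
      refine this.congr fun n => ?_
      simp
    have h3 := ((h1.const_mul (η ^ (-Q))).add h2).const_mul C'
    simp only [mul_zero, add_zero] at h3
    have := ENNReal.tendsto_ofReal h3
    simpa using this
  -- This ensures `η m ≥ 1`, so that rounding up at most doubles the cell length.
  filter_upwards [hb.eventually_pos (1 / η)] with n ⟨hn, hmη⟩
  have hb0 := (hb.mem n).1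
  have hn' : (0 : ℝ) < n := by exact_mod_cast hn
  set m := (n : ℝ) * b n with hmdef
  have hm0 : 0 < m := by positivity
  have hηm : 1 ≤ η * m := by rw [div_le_iff₀' hη0] at hmη; exact hmη
  set h := ⌈η * m⌉₊ with hh
  have hh0 : 0 < h := Nat.ceil_pos.2 (by positivity)
  have hhle : η * m ≤ h := Nat.le_ceil _
  have hhge : (h : ℝ) ≤ 2 * (η * m) := by
    have := Nat.ceil_lt_add_one (by positivity : 0 ≤ η * m)
    linarith
  have hhr : (0 : ℝ) < h := by exact_mod_cast hh0
  set S := Finset.Icc (p + 1) n with hSdef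
  set J := n / h + 1 with hJ
  set cell : ℕ → Finset ℕ := fun j => S.filter fun t => t / h = j with hcell
  set bad : ((Fin (p + 1) → ℝ) → ℝ) → ℕ → Set Ω := fun f j =>
    {ω | δ' * h ≤ |∑ t ∈ cell j, (f (lags (p + 1) (fun s => X n s ω) (t : ℤ)) -
        ∫ ω', f (lags (p + 1) (fun s => X n s ω') (t : ℤ)) ∂μ)|} with hbad
  have hprob : ∀ (f : (Fin (p + 1) → ℝ) → ℝ) (Cf : ℝ), (∀ (n : ℕ) (S : Finset ℤ) (h : ℕ),
      0 < h → S.card ≤ h → (∀ t ∈ S, t ≤ (n : ℤ)) →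
      μ.real {ω | δ' * h ≤ |∑ t ∈ S, (f (lags (p + 1) (fun s => X n s ω) t) -
        ∫ ω', f (lags (p + 1) (fun s => X n s ω') t) ∂μ)|} ≤ Cf * (h : ℝ) ^ (1 - Q)) →
      ∀ j, μ.real (bad f j) ≤ |Cf| * (h : ℝ) ^ (1 - Q) := by
    intro f Cf hf j
    have h1 := hf n ((cell j).map Nat.castEmbedding) h hh0
      (by rw [Finset.card_map]; exact card_cell_le S hh0 j) (by
        intro t ht
        obtain ⟨t', ht', rfl⟩ := Finset.mem_map.1 ht
        have := (Finset.mem_Icc.1 (Finset.mem_filter.1 ht').1).2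
        simpa using this)
    simp only [Finset.sum_map, Nat.castEmbedding_apply] at h1
    refine h1.trans ?_
    gcongr
    exact le_abs_self _
  have hbadprob : μ.real (⋃ j ∈ Finset.range J, (bad g j ∪ bad (fun z => |g z|) j)) ≤ a n := by
    refine (measureReal_biUnion_finset_le _ _).trans ((Finset.sum_le_sum
      (g := fun _ => C' * (h : ℝ) ^ (1 - Q)) fun j _ => ?_).trans ?_)
    · refine (measureReal_union_le _ _).trans ?_
      have h1 := hprob g Ca hCa j
      have h2 := hprob (fun z => |g z|) Cb hCb j
      calc _ ≤ |Ca| * (h : ℝ) ^ (1 - Q) + |Cb| * (h : ℝ) ^ (1 - Q) := add_le_add h1 h2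
        _ = C' * (h : ℝ) ^ (1 - Q) := by rw [hC']; ring
    · rw [Finset.sum_const, Finset.card_range, nsmul_eq_mul]
      have hJle : (J : ℝ) ≤ n / h + 1 := by
        rw [hJ]; push_cast
        gcongr
        exact Nat.cast_div_le
      have hpos : 0 ≤ (h : ℝ) ^ (1 - Q) := by positivity
      have hC'0 : 0 ≤ C' := by positivity
      have hlast : (h : ℝ) ^ (1 - Q) ≤ (η * m) ^ (1 - Q) :=
        Real.rpow_le_rpow_of_nonpos (by positivity) hhle (by linarith)
      have hfirst := div_mul_rpow_le (n := n) hM (by linarith : 0 < q) hη0 hn' hb0 hhr hhle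
      calc (J : ℝ) * (C' * (h : ℝ) ^ (1 - Q)) ≤ (n / h + 1) * (C' * (h : ℝ) ^ (1 - Q)) := by gcongr
        _ = C' * (n / h * (h : ℝ) ^ (1 - Q) + (h : ℝ) ^ (1 - Q)) := by ring
        _ ≤ a n := by
            simp only [ha]
            gcongr
  -- The bad event on the right does not involve `u`: outside it all locations are controlled at
  -- once.
  have hsub : {ω | ∃ u ∈ U n, δ ≤ |localAvg p K n (b n) u (fun t =>
      g (lags (p + 1) (fun s => X n s ω) t) -
        ∫ ω, g (lags (p + 1) (fun s => X n s ω) t) ∂μ)|} ⊆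
      ⋃ j ∈ Finset.range J, (bad g j ∪ bad (fun z => |g z|) j) := by
    rintro ω ⟨u, hu, hle⟩
    by_contra hcon
    simp only [hbad, mem_iUnion, mem_union, mem_ofPred_eq, not_exists, not_or, not_le,
      Finset.mem_range] at hcon
    set ξ : ℕ → ℝ := fun t => g (lags (p + 1) (fun s => X n s ω) t) with hξ
    set Eξ : ℕ → ℝ := fun t => ∫ ω, g (lags (p + 1) (fun s => X n s ω) t) ∂μ with hEξ
    set Ea : ℕ → ℝ := fun t => ∫ ω, |g (lags (p + 1) (fun s => X n s ω) t)| ∂μ with hEa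
    have hEale : ∀ t ∈ S, Ea t ≤ L₀ := fun t ht =>
      (hS.integrable_X hq.le hg hC (by exact_mod_cast (Finset.mem_Icc.1 ht).2)).2
    have hEξle : ∀ t ∈ S, |Eξ t| ≤ L₀ := fun t ht =>
      abs_integral_le_integral_abs.trans (hEale t ht)
    have hcellsum := hK.abs_sum_mul_le (n * u) hm0 hh0 S (J := J) (fun t ht => by
        rw [hJ]
        exact Nat.lt_succ_of_le (Nat.div_le_div_right (Finset.mem_Icc.1 ht).2))
      (fun t => ξ t - Eξ t) hδ'0.le hD0.le (fun j hj => (hcon j hj).1.le) (by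
        intro j hj
        have h2 := (abs_lt.1 (hcon j hj).2).2
        have hcard : ((cell j).card : ℝ) ≤ h := by exact_mod_cast card_cell_le S hh0 j
        -- Bounding by the centred `|ξ|` plus `2 L₀` reduces absolute sums to the deviations of
        -- `|g|`, which are at most `δ' h ≤ h` here.
        have h3 : ∑ t ∈ cell j, |ξ t - Eξ t| ≤ ∑ t ∈ cell j, ((|ξ t| - Ea t) + 2 * L₀) := by
          refine Finset.sum_le_sum fun t ht => ?_
          have ht' : t ∈ S := (Finset.mem_filter.1 ht).1
          have := abs_sub (ξ t) (Eξ t)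
          linarith [hEale t ht', hEξle t ht']
        rw [Finset.sum_add_distrib, Finset.sum_const, nsmul_eq_mul] at h3
        have h4 : (cell j).card * (2 * L₀) ≤ h * (2 * L₀) := by gcongr
        have h5 : ∑ t ∈ cell j, (|ξ t| - Ea t) ≤ h := by nlinarith
        rw [hD]
        linarith)
    rw [localAvg_eq p K hn hb0, abs_mul, abs_of_pos (by positivity), one_div_mul_eq_div,
      le_div_iff₀ hm0] at hle
    have h6 : B * δ' * (m + h) + B * D * h ≤ δ / 2 * m := by
      have h7 : B * δ' * (m + h) ≤ B * δ' * (3 * m) := by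
        gcongr
        nlinarith
      have h8 : B * D * h ≤ B * D * (2 * (η * m)) := by gcongr
      nlinarith
    have h9 : δ * m ≤ δ / 2 * m := hle.trans (hcellsum.trans h6)
    nlinarith
  refine (measure_mono hsub).trans ?_
  rw [← ENNReal.ofReal_toReal (measure_ne_top μ _)]
  exact ENNReal.ofReal_le_ofReal hbadprob

end Setup

end LocStat

end

/-! ### Law of large numbers at a fixed location, with first moments only -/

noncomputable section


namespace LocStat

variable {Ω : Type*} [mΩ : MeasurableSpace Ω] {μ : Measure Ω} [IsProbabilityMeasure μ]
  {p : ℕ} {ε : ℤ → Ω → ℝ} {F : ℝ → (Fin p → ℝ) → ℝ → ℝ}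
  {q : ℝ} {χ : Fin p → ℝ} {C₁ : ℝ} {Xt : ℤ → ℝ → Ω → ℝ} {X : ℕ → ℤ → Ω → ℝ}

/-- Variance bound for weighted sums of bounded centred `D`-dependent variables. -/
lemma integral_sq_weighted_sum_le (hε : IsIIDInnovations μ ε) {D : ℕ} {ζ : ℤ → Ω → ℝ}
    (hζ : ∀ t, Measurable[sigmaOn ε (Ioc (t - D) t)] (ζ t)) {τ : ℝ} (hτ : ∀ t ω, |ζ t ω| ≤ τ)
    (hζ0 : ∀ t, ∫ ω, ζ t ω ∂μ = 0)
    (S : Finset ℕ) (w : ℕ → ℝ) {W w₀ : ℝ} (hw₀ : 0 ≤ w₀) (hW : ∑ t ∈ S, |w t| ≤ W)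
    (hw : ∀ t ∈ S, |w t| ≤ w₀) :
    Integrable (fun ω => (∑ t ∈ S, w t * ζ t ω) ^ 2) μ ∧
    ∫ ω, (∑ t ∈ S, w t * ζ t ω) ^ 2 ∂μ ≤ 2 * D * τ ^ 2 * W * w₀ := by
  have hmeas : ∀ t, Measurable (ζ t) := fun t => (hζ t).mono (hε.sigmaOn_le _) le_rfl
  have hprod : ∀ s t ω, ‖ζ s ω * ζ t ω‖ ≤ τ ^ 2 := by
    intro s t ω
    rw [Real.norm_eq_abs, abs_mul, sq]
    exact mul_le_mul (hτ s ω) (hτ t ω) (abs_nonneg _) ((abs_nonneg _).trans (hτ s ω))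
  have hint : ∀ s t, Integrable (fun ω => ζ s ω * ζ t ω) μ := fun s t =>
    Integrable.of_bound ((hmeas s).mul (hmeas t)).aestronglyMeasurable _
      (Eventually.of_forall (hprod s t))
  have hexp : (fun ω => (∑ t ∈ S, w t * ζ t ω) ^ 2) =
      fun ω => ∑ s ∈ S, ∑ t ∈ S, w s * w t * (ζ s ω * ζ t ω) := by
    funext ω
    rw [sq, Finset.sum_mul_sum]
    refine Finset.sum_congr rfl fun s _ => Finset.sum_congr rfl fun t _ => by ring
  have hint' : ∀ s ∈ S, ∀ t ∈ S, Integrable (fun ω => w s * w t * (ζ s ω * ζ t ω)) μ :=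
    fun s _ t _ => (hint s t).const_mul _
  refine ⟨hexp ▸ integrable_finsetSum _ fun s hs => integrable_finsetSum _ (hint' s hs), ?_⟩
  -- Two windows of length `D` overlap only if `|s - t| < D`. Truncated subtraction in `s + 1 - D`
  -- is harmless because `t` is natural.
  have hcov : ∀ s t : ℕ, |∫ ω, ζ s ω * ζ t ω ∂μ| ≤
      if t ∈ Finset.Ico (s + 1 - D) (s + D) then τ ^ 2 else 0 := by
    intro s t
    split_ifs with h
    · simpa using norm_integral_le_of_norm_le_const (μ := μ) (Eventually.of_forall (hprod s t))
    · have hind : IndepFun (ζ s) (ζ t) μ := by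
        rw [Finset.mem_Ico, not_and_or] at h
        rcases h with h | h
        · exact (hε.indepFun_of_le hζ (s := t) (t := s) (by omega)).symm
        · exact hε.indepFun_of_le hζ (by omega)
      rw [hind.integral_fun_mul_eq_mul_integral (hmeas s).aestronglyMeasurable
        (hmeas t).aestronglyMeasurable, hζ0, zero_mul, abs_zero]
  rw [hexp, integral_finsetSum _ fun s hs => integrable_finsetSum _ (hint' s hs)]
  have hterm : ∀ s ∈ S, ∫ ω, ∑ t ∈ S, w s * w t * (ζ s ω * ζ t ω) ∂μ ≤
      |w s| * (w₀ * (2 * D * τ ^ 2)) := by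
    intro s hs
    rw [integral_finsetSum _ (hint' s hs)]
    calc ∑ t ∈ S, ∫ ω, w s * w t * (ζ s ω * ζ t ω) ∂μ
        ≤ ∑ t ∈ S, |w s| * (w₀ * if t ∈ Finset.Ico (s + 1 - D) (s + D) then τ ^ 2 else 0) := by
          refine Finset.sum_le_sum fun t ht => ?_
          rw [integral_const_mul]
          refine (le_abs_self _).trans ?_
          rw [abs_mul, abs_mul, mul_assoc]
          gcongr
          exacts [hw t ht, hcov s t]
      _ = |w s| * (w₀ * ∑ t ∈ S, if t ∈ Finset.Ico (s + 1 - D) (s + D) then τ ^ 2 else 0) := by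
          simp only [Finset.mul_sum]
      _ ≤ |w s| * (w₀ * (2 * D * τ ^ 2)) := by
          gcongr
          rw [← Finset.sum_filter, Finset.sum_const, nsmul_eq_mul]
          gcongr
          have h1 : (S.filter fun t => t ∈ Finset.Ico (s + 1 - D) (s + D)).card ≤ 2 * D := by
            refine (Finset.card_le_card (t := Finset.Ico (s + 1 - D) (s + D)) fun t ht =>
              (Finset.mem_filter.1 ht).2).trans ?_
            rw [Nat.card_Ico]; omega
          exact_mod_cast h1
  refine (Finset.sum_le_sum hterm).trans ?_
  rw [← Finset.sum_mul]
  calc _ ≤ W * (w₀ * (2 * D * τ ^ 2)) := by gcongr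
    _ = _ := by ring

/-- First absolute moment of a weighted sum of variables which are close to bounded
`D`-dependent ones. -/
lemma integral_abs_weighted_sum_le (hε : IsIIDInnovations μ ε) {D : ℕ} {ξ ζ : ℤ → Ω → ℝ}
    (hζ : ∀ t, Measurable[sigmaOn ε (Ioc (t - D) t)] (ζ t)) {τ : ℝ} (hτ : ∀ t ω, |ζ t ω| ≤ τ)
    (hξ : ∀ t, Integrable (ξ t) μ) {κ : ℝ} (hκ : 0 < κ)
    (hclose : ∀ t, ∫ ω, |ξ t ω - ζ t ω| ∂μ ≤ κ)
    (S : Finset ℕ) (w : ℕ → ℝ) {W w₀ : ℝ} (hw₀ : 0 ≤ w₀) (hW : ∑ t ∈ S, |w t| ≤ W)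
    (hw : ∀ t ∈ S, |w t| ≤ w₀) :
    ∫ ω, |∑ t ∈ S, w t * (ξ t ω - ∫ ω', ξ t ω' ∂μ)| ∂μ ≤
      κ * (2 * W + 1) + 8 * D * τ ^ 2 / κ * W * w₀ := by
  have hmeas : ∀ t, Measurable (ζ t) := fun t => (hζ t).mono (hε.sigmaOn_le _) le_rfl
  have hζi : ∀ t, Integrable (ζ t) μ := fun t =>
    Integrable.of_bound (hmeas t).aestronglyMeasurable τ (Eventually.of_forall (hτ t))
  have hE : ∀ t, |∫ ω, ζ t ω ∂μ| ≤ τ := fun t => by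
    simpa using norm_integral_le_of_norm_le_const (μ := μ) (f := ζ t) (C := τ)
      (Eventually.of_forall (hτ t))
  set Y : Ω → ℝ := fun ω => ∑ t ∈ S, w t * (ζ t ω - ∫ ω', ζ t ω' ∂μ) with hY
  obtain ⟨hYi, hYle⟩ := integral_sq_weighted_sum_le (μ := μ) hε (D := D) (τ := 2 * τ)
    (ζ := fun t ω => ζ t ω - ∫ ω', ζ t ω' ∂μ) (fun t => (hζ t).sub_const _)
    (fun t ω => (abs_sub _ _).trans (by linarith [hτ t ω, hE t]))
    (fun t => by rw [integral_sub (hζi t) (integrable_const _)]; simp) S w hw₀ hW hw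
  have hdi : ∀ t, Integrable (fun ω => ξ t ω - ζ t ω) μ := fun t => (hξ t).sub (hζi t)
  have hpt : ∀ ω, |∑ t ∈ S, w t * (ξ t ω - ∫ ω', ξ t ω' ∂μ)| ≤
      (∑ t ∈ S, |w t| * (|ξ t ω - ζ t ω| + κ)) + (κ + 1 / κ * Y ω ^ 2) := by
    intro ω
    have e : ∑ t ∈ S, w t * (ξ t ω - ∫ ω', ξ t ω' ∂μ) =
        (∑ t ∈ S, w t * ((ξ t ω - ζ t ω) - ∫ ω', (ξ t ω' - ζ t ω') ∂μ)) + Y ω := by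
      rw [hY, ← Finset.sum_add_distrib]
      refine Finset.sum_congr rfl fun t _ => ?_
      rw [integral_sub (hξ t) (hζi t)]; ring
    rw [e]
    refine (abs_add_le _ _).trans (add_le_add ?_ ?_)
    · refine (Finset.abs_sum_le_sum_abs _ _).trans (Finset.sum_le_sum fun t _ => ?_)
      rw [abs_mul]
      gcongr
      refine (abs_sub _ _).trans ?_
      gcongr
      exact abs_integral_le_integral_abs.trans (hclose t)
    -- `|Y| ≤ κ + Y² / κ` turns the variance bound into one for the first moment.
    · have h1 : |Y ω| * κ ≤ κ ^ 2 + |Y ω| ^ 2 := by nlinarith [sq_nonneg (|Y ω| - κ), abs_nonneg (Y ω)]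
      rw [sq_abs] at h1
      have e2 : κ + 1 / κ * Y ω ^ 2 = (κ ^ 2 + Y ω ^ 2) / κ := by field_simp
      rwa [e2, le_div_iff₀ hκ]
  have i1 : ∀ t ∈ S, Integrable (fun ω => |w t| * (|ξ t ω - ζ t ω| + κ)) μ := fun t _ =>
    ((hdi t).abs.add (integrable_const κ)).const_mul _
  have i2 : Integrable (fun ω => κ + 1 / κ * Y ω ^ 2) μ :=
    (integrable_const κ).add (hYi.const_mul _)
  have i0 : ∀ t ∈ S, Integrable (fun ω => w t * (ξ t ω - ∫ ω', ξ t ω' ∂μ)) μ := fun t _ =>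
    ((hξ t).sub (integrable_const _)).const_mul _
  have i3 : Integrable (fun ω => |∑ t ∈ S, w t * (ξ t ω - ∫ ω', ξ t ω' ∂μ)|) μ :=
    (integrable_finsetSum _ i0).abs
  refine (integral_mono i3 ((integrable_finsetSum _ i1).add i2) hpt).trans ?_
  have e1 : ∫ ω, ((∑ t ∈ S, |w t| * (|ξ t ω - ζ t ω| + κ)) + (κ + 1 / κ * Y ω ^ 2)) ∂μ =
      (∑ t ∈ S, |w t| * (∫ ω, |ξ t ω - ζ t ω| ∂μ + κ)) + (κ + 1 / κ * ∫ ω, Y ω ^ 2 ∂μ) := by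
    rw [integral_add (integrable_finsetSum _ i1) i2, integral_finsetSum _ i1,
      integral_add (integrable_const κ) (hYi.const_mul _), integral_const_mul]
    congr 1
    · refine Finset.sum_congr rfl fun t _ => ?_
      rw [integral_const_mul, integral_add (hdi t).abs (integrable_const κ)]
      simp
    · simp [hY]
  have h2 : ∑ t ∈ S, |w t| * (∫ ω, |ξ t ω - ζ t ω| ∂μ + κ) ≤ W * (κ + κ) := by
    calc _ ≤ ∑ t ∈ S, |w t| * (κ + κ) := by
          refine Finset.sum_le_sum fun t _ => ?_
          gcongr
          exact hclose t
      _ ≤ W * (κ + κ) := by rw [← Finset.sum_mul]; gcongr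
  have h3 : 1 / κ * ∫ ω, Y ω ^ 2 ∂μ ≤ 1 / κ * (2 * D * (2 * τ) ^ 2 * W * w₀) := by gcongr
  calc _ ≤ W * (κ + κ) + (κ + 1 / κ * (2 * D * (2 * τ) ^ 2 * W * w₀)) := by
        refine e1.le.trans ?_
        gcongr
    _ = _ := by field_simp; ring

/-- Truncation at level `τ`. -/
def trunc (τ x : ℝ) : ℝ := max (-τ) (min x τ)

lemma abs_trunc_le {τ : ℝ} (hτ : 0 ≤ τ) (x : ℝ) : |trunc τ x| ≤ τ :=
  abs_le.2 ⟨le_max_left _ _, max_le (by linarith) (min_le_right _ _)⟩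

lemma continuous_trunc (τ : ℝ) : Continuous (trunc τ) := by
  unfold trunc; fun_prop

lemma abs_trunc_sub_le (τ x y : ℝ) : |trunc τ x - trunc τ y| ≤ |x - y| := by
  unfold trunc
  rw [max_comm (-τ), max_comm (-τ)]
  refine (abs_max_sub_max_le_abs _ _ _).trans ?_
  refine (abs_min_sub_min_le_max x τ y τ).trans ?_
  simp

lemma trunc_eq {τ x : ℝ} (h : |x| ≤ τ) : trunc τ x = x := by
  rw [trunc, min_eq_left (abs_le.1 h).2, max_eq_right (abs_le.1 h).1]

lemma trunc_zero {τ : ℝ} (hτ : 0 ≤ τ) : trunc τ 0 = 0 := trunc_eq (by simpa)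

/-- Dominated convergence. At the critical exponent only integrability is available, so the level
`τ` comes without a rate. -/
lemma exists_integral_sub_trunc_le {f : Ω → ℝ} (hf : Integrable f μ) {κ : ℝ} (hκ : 0 < κ) :
    ∃ τ : ℝ, 0 ≤ τ ∧ ∫ ω, |f ω - trunc τ (f ω)| ∂μ ≤ κ := by
  have h : Tendsto (fun k : ℕ => ∫ ω, |f ω - trunc k (f ω)| ∂μ) atTop (𝓝 (∫ _, (0 : ℝ) ∂μ)) := by
    refine tendsto_integral_of_dominated_convergence (fun ω => 2 * |f ω|) (fun k => ?_)
      (hf.abs.const_mul 2) (fun k => ?_) ?_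
    · exact (hf.aestronglyMeasurable.sub
        ((continuous_trunc k).comp_aestronglyMeasurable hf.aestronglyMeasurable)).norm
    · refine Eventually.of_forall fun ω => ?_
      have h1 := abs_trunc_sub_le k (f ω) 0
      rw [trunc_zero k.cast_nonneg, sub_zero, sub_zero] at h1
      rw [Real.norm_eq_abs, abs_abs]
      linarith [abs_sub (f ω) (trunc k (f ω))]
    · refine Eventually.of_forall fun ω => ?_
      obtain ⟨N, hN⟩ := exists_nat_ge |f ω|
      refine tendsto_const_nhds.congr' ?_
      filter_upwards [eventually_ge_atTop N] with k hk
      rw [trunc_eq (hN.trans (by exact_mod_cast hk))]; simp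
  rw [integral_zero] at h
  obtain ⟨k, hk⟩ := (h.eventually_le_const hκ).exists
  exact ⟨k, k.cast_nonneg, hk⟩

namespace Setup

variable {A c α : ℝ} {M C : ℝ} {g : (Fin (p + 1) → ℝ) → ℝ} {K V : ℝ → ℝ} {B : ℝ} {b : ℕ → ℝ}

/-- Weighted sums of `g` along the stationary approximation. -/
lemma exists_integral_abs_weighted_sum_le (hS : Setup μ ε F q χ C₁ Xt X A c α) (hq : M + 1 ≤ q)
    (hg : ClassL univ M C g) (hC : 0 ≤ C) {u : ℝ} (hu : u ∈ Icc (0 : ℝ) 1) {κ : ℝ} (hκ : 0 < κ) :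
    ∃ Cκ : ℝ, ∀ (S : Finset ℕ) (w : ℕ → ℝ) (W w₀ : ℝ), 0 ≤ w₀ → ∑ t ∈ S, |w t| ≤ W →
      (∀ t ∈ S, |w t| ≤ w₀) →
      ∫ ω, |∑ t ∈ S, w t * (g (lags (p + 1) (fun s => Xt s u ω) t) -
        ∫ ω', g (lags (p + 1) (fun s => Xt s u ω') t) ∂μ)| ∂μ ≤ κ * (2 * W + 1) + Cκ * W * w₀ := by
  have hm := hS.model
  have hR := hm.bound_nonneg
  have hΛ := lipConst_nonneg (r := p + 1) (M := M) hC hR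
  set ξ : ℤ → Ω → ℝ := fun t ω => g (lags (p + 1) (fun s => Xt s u ω) t) with hξdef
  have hξ : ∀ t, Integrable (ξ t) μ := fun t => (hS.integrable_Xt hq hg hC hu t).1
  obtain ⟨τ, hτ0, hτ⟩ := exists_integral_sub_trunc_le (hξ 0) (half_pos hκ)
  -- By stationarity one truncation level serves all times.
  have hτt : ∀ t, ∫ ω, |ξ t ω - trunc τ (ξ t ω)| ∂μ ≤ κ / 2 := by
    intro t
    refine le_of_eq_of_le ?_ hτ
    have hcont : Continuous fun z => |g z - trunc τ (g z)| :=
      (hg.continuous.sub ((continuous_trunc τ).comp hg.continuous)).abs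
    exact ((hS.stat.identDistrib_lags hm.iid hu (p + 1) t 0).comp hcont.measurable).integral_eq
  -- A fixed Picard depth gives a finite dependence range with `L¹` error `κ / 2`; the truncation
  -- accounts for the other half of `κ`.
  obtain ⟨k, hk⟩ : ∃ k : ℕ, lipConst (p + 1) M C (Model.bound χ C₁) *
      (Model.bound χ C₁ * (∑ i, χ i) ^ k) ≤ κ / 2 := by
    have h1 := ((tendsto_pow_atTop_nhds_zero_of_lt_one hm.sum_nonneg hm.weight_lt).const_mul
      (Model.bound χ C₁)).const_mul (lipConst (p + 1) M C (Model.bound χ C₁))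
    simp only [mul_zero] at h1
    exact (h1.eventually_le_const (half_pos hκ)).exists
  set η : ℤ → Ω → ℝ := fun t ω => g (lags (p + 1) (fun s => picard ε F (fun _ => u) k s ω) t)
    with hηdef
  have hηm : ∀ t, Measurable[sigmaOn ε (Ioc (t - ((k + 1) * (p + 1) : ℕ)) t)] (η t) := fun t =>
    hg.continuous.measurable.comp (hm.measurable_lags_picard (fun _ => hu) k t)
  have hηa : ∀ t, AEStronglyMeasurable (η t) μ := fun t =>
    ((hηm t).mono (hm.iid.sigmaOn_le _) le_rfl).aestronglyMeasurable
  have hξη : ∀ t, Integrable (fun ω => ξ t ω - η t ω) μ ∧ ∫ ω, |ξ t ω - η t ω| ∂μ ≤ κ / 2 := by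
    intro t
    have h1 := hm.nq_class_sub_picard (fun _ => hu) hg hC (hS.stat.isSol hu t)
      (fun s _ => hS.stat.nq_le hm hu s) k (t := t) le_rfl
    exact integrable_of_nq (Model.one_le_exponent hq hg)
      ((hξ t).aestronglyMeasurable.sub (hηa t)) (half_pos hκ).le
      (h1.trans (ENNReal.ofReal_le_ofReal hk))
  refine ⟨8 * ((k + 1) * (p + 1) : ℕ) * τ ^ 2 / κ, fun S w W w₀ hw₀ hW hw => ?_⟩
  refine integral_abs_weighted_sum_le (μ := μ) hm.iid (ξ := ξ) (ζ := fun t ω => trunc τ (η t ω))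
    (fun t => (continuous_trunc τ).measurable.comp (hηm t)) (fun t ω => abs_trunc_le hτ0 _)
    hξ hκ (fun t => ?_) S w hw₀ hW hw
  have i1 : Integrable (fun ω => |ξ t ω - trunc τ (ξ t ω)|) μ := by
    refine ((hξ t).sub ((hξ t).mono ((continuous_trunc τ).comp_aestronglyMeasurable
      (hξ t).aestronglyMeasurable) (Eventually.of_forall fun ω => ?_))).abs
    have h1 := abs_trunc_sub_le τ (ξ t ω) 0
    rwa [trunc_zero hτ0, sub_zero, sub_zero] at h1
  have i2 : Integrable (fun ω => |ξ t ω - η t ω|) μ := (hξη t).1.abs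
  have h2 : ∫ ω, |ξ t ω - trunc τ (η t ω)| ∂μ ≤
      ∫ ω, (|ξ t ω - trunc τ (ξ t ω)| + |ξ t ω - η t ω|) ∂μ := by
    refine integral_mono_of_nonneg (Eventually.of_forall fun _ => abs_nonneg _) (i1.add i2)
      (Eventually.of_forall fun ω => ?_)
    have h3 := abs_sub_le (ξ t ω) (trunc τ (ξ t ω)) (trunc τ (η t ω))
    have h4 := abs_trunc_sub_le τ (ξ t ω) (η t ω)
    show |ξ t ω - trunc τ (η t ω)| ≤ |ξ t ω - trunc τ (ξ t ω)| + |ξ t ω - η t ω|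
    linarith
  rw [integral_add i1 i2] at h2
  linarith [hτt t, (hξη t).2]

/-- Pointwise law of large numbers for local averages. -/
lemma unifTendsto_centered_singleton (hS : Setup μ ε F q χ C₁ Xt X A c α) (hq : M + 1 ≤ q)
    (hg : ClassL univ M C g) (hC : 0 ≤ C) (hK : IsBVKernel K V B) (hb : IsBandwidth b)
    {u : ℝ} (hu : u ∈ Icc (0 : ℝ) 1) :
    UnifTendsto μ (fun _ => {u}) (fun n u ω => localAvg p K n (b n) u (fun t =>
      g (lags (p + 1) (fun s => X n s ω) t) -
        ∫ ω, g (lags (p + 1) (fun s => X n s ω) t) ∂μ)) := by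
  have hB := hK.bound_nonneg
  have hA := hS.const_nonneg
  set Λ := lipConst (p + 1) M C (Model.bound χ C₁) with hΛdef
  have hΛ : 0 ≤ Λ := lipConst_nonneg hC hS.model.bound_nonneg
  set Y : ℕ → Ω → ℝ := fun n ω => localAvg p K n (b n) u (fun t =>
      g (lags (p + 1) (fun s => X n s ω) t) -
        ∫ ω, g (lags (p + 1) (fun s => X n s ω) t) ∂μ) with hY
  set r : ℕ → ℝ := fun n => Λ * A * (b n / 2 + (c + p) / n) ^ α with hr
  -- Within the kernel window the process is replaced by the stationary one at the fixed `u`, at a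
  -- cost of order `r n`. The weights have total mass at most `2B` and single size at most `B / (n
  -- b)`, so the variance term vanishes for each fixed `κ`.
  have hbound : ∀ κ > 0, ∃ Cκ : ℝ, ∀ᶠ n in atTop, Integrable (Y n) μ ∧
      ∫ ω, |Y n ω| ∂μ ≤ 4 * B * r n + (κ * (2 * (2 * B) + 1) + Cκ * (2 * B) * (B / (n * b n))) := by
    intro κ hκ
    obtain ⟨Cκ, hCκ⟩ := hS.exists_integral_abs_weighted_sum_le hq hg hC hu hκ
    refine ⟨Cκ, ?_⟩
    filter_upwards [hb.eventually_pos 1] with n ⟨hn, hm1⟩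
    have hb0 := (hb.mem n).1
    have hn' : (0 : ℝ) < n := by exact_mod_cast hn
    set m := (n : ℝ) * b n with hmdef
    have hm0 : 0 < m := by positivity
    set S := Finset.Icc (p + 1) n with hSdef
    set w : ℕ → ℝ := fun t => 1 / m * K (((t : ℝ) - n * u) / m) with hw
    set ξ : ℕ → Ω → ℝ := fun t ω => g (lags (p + 1) (fun s => X n s ω) t) with hξ
    set ξt : ℕ → Ω → ℝ := fun t ω => g (lags (p + 1) (fun s => Xt s u ω) t) with hξt
    have hξi : ∀ t ∈ S, Integrable (ξ t) μ := fun t ht =>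
      (hS.integrable_X hq hg hC (by exact_mod_cast (Finset.mem_Icc.1 ht).2)).1
    have hξti : ∀ t, Integrable (ξt t) μ := fun t => (hS.integrable_Xt hq hg hC hu t).1
    have hYeq : ∀ ω, Y n ω = ∑ t ∈ S, w t * (ξ t ω - ∫ ω', ξ t ω' ∂μ) := by
      intro ω
      simp only [hY]
      rw [localAvg_eq p K hn hb0, Finset.mul_sum]
      refine Finset.sum_congr rfl fun t _ => by rw [hw, mul_assoc]
    have hwsum : ∑ t ∈ S, |w t| ≤ 2 * B := by
      refine le_of_eq_of_le ?_ (hK.sum_abs_div_le hm1 (n * u) S)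
      rw [Finset.mul_sum]
      refine Finset.sum_congr rfl fun t _ => ?_
      rw [hw, abs_mul, abs_of_pos (by positivity)]
    have hwle : ∀ t ∈ S, |w t| ≤ B / m := by
      intro t _
      rw [hw, abs_mul, abs_of_pos (by positivity), one_div_mul_eq_div]
      gcongr
      exact hK.abs_le _
    have hYi : Integrable (Y n) μ := by
      have : Y n = fun ω => ∑ t ∈ S, w t * (ξ t ω - ∫ ω', ξ t ω' ∂μ) := funext hYeq
      rw [this]
      exact integrable_finsetSum _ fun t ht =>
        ((hξi t ht).sub (integrable_const _)).const_mul _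
    refine ⟨hYi, ?_⟩
    have hd : ∀ t ∈ S, w t ≠ 0 → ∫ ω, |ξ t ω - ξt t ω| ∂μ ≤ r n := by
      intro t ht h0
      have htn : t ≤ n := (Finset.mem_Icc.1 ht).2
      refine (hS.integral_abs_sub_le hq hg hC (by exact_mod_cast htn) hu).trans ?_
      rw [path_eq_div htn, ← mul_assoc]
      simp only [hr]
      have := hK.div_sub_abs_le hn hb0 (right_ne_zero_of_mul h0)
      have hc := hS.shift_nonneg
      have := hS.exponent_pos
      gcongr
    have i1 : ∀ t ∈ S, Integrable (fun ω => |w t| * (|ξ t ω - ξt t ω| + r n)) μ := fun t ht =>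
      ((((hξi t ht).sub (hξti t)).abs).add (integrable_const _)).const_mul _
    have i2 : Integrable (fun ω => |∑ t ∈ S, w t * (ξt t ω - ∫ ω', ξt t ω' ∂μ)|) μ :=
      (integrable_finsetSum _ fun t _ => ((hξti t).sub (integrable_const _)).const_mul _).abs
    have hpt : ∀ ω, |Y n ω| ≤ (∑ t ∈ S, |w t| * (|ξ t ω - ξt t ω| + r n)) +
        |∑ t ∈ S, w t * (ξt t ω - ∫ ω', ξt t ω' ∂μ)| := by
      intro ω
      have e : Y n ω = (∑ t ∈ S, w t * ((ξ t ω - ξt t ω) - ∫ ω', (ξ t ω' - ξt t ω') ∂μ)) +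
          ∑ t ∈ S, w t * (ξt t ω - ∫ ω', ξt t ω' ∂μ) := by
        rw [hYeq, ← Finset.sum_add_distrib]
        refine Finset.sum_congr rfl fun t ht => ?_
        rw [integral_sub (hξi t ht) (hξti t)]; ring
      rw [e]
      refine (abs_add_le _ _).trans (add_le_add ?_ le_rfl)
      refine (Finset.abs_sum_le_sum_abs _ _).trans (Finset.sum_le_sum fun t ht => ?_)
      rw [abs_mul]
      rcases eq_or_ne (w t) 0 with h0 | h0
      · simp [h0]
      gcongr
      refine (abs_sub _ _).trans ?_
      gcongr
      exact abs_integral_le_integral_abs.trans (hd t ht h0)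
    refine (integral_mono hYi.abs ((integrable_finsetSum _ i1).add i2) hpt).trans ?_
    have e1 : ∫ ω, ((∑ t ∈ S, |w t| * (|ξ t ω - ξt t ω| + r n)) +
        |∑ t ∈ S, w t * (ξt t ω - ∫ ω', ξt t ω' ∂μ)|) ∂μ =
        (∑ t ∈ S, |w t| * (∫ ω, |ξ t ω - ξt t ω| ∂μ + r n)) +
        ∫ ω, |∑ t ∈ S, w t * (ξt t ω - ∫ ω', ξt t ω' ∂μ)| ∂μ := by
      rw [integral_add (integrable_finsetSum _ i1) i2, integral_finsetSum _ i1]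
      congr 1
      refine Finset.sum_congr rfl fun t ht => ?_
      have i3 : Integrable (fun ω => |ξ t ω - ξt t ω|) μ := ((hξi t ht).sub (hξti t)).abs
      rw [integral_const_mul, integral_add i3 (integrable_const _)]
      simp
    refine e1.le.trans (add_le_add ?_ (hCκ S w _ _ (by positivity) hwsum hwle))
    calc ∑ t ∈ S, |w t| * (∫ ω, |ξ t ω - ξt t ω| ∂μ + r n) ≤ ∑ t ∈ S, |w t| * (2 * r n) := by
          refine Finset.sum_le_sum fun t ht => ?_
          rcases eq_or_ne (w t) 0 with h0 | h0
          · simp [h0]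
          gcongr
          linarith [hd t ht h0]
      _ ≤ 2 * B * (2 * r n) := by
          have hc := hS.shift_nonneg
          have hr0 : 0 ≤ r n := by simp only [hr]; positivity
          rw [← Finset.sum_mul]; gcongr
      _ = _ := by ring
  have hlim : Tendsto (fun n => ENNReal.ofReal (∫ ω, |Y n ω| ∂μ)) atTop (𝓝 0) := by
    have hr' : Tendsto (fun n : ℕ => 4 * B * r n) atTop (𝓝 0) := by
      simpa using (hb.tendsto_rate (c + p) (Λ * A) hS.exponent_pos).const_mul (4 * B)
    have : Tendsto (fun n => ∫ ω, |Y n ω| ∂μ) atTop (𝓝 0) := by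
      refine tendsto_order.2 ⟨fun a ha => Eventually.of_forall fun n =>
        ha.trans_le (integral_nonneg fun _ => abs_nonneg _), fun a ha => ?_⟩
      set κ := a / (2 * (2 * (2 * B) + 1)) with hκ
      have hκ0 : 0 < κ := by positivity
      have hκe : κ * (2 * (2 * B) + 1) = a / 2 := by rw [hκ]; field_simp
      obtain ⟨Cκ, hev⟩ := hbound κ hκ0
      have h2 := ((tendsto_const_nhds (x := B)).div_atTop hb.tendsto_mul).const_mul (Cκ * (2 * B))
      have h3 := hr'.add h2
      simp only [mul_zero, add_zero] at h3
      filter_upwards [hev, h3.eventually_lt_const (half_pos ha)] with n ⟨_, h4⟩ h5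
      rw [hκe] at h4
      linarith
    simpa using ENNReal.tendsto_ofReal this
  refine UnifTendsto.of_eventually_le fun δ hδ =>
    ⟨fun n => ENNReal.ofReal (∫ ω, |Y n ω| ∂μ) / ENNReal.ofReal δ, ?_, ?_⟩
  · simpa using ENNReal.Tendsto.div_const hlim (b := ENNReal.ofReal δ)
      (Or.inr (by simpa using hδ))
  -- Only the integrability of `Y n` is taken from this instance; the tolerance 1 is arbitrary.
  · obtain ⟨_, hev⟩ := hbound 1 one_pos
    filter_upwards [hev] with n ⟨hYi, _⟩
    have hset : {ω | ∃ v ∈ ({u} : Set ℝ), δ ≤ |localAvg p K n (b n) v (fun t =>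
        g (lags (p + 1) (fun s => X n s ω) t) -
          ∫ ω, g (lags (p + 1) (fun s => X n s ω) t) ∂μ)|} =
        {ω | ENNReal.ofReal δ ≤ ‖Y n ω‖ₑ} := by
      ext ω
      simp only [mem_singleton_iff, exists_eq_left, mem_ofPred_eq, hY]
      rw [Real.enorm_eq_ofReal_abs, ENNReal.ofReal_le_ofReal_iff (abs_nonneg _)]
    rw [hset]
    refine (meas_ge_le_lintegral_div hYi.aestronglyMeasurable.enorm (by simpa using hδ)
      ENNReal.ofReal_ne_top).trans_eq ?_
    congr 1
    rw [ofReal_integral_eq_lintegral_ofReal hYi.abs (Eventually.of_forall fun _ => abs_nonneg _)]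
    simp only [Real.enorm_eq_ofReal_abs]

end Setup

end LocStat

end

/-! ### From the law of large numbers to consistency -/

noncomputable section


namespace LocStat

lemma IsBVKernel.abs_le_mul_boxKernel {K V : ℝ → ℝ} {B : ℝ} (hK : IsBVKernel K V B) (x : ℝ) :
    |K x| ≤ B * boxKernel x := by
  by_cases hx : x ∈ Icc (-(1 / 2) : ℝ) (1 / 2)
  · rw [boxKernel, indicator_of_mem hx, mul_one]
    exact hK.abs_le x
  · rw [boxKernel, indicator_of_notMem hx, hK.support x hx]
    simp

/-- `K` may change sign; dominating by the box kernel leaves an average to which the law of large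
numbers applies again. -/
lemma IsBVKernel.abs_localAvg_le {K V : ℝ → ℝ} {B : ℝ} (hK : IsBVKernel K V B) (p n : ℕ) {b : ℝ}
    (hb : 0 < b) (u : ℝ) {f h : ℕ → ℝ} (hf : ∀ t, |f t| ≤ h t) :
    |localAvg p K n b u f| ≤ B * localAvg p boxKernel n b u h := by
  rw [localAvg, localAvg, abs_mul, abs_of_nonneg (by positivity), mul_left_comm, Finset.mul_sum]
  gcongr
  refine (Finset.abs_sum_le_sum_abs _ _).trans (Finset.sum_le_sum fun t _ => ?_)
  rw [scaled, scaled, abs_mul, abs_mul, abs_of_nonneg (by positivity : 0 ≤ 1 / b), ← mul_assoc,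
    mul_left_comm B]
  have h1 := hK.abs_le_mul_boxKernel (((t : ℝ) / n - u) / b)
  gcongr
  · exact mul_nonneg (by positivity) ((abs_nonneg _).trans h1)
  · exact hf t

lemma localAvg_const_mul (p : ℕ) (K : ℝ → ℝ) (n : ℕ) (b u a : ℝ) (f : ℕ → ℝ) :
    localAvg p K n b u (fun t => a * f t) = a * localAvg p K n b u f := by
  simp only [localAvg, Finset.mul_sum]
  exact Finset.sum_congr rfl fun t _ => by ring

/-- The envelope `1 + |z|_1^{M+1}` of the objective function in the parameter. -/
def envelope {r : ℕ} (M : ℝ) (z : Fin r → ℝ) : ℝ := 1 + l1 z ^ (M + 1)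

lemma classL_envelope {r : ℕ} {M : ℝ} (hM : 0 ≤ M) :
    ClassL univ M (M + 1) (envelope M : (Fin r → ℝ) → ℝ) := by
  refine ⟨hM, fun y hy y' hy' => ?_⟩
  simpa [envelope] using (classL_rpow hM).2 y hy y' hy'

lemma ClassLTilde.abs_sub_le {p d : ℕ} {Θ : Set (Fin d → ℝ)} {M Cz Cθ : ℝ}
    {ℓ : (Fin (p + 1) → ℝ) → (Fin d → ℝ) → ℝ} (hℓ : ClassLTilde Θ M Cz Cθ ℓ)
    (z : Fin (p + 1) → ℝ) {θ θ' : Fin d → ℝ} (hθ : θ ∈ Θ) (hθ' : θ' ∈ Θ) :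
    |ℓ z θ - ℓ z θ'| ≤ 3 * Cθ * l1 (θ - θ') * envelope M z := by
  have h := (hℓ.2.2.2.2 z).2 θ hθ θ' hθ'
  -- Power zero is one also at zero, hence the factor `1 + 1 + 1 = 3`.
  rw [Real.rpow_zero, Real.rpow_zero] at h
  refine h.trans_eq ?_
  rw [envelope]; ring

variable {Ω : Type*} [mΩ : MeasurableSpace Ω] {μ : Measure Ω} [IsProbabilityMeasure μ]
  {p d : ℕ} {ε : ℤ → Ω → ℝ} {F : ℝ → (Fin p → ℝ) → ℝ → ℝ}
  {q : ℝ} {χ : Fin p → ℝ} {C₁ : ℝ} {Xt : ℤ → ℝ → Ω → ℝ} {X : ℕ → ℤ → Ω → ℝ}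

/-- Uniform law of large numbers over the locations `U n` for every objective in `𝓛(M, ·)`. -/
def LocalLLN (p : ℕ) (μ : Measure Ω) (Xt : ℤ → ℝ → Ω → ℝ) (X : ℕ → ℤ → Ω → ℝ) (M : ℝ) (b : ℕ → ℝ)
    (U : ℕ → Set ℝ) : Prop :=
  ∀ (K V : ℝ → ℝ) (B C : ℝ) (g : (Fin (p + 1) → ℝ) → ℝ), IsBVKernel K V B → 0 ≤ C →
    ClassL univ M C g → UnifTendsto μ U (fun n u ω =>
      localAvg p K n (b n) u (fun t => g (lags (p + 1) (fun s => X n s ω) t)) -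
        ∫ ω, g (lags (p + 1) (fun s => Xt s u ω) 0) ∂μ)

namespace Setup

variable {A c α : ℝ} {M Cz Cθ : ℝ} {ℓ : (Fin (p + 1) → ℝ) → (Fin d → ℝ) → ℝ}
  {Θ : Set (Fin d → ℝ)} {b : ℕ → ℝ} {θ₀ : ℝ → (Fin d → ℝ)}

lemma localLLN_singleton (hS : Setup μ ε F q χ C₁ Xt X A c α) (hq : M + 1 ≤ q)
    (hb : IsBandwidth b) {u : ℝ} (hu : u ∈ Ioo (0 : ℝ) 1) :
    LocalLLN p μ Xt X M b (fun _ => {u}) := by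
  intro K V B C g hK hC hg
  have h0 : Tendsto (fun n => b n / 2) atTop (𝓝 0) := by simpa using hb.tendsto_zero.div_const 2
  refine ((hS.unifTendsto_centered_singleton hq hg hC hK hb ⟨hu.1.le, hu.2.le⟩).add
    (hS.unifTendsto_bias hq hg hC hK hb ?_)).congr fun n u ω => ?_
  · filter_upwards [h0.eventually_lt_const hu.1,
      h0.eventually_lt_const (sub_pos.2 hu.2)] with n h1 h2
    rw [singleton_subset_iff]
    exact ⟨h1.le, by linarith⟩
  · rw [localAvg_sub]; ring

lemma localLLN (hS : Setup μ ε F q χ C₁ Xt X A c α) (hq : M + 1 < q) (hb : IsBandwidth b)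
    (hbo : (fun n : ℕ => (b n)⁻¹) =o[atTop] (fun n : ℕ => (n : ℝ) ^ (1 - (M + 1) / q))) :
    LocalLLN p μ Xt X M b (fun n => Icc (b n / 2) (1 - b n / 2)) := by
  intro K V B C g hK hC hg
  refine ((hS.unifTendsto_centered hq hg hC hK hb hbo _).add
    (hS.unifTendsto_bias hq.le hg hC hK hb (Eventually.of_forall fun _ => Subset.rfl))).congr
    fun n u ω => ?_
  rw [localAvg_sub]; ring

lemma exists_integral_envelope_le (hS : Setup μ ε F q χ C₁ Xt X A c α) (hq : M + 1 ≤ q)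
    (hM : 0 ≤ M) : ∃ H : ℝ, 0 ≤ H ∧ ∀ u ∈ Icc (0 : ℝ) 1,
      Integrable (fun ω => envelope M (lags (p + 1) (fun s => Xt s u ω) 0)) μ ∧
      ∫ ω, envelope M (lags (p + 1) (fun s => Xt s u ω) 0) ∂μ ≤ H := by
  have hR := hS.model.bound_nonneg
  have hM1 : 0 ≤ M + 1 := by linarith
  have hΛ := lipConst_nonneg (r := p + 1) (M := M) hM1 hR
  refine ⟨|envelope M (0 : Fin (p + 1) → ℝ)| + lipConst (p + 1) M (M + 1) (Model.bound χ C₁) *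
    Model.bound χ C₁, by positivity, fun u hu => ?_⟩
  obtain ⟨hi, hle⟩ := hS.integrable_Xt hq (classL_envelope hM) hM1 hu 0
  exact ⟨hi, (integral_mono hi hi.abs fun _ => le_abs_self _).trans hle⟩

/-- The moment bounds do not depend on the location, so one `H` serves all `u`, both for the mean
envelope and for the Lipschitz constant of the limit. -/
lemma exists_abs_limitLik_sub_le (hS : Setup μ ε F q χ C₁ Xt X A c α) (hq : M + 1 ≤ q)
    (hℓ : ClassLTilde Θ M Cz Cθ ℓ) : ∃ H : ℝ, 0 ≤ H ∧ ∀ u ∈ Icc (0 : ℝ) 1,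
      ∫ ω, envelope M (lags (p + 1) (fun s => Xt s u ω) 0) ∂μ ≤ H ∧
      ∀ θ ∈ Θ, ∀ θ' ∈ Θ,
        |limitLik μ Xt ℓ u θ - limitLik μ Xt ℓ u θ'| ≤ 3 * Cθ * l1 (θ - θ') * H := by
  obtain ⟨H, hH, hHu⟩ := hS.exists_integral_envelope_le hq hℓ.1
  refine ⟨H, hH, fun u hu => ⟨(hHu u hu).2, fun θ hθ θ' hθ' => ?_⟩⟩
  obtain ⟨hi, hle⟩ := hHu u hu
  have hCθ := hℓ.2.2.1
  have hi1 := (hS.integrable_Xt hq (hℓ.2.2.2.1 θ hθ) hℓ.2.1 hu 0).1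
  have hi2 := (hS.integrable_Xt hq (hℓ.2.2.2.1 θ' hθ') hℓ.2.1 hu 0).1
  rw [limitLik, limitLik, ← integral_sub hi1 hi2]
  refine abs_integral_le_integral_abs.trans ?_
  refine (integral_mono (hi1.sub hi2).abs (hi.const_mul (3 * Cθ * l1 (θ - θ')))
    fun ω => hℓ.abs_sub_le _ hθ hθ').trans ?_
  rw [integral_const_mul]
  have := l1_nonneg (θ - θ')
  gcongr

/-- Hölder in `u` with a constant uniform in `θ`, from the distance between stationary solutions,
and Lipschitz in `θ` uniformly in `u`. -/
lemma continuousOn_limitLik (hS : Setup μ ε F q χ C₁ Xt X A c α) (hq : M + 1 ≤ q)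
    (hℓ : ClassLTilde Θ M Cz Cθ ℓ) :
    ContinuousOn (fun x : ℝ × (Fin d → ℝ) => limitLik μ Xt ℓ x.1 x.2) (Icc (0 : ℝ) 1 ×ˢ Θ) := by
  obtain ⟨H, hH, hHu⟩ := hS.exists_abs_limitLik_sub_le hq hℓ
  rintro ⟨u, θ⟩ ⟨hu, hθ⟩
  rw [ContinuousWithinAt, tendsto_iff_dist_tendsto_zero]
  have hα := hS.exponent_pos
  set Λ := lipConst (p + 1) M Cz (Model.bound χ C₁)
  have hcont : Continuous fun x : ℝ × (Fin d → ℝ) =>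
      Λ * (A * |x.1 - u| ^ α) + 3 * Cθ * l1 (x.2 - θ) * H := by
    have h1 : Continuous fun x : ℝ × (Fin d → ℝ) => |x.1 - u| ^ α :=
      (by fun_prop : Continuous fun x : ℝ × (Fin d → ℝ) => |x.1 - u|).rpow_const
        fun _ => Or.inr hα.le
    have h2 : Continuous fun x : ℝ × (Fin d → ℝ) => l1 (x.2 - θ) :=
      continuous_l1.comp (by fun_prop)
    fun_prop
  have hlim := (hcont.tendsto (u, θ)).mono_left (nhdsWithin_le_nhds (s := Icc (0 : ℝ) 1 ×ˢ Θ))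
  have h0 : Λ * (A * |u - u| ^ α) + 3 * Cθ * l1 (θ - θ) * H = 0 := by
    simp [l1, Real.zero_rpow hα.ne']
  simp only [h0] at hlim
  refine squeeze_zero' (Eventually.of_forall fun _ => dist_nonneg) ?_ hlim
  filter_upwards [self_mem_nhdsWithin] with x hx
  rw [Real.dist_eq]
  refine (abs_sub_le _ (limitLik μ Xt ℓ u x.2) _).trans (add_le_add ?_ ?_)
  · exact hS.abs_integral_Xt_sub_le hq (hℓ.2.2.2.1 x.2 hx.2) hℓ.2.1 hx.1 hu
  · exact (hHu u hu).2 x.2 hx.2 θ hθ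

/-- The limit likelihood separates the true parameter from its complement, uniformly. -/
lemma exists_separation (hS : Setup μ ε F q χ C₁ Xt X A c α) (hq : M + 1 ≤ q)
    (hℓ : ClassLTilde Θ M Cz Cθ ℓ) (hΘ : IsCompact Θ) {U : Set ℝ} (hU : IsCompact U)
    (hU1 : U ⊆ Icc 0 1) (hθ : ContinuousOn θ₀ U) (hmem : ∀ u ∈ U, θ₀ u ∈ Θ)
    (hmin : ∀ u ∈ U, ∀ θ ∈ Θ, θ ≠ θ₀ u → limitLik μ Xt ℓ u (θ₀ u) < limitLik μ Xt ℓ u θ)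
    {δ : ℝ} (hδ : 0 < δ) :
    ∃ κ > 0, ∀ u ∈ U, ∀ θ ∈ Θ, δ ≤ l1 (θ - θ₀ u) →
      limitLik μ Xt ℓ u (θ₀ u) + κ ≤ limitLik μ Xt ℓ u θ := by
  have hL := hS.continuousOn_limitLik hq hℓ
  have hc := hU.prod hΘ
  have hfst : ContinuousOn (fun x : ℝ × (Fin d → ℝ) => θ₀ x.1) (U ×ˢ Θ) :=
    hθ.comp continuousOn_fst fun x hx => hx.1
  have hdist : ContinuousOn (fun x : ℝ × (Fin d → ℝ) => l1 (x.2 - θ₀ x.1)) (U ×ˢ Θ) :=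
    continuous_l1.comp_continuousOn (continuousOn_snd.sub hfst)
  -- On this compact set the excess of the limit over its minimum is continuous and positive, so its
  -- least value is the gap; if the set is empty any gap will do.
  have hZ : IsCompact ((U ×ˢ Θ) ∩ (fun x : ℝ × (Fin d → ℝ) => l1 (x.2 - θ₀ x.1)) ⁻¹' Ici δ) :=
    hc.of_isClosed_subset (hdist.preimage_isClosed_of_isClosed hc.isClosed isClosed_Ici)
      inter_subset_left
  have hφ : ContinuousOn (fun x : ℝ × (Fin d → ℝ) =>
      limitLik μ Xt ℓ x.1 x.2 - limitLik μ Xt ℓ x.1 (θ₀ x.1)) (U ×ˢ Θ) :=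
    (hL.mono (prod_mono hU1 Subset.rfl)).sub
      (hL.comp (continuousOn_fst.prodMk hfst) fun x hx => ⟨hU1 hx.1, hmem _ hx.1⟩)
  rcases eq_empty_or_nonempty
    ((U ×ˢ Θ) ∩ (fun x : ℝ × (Fin d → ℝ) => l1 (x.2 - θ₀ x.1)) ⁻¹' Ici δ) with he | hne
  · refine ⟨1, one_pos, fun u hu θ hθ' hle => ?_⟩
    have : (u, θ) ∈ (∅ : Set (ℝ × (Fin d → ℝ))) := he ▸ ⟨⟨hu, hθ'⟩, hle⟩
    exact this.elim
  · obtain ⟨x, hx, hxmin⟩ := hZ.exists_isMinOn hne (hφ.mono inter_subset_left)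
    refine ⟨_, sub_pos.2 (hmin x.1 hx.1.1 x.2 hx.1.2 fun he => ?_), fun u hu θ hθ' hle => ?_⟩
    · have h1 : δ ≤ l1 (x.2 - θ₀ x.1) := hx.2
      rw [he, sub_self] at h1
      simp only [l1, Pi.zero_apply, abs_zero, Finset.sum_const_zero] at h1
      linarith
    · have h1 := isMinOn_iff.1 hxmin (u, θ) ⟨⟨hu, hθ'⟩, hle⟩
      simp only at h1
      linarith

/-- Uniform convergence of the local likelihood in location and parameter. -/
lemma tendsto_localLik (hS : Setup μ ε F q χ C₁ Xt X A c α) (hq : M + 1 ≤ q)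
    (hℓ : ClassLTilde Θ M Cz Cθ ℓ) (hΘ : IsCompact Θ) {K : ℝ → ℝ} (hK : IsKernel K)
    (hb : IsBandwidth b) {U : ℕ → Set ℝ} (hU : ∀ n, U n ⊆ Icc 0 1)
    (hlln : LocalLLN p μ Xt X M b U) {δ : ℝ} (hδ : 0 < δ) :
    Tendsto (fun n => μ {ω | ∃ u ∈ U n, ∃ θ ∈ Θ,
      δ ≤ |localLik K ℓ n (b n) (fun t => X n t ω) u θ - limitLik μ Xt ℓ u θ|}) atTop (𝓝 0) := by
  obtain ⟨V, B, hK⟩ := hK.exists_bv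
  obtain ⟨V', B', hbox⟩ := boxKernel_bv
  obtain ⟨H, hH, hHu⟩ := hS.exists_abs_limitLik_sub_le hq hℓ
  have hB := hK.bound_nonneg
  have hCθ := hℓ.2.2.1
  -- `η a` bounds the joint oscillation of the empirical and limit objectives over distance `η`, as
  -- long as the averaged envelope stays below `H + 1`.
  set a := 3 * Cθ * (B * (H + 1) + H) with ha
  have ha0 : 0 ≤ a := by positivity
  set η := δ / (2 * (a + 1)) with hη
  have hη0 : 0 < η := by positivity
  have hηa : η * a ≤ δ / 2 := by
    have : η * (a + 1) = δ / 2 := by rw [hη]; field_simp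
    nlinarith
  -- Errors below `δ / 4` at the net points and an oscillation of at most `δ / 2` leave less than
  -- `δ`.
  obtain ⟨T, hTΘ, hT⟩ := hΘ.elim_nhds_subcover (fun θ => {θ' | l1 (θ' - θ) < η}) fun θ _ =>
    (isOpen_lt (continuous_l1.comp (by fun_prop)) continuous_const).mem_nhds (by simp [l1, hη0])
  set lik : ℕ → ℝ → (Fin d → ℝ) → Ω → ℝ := fun n u θ ω =>
    localLik K ℓ n (b n) (fun t => X n t ω) u θ with hlik
  set Hn : ℕ → ℝ → Ω → ℝ := fun n u ω => localAvg p boxKernel n (b n) u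
    (fun t => envelope M (lags (p + 1) (fun s => X n s ω) t)) with hHn
  have hosc : ∀ n u ω, ∀ θ ∈ Θ, ∀ θ' ∈ Θ,
      |lik n u θ ω - lik n u θ' ω| ≤ 3 * Cθ * l1 (θ - θ') * (B * Hn n u ω) := by
    intro n u ω θ hθ θ' hθ'
    have h1 := hK.abs_localAvg_le p n (hb.mem n).1 u
      (f := fun t => ℓ (lags (p + 1) (fun s => X n s ω) t) θ -
        ℓ (lags (p + 1) (fun s => X n s ω) t) θ')
      (h := fun t => 3 * Cθ * l1 (θ - θ') * envelope M (lags (p + 1) (fun s => X n s ω) t))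
      (fun t => hℓ.abs_sub_le _ hθ hθ')
    rw [localAvg_sub, localAvg_const_mul] at h1
    exact h1.trans_eq (by ring)
  have hnet : Tendsto (fun n => ∑ θ ∈ T, μ {ω | ∃ u ∈ U n, δ / 4 ≤
      |lik n u θ ω - limitLik μ Xt ℓ u θ|}) atTop (𝓝 0) := by
    rw [← Finset.sum_const_zero (s := T)]
    exact tendsto_finsetSum _ fun θ hθ => hlln K V B Cz (fun z => ℓ z θ) hK hℓ.2.1
      (hℓ.2.2.2.1 θ (hTΘ θ hθ)) (δ / 4) (by positivity)
  have henv := hlln boxKernel V' B' (M + 1) (envelope M) hbox (by linarith [hℓ.1])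
    (classL_envelope hℓ.1) 1 one_pos
  have hsum := hnet.add henv
  rw [add_zero] at hsum
  refine tendsto_of_tendsto_of_tendsto_of_le_of_le tendsto_const_nhds hsum (fun _ => zero_le)
    fun n => ?_
  refine (measure_mono ?_).trans ((measure_union_le _ _).trans
    (add_le_add (measure_biUnion_finset_le T _) le_rfl))
  rintro ω ⟨u, hu, θ, hθ, hle⟩
  by_contra hcon
  simp only [mem_union, mem_iUnion, mem_ofPred_eq, not_or, not_exists, not_and, not_le] at hcon
  obtain ⟨θ', hθ'T, hθθ'⟩ : ∃ θ' ∈ T, l1 (θ - θ') < η := by simpa using hT hθ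
  have h1 := hcon.1 θ' hθ'T u hu
  have h2 := (abs_lt.1 (hcon.2 u hu)).2
  obtain ⟨hHle, hLip⟩ := hHu u (hU n hu)
  have hHn1 : Hn n u ω ≤ H + 1 := by simp only [hHn]; linarith
  have h3 := hosc n u ω θ hθ θ' (hTΘ θ' hθ'T)
  have h4 := hLip θ hθ θ' (hTΘ θ' hθ'T)
  have hl := l1_nonneg (θ - θ')
  have h5 : 3 * Cθ * l1 (θ - θ') * (B * Hn n u ω) ≤ 3 * Cθ * η * (B * (H + 1)) := by
    have h6 : B * Hn n u ω ≤ B * (H + 1) := by gcongr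
    calc _ ≤ 3 * Cθ * l1 (θ - θ') * (B * (H + 1)) := by gcongr
      _ ≤ _ := by gcongr
  have h7 : 3 * Cθ * l1 (θ - θ') * H ≤ 3 * Cθ * η * H := by gcongr
  have h8 : 3 * Cθ * η * (B * (H + 1)) + 3 * Cθ * η * H = η * a := by rw [ha]; ring
  have h9 := abs_sub_le (lik n u θ ω) (lik n u θ' ω) (limitLik μ Xt ℓ u θ)
  have h10 := abs_sub_le (lik n u θ' ω) (limitLik μ Xt ℓ u θ') (limitLik μ Xt ℓ u θ)
  rw [abs_sub_comm (limitLik μ Xt ℓ u θ')] at h10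
  change δ ≤ |lik n u θ ω - limitLik μ Xt ℓ u θ| at hle
  linarith

/-- Consistency of minimisers of the local likelihood over a compact set of locations. -/
lemma tendsto_localMLE (hS : Setup μ ε F q χ C₁ Xt X A c α) (hq : M + 1 ≤ q)
    (hℓ : ClassLTilde Θ M Cz Cθ ℓ) (hΘ : IsCompact Θ) {K : ℝ → ℝ} (hK : IsKernel K)
    (hb : IsBandwidth b) {U : ℕ → Set ℝ} {U₀ : Set ℝ} (hU₀ : IsCompact U₀) (hU1 : U₀ ⊆ Icc 0 1)
    (hU : ∀ n, U n ⊆ U₀) (hlln : LocalLLN p μ Xt X M b U) (hθ : ContinuousOn θ₀ U₀)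
    (hmem : ∀ u ∈ U₀, θ₀ u ∈ Θ)
    (hmin : ∀ u ∈ U₀, ∀ θ ∈ Θ, θ ≠ θ₀ u → limitLik μ Xt ℓ u (θ₀ u) < limitLik μ Xt ℓ u θ)
    {θhat : ℕ → ℝ → Ω → (Fin d → ℝ)} (hhat : IsLocalMLE K ℓ Θ X b θhat) {δ : ℝ} (hδ : 0 < δ) :
    Tendsto (fun n => μ {ω | ∃ u ∈ U n, δ ≤ l1 (θhat n u ω - θ₀ u)}) atTop (𝓝 0) := by
  obtain ⟨κ, hκ, hsep⟩ := hS.exists_separation hq hℓ hΘ hU₀ hU1 hθ hmem hmin hδ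
  refine tendsto_of_tendsto_of_tendsto_of_le_of_le tendsto_const_nhds
    (hS.tendsto_localLik hq hℓ hΘ hK hb (fun n => (hU n).trans hU1) hlln (half_pos hκ))
    (fun _ => zero_le) fun n => measure_mono ?_
  rintro ω ⟨u, hu, hle⟩
  have huU := hU n hu
  obtain ⟨hhΘ, hhmin⟩ := hhat n u (hU1 huU) ω
  have h1 := hhmin (θ₀ u) (hmem u huU)
  have h2 := hsep u huU _ hhΘ hle
  -- Errors below `κ / 2` at the minimiser and at `θ₀ u` would put the limit at the minimiser below
  -- its minimum plus `κ`, against the gap.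
  by_contra hcon
  simp only [mem_ofPred_eq, not_exists, not_and, not_le] at hcon
  have h3 := abs_lt.1 (hcon u hu _ hhΘ)
  have h4 := abs_lt.1 (hcon u hu _ (hmem u huU))
  linarith [h3.1, h4.2]

end Setup

lemma exists_setup (hε : IsIIDInnovations μ ε)
    (hF : ∀ u ∈ Icc (0 : ℝ) 1, Measurable (fun x : ℝ × (Fin p → ℝ) => F x.1 x.2 u))
    (hXt : IsStationaryApprox μ ε F Xt) (hX : IsLocallyStationary μ ε F Xt X) (hq : 1 ≤ q)
    (hL1 : CondL1 μ ε F q) (hL4 : CondL4 μ ε F Xt q) :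
    ∃ χ C₁ A c α, Setup μ ε F q χ C₁ Xt X A c α := by
  obtain ⟨χ, C₁, hm⟩ := hL1.exists_model hq hε hF
  obtain ⟨A, c, α, hA, hc, hα, h1, h2⟩ := exists_approx hm hXt hX hL4
  exact ⟨χ, C₁, A, c, α, hm, hXt, hX, hA, hc, hα, h1, h2⟩

end LocStat

end

/-! ### The two consistency statements -/

theorem theorem5p2 {Ω : Type*} [MeasurableSpace Ω] (μ : Measure Ω) [IsProbabilityMeasure μ]
    {p d : ℕ}
    -- innovations, parameter set, parameter curve and model function
    (ε : ℤ → Ω → ℝ) (hε : LocStat.IsIIDInnovations μ ε)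
    (Θ : Set (Fin d → ℝ)) (hΘ : IsCompact Θ)
    (θ₀ : ℝ → (Fin d → ℝ))
    (G : ℝ → (Fin p → ℝ) → (Fin d → ℝ) → ℝ)
    (hG : ∀ θ ∈ Θ, Measurable (fun x : ℝ × (Fin p → ℝ) => G x.1 x.2 θ))
    -- the stationary approximation and the locally stationary process
    (Xt : ℤ → ℝ → Ω → ℝ)
    (hXt : LocStat.IsStationaryApprox μ ε (fun e y u => G e y (θ₀ u)) Xt)
    (X : ℕ → ℤ → Ω → ℝ)
    (hX : LocStat.IsLocallyStationary μ ε (fun e y u => G e y (θ₀ u)) Xt X)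
    -- kernel and objective function
    (K : ℝ → ℝ) (hK : LocStat.IsKernel K)
    (M Cz Cθ : ℝ) (ℓ : (Fin (p + 1) → ℝ) → (Fin d → ℝ) → ℝ)
    (hℓ : LocStat.ClassLTilde Θ M Cz Cθ ℓ)
    -- (L1) and (L4) with `q = M + 1`
    (hL1 : LocStat.CondL1 μ ε (fun e y u => G e y (θ₀ u)) (M + 1))
    (hL4 : LocStat.CondL4 μ ε (fun e y u => G e y (θ₀ u)) Xt (M + 1))
    -- `θ₀ u` is an interior point and the unique minimiser of the limit likelihood
    (hint : ∀ u ∈ Icc (0 : ℝ) 1, θ₀ u ∈ interior Θ)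
    (hmin : ∀ u ∈ Icc (0 : ℝ) 1, ∀ θ ∈ Θ, θ ≠ θ₀ u →
      LocStat.limitLik μ Xt ℓ u (θ₀ u) < LocStat.limitLik μ Xt ℓ u θ) :
    (∀ (b : ℕ → ℝ), LocStat.IsBandwidth b →
      ∀ (θhat : ℕ → ℝ → Ω → (Fin d → ℝ)), LocStat.IsLocalMLE K ℓ Θ X b θhat →
      ∀ u ∈ Ioo (0 : ℝ) 1,
        TendstoInMeasure μ (fun n ω => θhat n u ω) atTop (fun _ => θ₀ u)) ∧
    (∀ (q : ℝ), M + 1 < q →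
      LocStat.CondL1 μ ε (fun e y u => G e y (θ₀ u)) q →
      LocStat.CondL4 μ ε (fun e y u => G e y (θ₀ u)) Xt q →
      ContinuousOn θ₀ (Icc (0 : ℝ) 1) →
      ∀ (b : ℕ → ℝ), LocStat.IsBandwidth b →
      ((fun n : ℕ => (b n)⁻¹) =o[atTop] (fun n : ℕ => (n : ℝ) ^ (1 - (M + 1) / q))) →
      ∀ (θhat : ℕ → ℝ → Ω → (Fin d → ℝ)), LocStat.IsLocalMLE K ℓ Θ X b θhat →
        TendstoInMeasure μ
          (fun n ω => ⨆ u : Icc (b n / 2) (1 - b n / 2),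
            LocStat.l1 (θhat n (u : ℝ) ω - θ₀ (u : ℝ)))
          atTop (fun _ => (0 : ℝ))) := by
  have hmem : ∀ u ∈ Icc (0 : ℝ) 1, θ₀ u ∈ Θ := fun u hu => interior_subset (hint u hu)
  have hF : ∀ u ∈ Icc (0 : ℝ) 1, Measurable (fun x : ℝ × (Fin p → ℝ) => G x.1 x.2 (θ₀ u)) :=
    fun u hu => hG _ (hmem u hu)
  have hM : 0 ≤ M := hℓ.1
  constructor
  · intro b hb θhat hhat u hu
    obtain ⟨χ, C₁, A, c, α, hS⟩ :=
      LocStat.exists_setup hε hF hXt hX (by linarith : 1 ≤ M + 1) hL1 hL4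
    have huI : {u} ⊆ Icc (0 : ℝ) 1 := singleton_subset_iff.2 ⟨hu.1.le, hu.2.le⟩
    refine tendstoInMeasure_of_ne_top fun δ hδ hδt => ?_
    -- With the single location `u` as compact set, continuity of `θ₀` is automatic.
    have h := hS.tendsto_localMLE le_rfl hℓ hΘ hK hb isCompact_singleton huI
      (fun _ => Subset.rfl) (hS.localLLN_singleton le_rfl hb hu) (continuousOn_singleton θ₀ u)
      (fun v hv => hmem v (huI hv)) (fun v hv => hmin v (huI hv)) hhat
      (ENNReal.toReal_pos hδ.ne' hδt)
    refine tendsto_of_tendsto_of_tendsto_of_le_of_le tendsto_const_nhds h (fun _ => zero_le)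
      fun n => measure_mono fun ω hω => ⟨u, rfl, ?_⟩
    -- Convergence in measure refers to the sup distance, which `l1` dominates.
    have h1 : δ.toReal ≤ dist (θhat n u ω) (θ₀ u) := by
      rw [dist_edist]
      exact ENNReal.toReal_mono (edist_ne_top _ _) hω
    refine h1.trans ((dist_pi_le_iff (LocStat.l1_nonneg _)).2 fun i => ?_)
    exact LocStat.abs_le_l1 (θhat n u ω - θ₀ u) i
  · intro q hq hL1' hL4' hcont b hb hbo θhat hhat
    obtain ⟨χ, C₁, A, c, α, hS⟩ :=
      LocStat.exists_setup hε hF hXt hX (by linarith : 1 ≤ q) hL1' hL4'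
    refine tendstoInMeasure_of_ne_top fun δ hδ hδt => ?_
    have hδ0 := ENNReal.toReal_pos hδ.ne' hδt
    have h := hS.tendsto_localMLE hq.le hℓ hΘ hK hb isCompact_Icc Subset.rfl
      (fun n => Icc_subset_Icc (by linarith [(hb.mem n).1]) (by linarith [(hb.mem n).1]))
      (hS.localLLN hq hb hbo) hcont hmem hmin hhat (half_pos hδ0)
    refine tendsto_of_tendsto_of_tendsto_of_le_of_le tendsto_const_nhds h (fun _ => zero_le)
      fun n => measure_mono fun ω hω => ?_
    by_contra hcon
    simp only [mem_ofPred_eq, not_exists, not_and, not_le] at hcon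
    -- Values below `δ / 2` give a supremum of at most `δ / 2`, strictly below `δ`. They also bound
    -- the family, so the default value of an unbounded real supremum plays no role.
    have hsup : (⨆ u : Icc (b n / 2) (1 - b n / 2),
        LocStat.l1 (θhat n (u : ℝ) ω - θ₀ (u : ℝ))) ≤ δ.toReal / 2 :=
      Real.iSup_le (fun u => (hcon u u.2).le) (half_pos hδ0).le
    have hsup0 := Real.iSup_nonneg (f := fun u : Icc (b n / 2) (1 - b n / 2) =>
      LocStat.l1 (θhat n (u : ℝ) ω - θ₀ (u : ℝ))) fun u => LocStat.l1_nonneg _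
    have h1 : δ.toReal ≤ dist (⨆ u : Icc (b n / 2) (1 - b n / 2),
        LocStat.l1 (θhat n (u : ℝ) ω - θ₀ (u : ℝ))) 0 := by
      rw [dist_edist]
      exact ENNReal.toReal_mono (edist_ne_top _ _) hω
    rw [Real.dist_eq, sub_zero, abs_of_nonneg hsup0] at h1
    linarith
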